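/- Let $(M,\omega)$ be a compact connected (Hausdorff, effective) symplectic orbifold of dimension $2n\ge 2$ with an effective smooth symplectic action of the torus $T=\mathbb{R}^n/\mathbb{Z}^n$ with Lie algebra $\mathfrak t=\mathbb{R}^n$, and let $x:M\to\mathfrak t^*$ be a moment map, that is, a smooth map with $-d\langle x,b\rangle=\omega(X_b,\cdot)$ for every $b\in\mathfrak t$, where $X_b$ is the vector field induced by the one-parameter subgroup generated by $b$. Let $(g,J)$ be a toric Kähler structure on $(M,\omega,T)$: a $T$-invariant Riemannian metric $g$ and a $T$-invariant integrable almost complex structure $J$ with $\omega=g(J\cdot,\cdot)$. Let $\Delta^g=-\operatorname{div}^g\operatorname{grad}^g$ be the Laplacian and $\rho^g=\mathrm{Ric}^g(J\cdot,\cdot)$ the Ricci form. Let $\lambda\in\mathbb{R}$. Then $(M,g,J,\omega)$ is Kähler–Einstein with Einstein constant $\lambda$, i.e. $\rho^g=\lambda\omega$, if and only if, up to an additive constant, the moment map satisfies $\Delta^g\langle x,b\rangle=2\lambda\langle x,b\rangle$ for all $b\in\mathfrak t$; that is, if and only if there is $\alpha\in\mathfrak t^*$ such that $$\Delta^g\langle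 x+\alpha,b\rangle=2\lambda\,\langle x+\alpha,b\rangle\qquad\text{for all } b\in\mathfrak t .$$ In this case, $2\lambda$ is the smallest non-vanishing eigenvalue of $\Delta^g$ acting on smooth functions on $M$. -/

import Mathlib

open scoped ContDiff Topology Matrix

noncomputable section

/-! ### Calculus of tensors in a coordinate domain of `ℝ^m`

Tensors are given by their matrices of components. -/

namespace Coord

variable {m : ℕ}

/-- The partial derivative `∂_k f` at `z`. -/
def pderiv (k : Fin m) (f : (Fin m → ℝ) → ℝ) (z : Fin m → ℝ) : ℝ :=
  fderiv ℝ f z (Pi.single k 1)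

/-- The Jacobian matrix `(∂_b h^a)_{a b}` of `h` at `z`. -/
def jacobian (h : (Fin m → ℝ) → (Fin m → ℝ)) (z : Fin m → ℝ) : Matrix (Fin m) (Fin m) ℝ :=
  Matrix.of fun a b => pderiv b (fun y => h y a) z

/-- The Christoffel symbol `Γ^k_{a b}` of the Levi-Civita connection of the metric `g`. -/
def christoffel (g : (Fin m → ℝ) → Matrix (Fin m) (Fin m) ℝ) (k a b : Fin m)
    (z : Fin m → ℝ) : ℝ :=
  (1 / 2) * ∑ l, (g z)⁻¹ k l *
    (pderiv a (fun y => g y b l) z + pderiv b (fun y => g y a l) z - pderiv l (fun y => g y a b) z)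

/-- The component `dx^d (R(∂_a, ∂_b) ∂_c)` of the Riemann curvature tensor
`R(X, Y) Z = ∇_X ∇_Y Z - ∇_Y ∇_X Z - ∇_[X, Y] Z`. -/
def riemann (g : (Fin m → ℝ) → Matrix (Fin m) (Fin m) ℝ) (d a b c : Fin m)
    (z : Fin m → ℝ) : ℝ :=
  pderiv a (christoffel g d b c) z - pderiv b (christoffel g d a c) z
    + ∑ e, (christoffel g d a e z * christoffel g e b c z
      - christoffel g d b e z * christoffel g e a c z)

/-- The Ricci tensor `Ric(Y, Z) = tr (X ↦ R(X, Y) Z)`. -/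
def ricci (g : (Fin m → ℝ) → Matrix (Fin m) (Fin m) ℝ) (z : Fin m → ℝ) :
    Matrix (Fin m) (Fin m) ℝ :=
  Matrix.of fun b c => ∑ a, riemann g a a b c z

/-- The components of the Riemannian gradient of `f`. -/
def grad (g : (Fin m → ℝ) → Matrix (Fin m) (Fin m) ℝ) (f : (Fin m → ℝ) → ℝ)
    (z : Fin m → ℝ) : Fin m → ℝ :=
  fun k => ∑ l, (g z)⁻¹ k l * pderiv l f z

/-- The Riemannian divergence `tr (∇ X)` of a vector field `X`. -/
def divergence (g : (Fin m → ℝ) → Matrix (Fin m) (Fin m) ℝ)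
    (X : (Fin m → ℝ) → (Fin m → ℝ)) (z : Fin m → ℝ) : ℝ :=
  ∑ k, (pderiv k (fun y => X y k) z + ∑ l, christoffel g k k l z * X z l)

/-- The (nonnegative) Laplacian `Δ f = - div (grad f)`. -/
def laplacian (g : (Fin m → ℝ) → Matrix (Fin m) (Fin m) ℝ) (f : (Fin m → ℝ) → ℝ)
    (z : Fin m → ℝ) : ℝ :=
  - divergence g (grad g f) z

/-- The component `(dσ)_{a b c}` of the exterior derivative of the two-form `σ`. -/
def extDeriv₂ (σ : (Fin m → ℝ) → Matrix (Fin m) (Fin m) ℝ) (a b c : Fin m)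
    (z : Fin m → ℝ) : ℝ :=
  pderiv a (fun y => σ y b c) z + pderiv b (fun y => σ y c a) z + pderiv c (fun y => σ y a b) z

/-- The component `N^c_{a b}` of the Nijenhuis tensor
`N(X, Y) = [J X, J Y] - J [J X, Y] - J [X, J Y] + J² [X, Y]` of an endomorphism field `J`. -/
def nijenhuis (J : (Fin m → ℝ) → Matrix (Fin m) (Fin m) ℝ) (c a b : Fin m)
    (z : Fin m → ℝ) : ℝ :=
  ∑ d, (J z d a * pderiv d (fun y => J y c b) z - J z d b * pderiv d (fun y => J y c a) z
    - J z c d * (pderiv a (fun y => J y d b) z - pderiv b (fun y => J y d a) z))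

end Coord

/-! ### Orbifolds -/

/-- A smooth `m`-dimensional orbifold chart on `M`: a connected open set `dom` of `ℝ^m`, a finite
group `group` of diffeomorphisms of `dom`, and a map `proj` which induces a homeomorphism of
`dom / group` onto an open subset of `M`. Only the values of `proj` on `dom` matter. -/
structure OrbifoldChart (m : ℕ) (M : Type*) [TopologicalSpace M] where
  dom : Set (Fin m → ℝ)
  isOpen_dom : IsOpen dom
  isConnected_dom : IsConnected dom
  group : Subgroup (Equiv.Perm dom)
  finite_group : Finite group
  smooth_group : ∀ γ ∈ group, ∃ f : (Fin m → ℝ) → (Fin m → ℝ),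
    ContDiffOn ℝ ∞ f dom ∧ ∀ z : dom, f z = γ z
  proj : (Fin m → ℝ) → M
  continuousOn_proj : ContinuousOn proj dom
  isOpen_image_proj : ∀ V ⊆ dom, IsOpen V → IsOpen (proj '' V)
  proj_eq_iff : ∀ z w : dom, proj z = proj w ↔ ∃ γ ∈ group, γ z = w

/-- `h` is a diffeomorphism between open subsets of the domains of the charts `c` and `c'` which
lifts the self-map `p` of `M`. -/
structure IsLocalLift {m : ℕ} {M : Type*} [TopologicalSpace M] (p : M → M)
    (c c' : OrbifoldChart m M) (h : OpenPartialHomeomorph (Fin m → ℝ) (Fin m → ℝ)) : Prop where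
  source_subset : h.source ⊆ c.dom
  target_subset : h.target ⊆ c'.dom
  contDiffOn : ContDiffOn ℝ ∞ h h.source
  contDiffOn_symm : ContDiffOn ℝ ∞ h.symm h.target
  proj_apply : ∀ z ∈ h.source, c'.proj (h z) = p (c.proj z)

/-- A smooth `m`-dimensional (effective) orbifold structure on the space `M`, given by an atlas
indexed by `ι`. -/
structure OrbifoldAtlas (ι : Type*) (m : ℕ) (M : Type*) [TopologicalSpace M] where
  chart : ι → OrbifoldChart m M
  cover : ∀ p : M, ∃ i, ∃ z ∈ (chart i).dom, (chart i).proj z = p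
  compatible : ∀ i j, ∀ z ∈ (chart i).dom, ∀ w ∈ (chart j).dom,
    (chart i).proj z = (chart j).proj w →
      ∃ h, IsLocalLift id (chart i) (chart j) h ∧ z ∈ h.source ∧ h z = w

namespace OrbifoldAtlas

variable {ι : Type*} {m : ℕ} {M : Type*} [TopologicalSpace M]

/-- Smooth functions on an orbifold. -/
def IsSmooth (A : OrbifoldAtlas ι m M) (f : M → ℝ) : Prop :=
  ∀ i, ContDiffOn ℝ ∞ (fun z => f ((A.chart i).proj z)) (A.chart i).dom

/-- The components in each chart depend smoothly on the point. -/
def SmoothComponents (A : OrbifoldAtlas ι m M)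
    (S : ι → (Fin m → ℝ) → Matrix (Fin m) (Fin m) ℝ) : Prop :=
  ∀ i a b, ContDiffOn ℝ ∞ (fun z => S i z a b) (A.chart i).dom

/-- The field of bilinear forms `S` is preserved by the self-map `p` of the orbifold:
`p^* S = S`. For `p = id` this is the compatibility of the expressions of `S` in the charts. -/
def PreservesForm (A : OrbifoldAtlas ι m M) (p : M → M)
    (S : ι → (Fin m → ℝ) → Matrix (Fin m) (Fin m) ℝ) : Prop :=
  ∀ i j h, IsLocalLift p (A.chart i) (A.chart j) h → ∀ z ∈ h.source,
    (Coord.jacobian h z)ᵀ * S j (h z) * Coord.jacobian h z = S i z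

/-- The field of endomorphisms `S` is preserved by the self-map `p` of the orbifold. For `p = id`
this is the compatibility of the expressions of `S` in the charts. -/
def PreservesEndo (A : OrbifoldAtlas ι m M) (p : M → M)
    (S : ι → (Fin m → ℝ) → Matrix (Fin m) (Fin m) ℝ) : Prop :=
  ∀ i j h, IsLocalLift p (A.chart i) (A.chart j) h → ∀ z ∈ h.source,
    S j (h z) * Coord.jacobian h z = Coord.jacobian h z * S i z

/-- `S` is a smooth field of bilinear forms on the orbifold. -/
def IsFormField (A : OrbifoldAtlas ι m M)
    (S : ι → (Fin m → ℝ) → Matrix (Fin m) (Fin m) ℝ) : Prop :=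
  A.SmoothComponents S ∧ A.PreservesForm id S

/-- `S` is a smooth field of endomorphisms of the tangent spaces of the orbifold. -/
def IsEndoField (A : OrbifoldAtlas ι m M)
    (S : ι → (Fin m → ℝ) → Matrix (Fin m) (Fin m) ℝ) : Prop :=
  A.SmoothComponents S ∧ A.PreservesEndo id S

end OrbifoldAtlas

/-! ### Torus actions -/

/-- The torus `T^n = ℝ^n / ℤ^n`. -/
abbrev Torus (n : ℕ) : Type := Fin n → UnitAddCircle

/-- The exponential map of the torus: the quotient map `ℝ^n → ℝ^n / ℤ^n`. -/
def Torus.exp {n : ℕ} (a : Fin n → ℝ) : Torus n := fun k => (a k : UnitAddCircle)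

namespace OrbifoldAtlas

variable {ι : Type*} {m n : ℕ} {M : Type*} [TopologicalSpace M] [AddAction (Torus n) M]

/-- The action map `T × M → M` is a smooth map of orbifolds: it has smooth lifts to charts near
each point. -/
def IsSmoothAction (A : OrbifoldAtlas ι m M) : Prop :=
  ∀ (a : Fin n → ℝ) (i j : ι), ∀ z ∈ (A.chart i).dom, ∀ w ∈ (A.chart j).dom,
    (A.chart j).proj w = Torus.exp a +ᵥ (A.chart i).proj z →
    ∃ (F : (Fin n → ℝ) × (Fin m → ℝ) → (Fin m → ℝ)) (O : Set ((Fin n → ℝ) × (Fin m → ℝ))),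
      IsOpen O ∧ (a, z) ∈ O ∧ ContDiffOn ℝ ∞ F O ∧ F (a, z) = w ∧
      ∀ q ∈ O, q.2 ∈ (A.chart i).dom ∧ F q ∈ (A.chart j).dom ∧
        (A.chart j).proj (F q) = Torus.exp q.1 +ᵥ (A.chart i).proj q.2

/-- `v` is the value at the point `z` of the chart `i` of the vector field `X_b` induced by the
one-parameter subgroup `s ↦ exp (s b)` of the torus: it is the velocity at `s = 0` of a lift to
the chart of the curve `s ↦ exp (s b) · p`, where `p` is the point represented by `z`. -/
def IsActionVector (A : OrbifoldAtlas ι m M) (b : Fin n → ℝ) (i : ι) (z v : Fin m → ℝ) : Prop :=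
  ∃ c : ℝ → (Fin m → ℝ), c 0 = z ∧ HasDerivAt c v 0 ∧
    ∀ᶠ s in 𝓝 (0 : ℝ), c s ∈ (A.chart i).dom ∧
      (A.chart i).proj (c s) = Torus.exp (s • b) +ᵥ (A.chart i).proj z

end OrbifoldAtlas

/-! ### Toric symplectic and toric Kähler orbifolds -/

/-- A symplectic orbifold of dimension `2 n` with an effective smooth symplectic action of the
torus `T^n`. -/
structure SymplecticTorusOrbifold (ι : Type*) (n : ℕ) (M : Type*) [TopologicalSpace M]
    [AddAction (Torus n) M] where
  atlas : OrbifoldAtlas ι (2 * n) M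
  smooth_action : atlas.IsSmoothAction (n := n)
  effective : ∀ t : Torus n, (∀ p : M, t +ᵥ p = p) → t = 0
  omega : ι → (Fin (2 * n) → ℝ) → Matrix (Fin (2 * n)) (Fin (2 * n)) ℝ
  form_omega : atlas.IsFormField omega
  alternating_omega : ∀ i, ∀ z ∈ (atlas.chart i).dom, (omega i z)ᵀ = - omega i z
  nondegenerate_omega : ∀ i, ∀ z ∈ (atlas.chart i).dom, IsUnit (omega i z).det
  closed_omega : ∀ i, ∀ z ∈ (atlas.chart i).dom, ∀ a b c, Coord.extDeriv₂ (omega i) a b c z = 0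
  invariant_omega : ∀ t : Torus n, atlas.PreservesForm (fun p => t +ᵥ p) omega

namespace SymplecticTorusOrbifold

variable {ι : Type*} {n : ℕ} {M : Type*} [TopologicalSpace M] [AddAction (Torus n) M]

/-- `x : M → 𝔱^*` is a moment map: it is smooth and `- d⟨x, b⟩ = ω(X_b, ·)` for all `b ∈ 𝔱`. -/
structure IsMomentMap (S : SymplecticTorusOrbifold ι n M)
    (x : M → Module.Dual ℝ (Fin n → ℝ)) : Prop where
  smooth : ∀ b, S.atlas.IsSmooth (fun p => x p b)
  hamiltonian : ∀ b i, ∀ z ∈ (S.atlas.chart i).dom, ∀ v, S.atlas.IsActionVector b i z v →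
    ∀ w, - fderiv ℝ (fun y => x ((S.atlas.chart i).proj y) b) z w = v ⬝ᵥ (S.omega i z *ᵥ w)

/-- A toric Kähler structure compatible with the symplectic form: a torus-invariant Riemannian
metric `g` and an integrable almost complex structure `J` with `ω = g(J ·, ·)`. -/
structure ToricKahler (S : SymplecticTorusOrbifold ι n M) where
  g : ι → (Fin (2 * n) → ℝ) → Matrix (Fin (2 * n)) (Fin (2 * n)) ℝ
  form_g : S.atlas.IsFormField g
  posDef_g : ∀ i, ∀ z ∈ (S.atlas.chart i).dom, (g i z).PosDef
  invariant_g : ∀ t : Torus n, S.atlas.PreservesForm (fun p => t +ᵥ p) g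
  J : ι → (Fin (2 * n) → ℝ) → Matrix (Fin (2 * n)) (Fin (2 * n)) ℝ
  endo_J : S.atlas.IsEndoField J
  invariant_J : ∀ t : Torus n, S.atlas.PreservesEndo (fun p => t +ᵥ p) J
  J_mul_J : ∀ i, ∀ z ∈ (S.atlas.chart i).dom, J i z * J i z = -1
  integrable_J : ∀ i, ∀ z ∈ (S.atlas.chart i).dom, ∀ c a b, Coord.nijenhuis (J i) c a b z = 0
  compatible : ∀ i, ∀ z ∈ (S.atlas.chart i).dom, S.omega i z = (J i z)ᵀ * g i z

namespace ToricKahler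

variable {S : SymplecticTorusOrbifold ι n M}

/-- The Ricci form `ρ = Ric(J ·, ·)`. -/
def ricciForm (K : S.ToricKahler) (i : ι) (z : Fin (2 * n) → ℝ) :
    Matrix (Fin (2 * n)) (Fin (2 * n)) ℝ :=
  (K.J i z)ᵀ * Coord.ricci (K.g i) z

/-- The structure is Kähler-Einstein with Einstein constant `lam`: `ρ = lam ω`. -/
def IsKahlerEinstein (K : S.ToricKahler) (lam : ℝ) : Prop :=
  ∀ i, ∀ z ∈ (S.atlas.chart i).dom, K.ricciForm i z = lam • S.omega i z

/-- `Δ f = h` on the orbifold, where `Δ` is the Laplacian of the metric. -/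
def HasLaplacian (K : S.ToricKahler) (f h : M → ℝ) : Prop :=
  ∀ i, ∀ z ∈ (S.atlas.chart i).dom,
    Coord.laplacian (K.g i) (fun y => f ((S.atlas.chart i).proj y)) z = h ((S.atlas.chart i).proj z)

/-- `μ` is an eigenvalue of the Laplacian: `Δ f = μ f` for a smooth function `f ≠ 0`. -/
def IsEigenvalue (K : S.ToricKahler) (μ : ℝ) : Prop :=
  ∃ f : M → ℝ, S.atlas.IsSmooth f ∧ f ≠ 0 ∧ K.HasLaplacian f (fun p => μ * f p)

end ToricKahler

end SymplecticTorusOrbifold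

end

/-! The torus acts by Killing fields, and `X_b = J grad ⟨x, b⟩`. For a Killing field, Kostant's
formula expresses `∇∇X` through the curvature. Contracting it with the Kähler form gives, for `f =
⟨x, b⟩`, the identity `d(Δ f) = 2 Ric(grad f, ·)` (`fderiv_laplacian`), and both directions of the
equivalence rest on it.

If `Ric = λ g`, then `Δ f - 2 λ f` has zero differential, so it is a constant `c(b)`, linear in `b`.
For `λ ≠ 0` it is absorbed by `α = c / (2 λ)`. For `λ = 0` the divergence of `grad f` is constant,
and the divergence theorem forces `c = 0`.

Conversely, the eigenvalue equations give `Ric(grad f, ·) = λ g(grad f, ·)` for every component `f`,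
and the `J`-invariance of the Ricci tensor of a Kähler metric gives the same for `X_b`. By
continuity it remains to see that the `X_b` and `J X_b` span the tangent space on a dense set. The
function `ω(X_a, X_b)` is constant, because the fields are Killing and commute, and it vanishes at a
maximum of `⟨x, b⟩`. So the orbits are isotropic, and it suffices that the fields of a basis are
independent on a dense set (`exists_linearIndependent`). If they were dependent on an open set, the
coefficients of a local relation would be constant, and some `X_b` with `b ≠ 0` would vanish on an
open set. A Killing field and its covariant derivative satisfy a closed linear first-order system,
so this `X_b` would vanish everywhere, against effectiveness.

For the eigenvalue bound let `Δ f = μ f`, `Y = grad f`, `B = ∇Y`, `Ric = λ g`. The field `∇_Y Y + J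
∇_{J Y} Y` has divergence `(2 λ - μ) |Y|² + tr (B² + J B J B)`, and the trace is half the squared
norm of `B + J B J`. If `μ < 2 λ`, this divergence is nonnegative, hence zero, so `Y = 0` and `f` is
constant. The components of `x + α` realize the value `2 λ`.

The divergence theorem is only needed in the form that a nonnegative divergence vanishes
(`OrbifoldAtlas.divergence_eq_zero_of_nonneg`). It uses a partition of unity and the Riemannian
volumes of the charts divided by the orders of the local groups. These agree on overlaps because
nontrivial group elements fix only null sets.

The tensor identities are proved over an abstract commutative ring with commuting derivations, where
they become matrix algebra. They are applied to the rings `smoothFn O`. -/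

open scoped ContDiff Topology Matrix

noncomputable section

set_option linter.unusedSectionVars false

/-! ### Riemannian and Kähler identities over a ring with commuting derivations. -/

section

namespace DiffAlg

open Matrix Finset

variable {R : Type*} [CommRing R] [Algebra ℝ R] {ι κ l : Type*} [Fintype ι] [DecidableEq ι]

theorem eq_zero_of_add_self {x : R} (h : x + x = 0) : x = 0 := by
  have h2 : (2 : ℝ) • x = 0 := by rw [two_smul, h]
  have h3 : ((1 / 2 : ℝ) * 2) • x = 0 := by rw [mul_smul, h2, smul_zero]
  simpa using h3

theorem two_smul_cancel {N : Type*} [AddCommGroup N] [Module ℝ N] {x y : N}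
    (h : (2 : ℝ) • x = (2 : ℝ) • y) : x = y := by
  have h2 : (1 / 2 : ℝ) • (2 : ℝ) • x = (1 / 2 : ℝ) • (2 : ℝ) • y := by rw [h]
  rw [smul_smul, smul_smul] at h2
  norm_num at h2
  exact h2

theorem map_mul_deriv (D : Derivation ℝ R R) (A : Matrix κ ι R) (B : Matrix ι l R) :
    (A * B).map D = A.map D * B + A * B.map D := by
  ext i j
  simp only [Matrix.map_apply, Matrix.mul_apply, Matrix.add_apply, map_sum, Derivation.leibniz,
    smul_eq_mul, ← Finset.sum_add_distrib]
  exact Finset.sum_congr rfl fun k _ => by ring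

theorem deriv_mulVec (D : Derivation ℝ R R) (A : Matrix κ ι R) (v : ι → R) (k : κ) :
    D ((A *ᵥ v) k) = (A.map D *ᵥ v) k + (A *ᵥ fun j => D (v j)) k := by
  simp only [Matrix.mulVec, dotProduct, Matrix.map_apply, map_sum, Derivation.leibniz,
    smul_eq_mul, ← Finset.sum_add_distrib]
  exact Finset.sum_congr rfl fun k _ => by ring

theorem deriv_dotProduct (D : Derivation ℝ R R) (u v : ι → R) :
    D (u ⬝ᵥ v) = (fun j => D (u j)) ⬝ᵥ v + u ⬝ᵥ fun j => D (v j) := by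
  simp only [dotProduct, map_sum, Derivation.leibniz, smul_eq_mul, ← Finset.sum_add_distrib]
  exact Finset.sum_congr rfl fun k _ => by ring

theorem deriv_trace (D : Derivation ℝ R R) (A : Matrix ι ι R) :
    D A.trace = (A.map D).trace := by
  simp [Matrix.trace, map_sum]

/-- `Γ` are the matrices of the Levi-Civita connection of `g` for the commuting derivations `d`. -/
structure IsLeviCivita (d : ι → Derivation ℝ R R) (g : Matrix ι ι R) (Γ : ι → Matrix ι ι R) :
    Prop where
  comm : ∀ a b f, d a (d b f) = d b (d a f)
  symm : gᵀ = g
  isUnit : IsUnit g.det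
  torsion : ∀ a b k, Γ a k b = Γ b k a
  compat : ∀ a, g.map (d a) = (Γ a)ᵀ * g + g * Γ a

/-- The curvature endomorphism `R(∂_a, ∂_b)`. -/
def curv (d : ι → Derivation ℝ R R) (Γ : ι → Matrix ι ι R) (a b : ι) : Matrix ι ι R :=
  (Γ b).map (d a) - (Γ a).map (d b) + (Γ a * Γ b - Γ b * Γ a)

/-- The Ricci tensor. -/
def ric (d : ι → Derivation ℝ R R) (Γ : ι → Matrix ι ι R) : Matrix ι ι R :=
  Matrix.of fun b c => ∑ a, curv d Γ a b a c

/-- The covariant derivative `∇_a A` of an endomorphism field. -/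
def covEndo (d : ι → Derivation ℝ R R) (Γ : ι → Matrix ι ι R) (a : ι) (A : Matrix ι ι R) :
    Matrix ι ι R :=
  A.map (d a) + (Γ a * A - A * Γ a)

/-- The endomorphism field `∇ X`. -/
def covVec (d : ι → Derivation ℝ R R) (Γ : ι → Matrix ι ι R) (X : ι → R) : Matrix ι ι R :=
  Matrix.of fun k a => d a (X k) + (Γ a *ᵥ X) k

/-- The Lie derivative of the metric along `X`. -/
def lieMetric (d : ι → Derivation ℝ R R) (g : Matrix ι ι R) (X : ι → R) : Matrix ι ι R :=
  (∑ c, X c • g.map (d c)) + (Matrix.of fun k a => d a (X k))ᵀ * g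
    + g * Matrix.of fun k a => d a (X k)

/-- The component `N^c_{a b}` of the Nijenhuis tensor. -/
def nij (d : ι → Derivation ℝ R R) (J : Matrix ι ι R) (c a b : ι) : R :=
  ∑ e, (J e a * d e (J c b) - J e b * d e (J c a) - J c e * (d a (J e b) - d b (J e a)))

section

variable {d : ι → Derivation ℝ R R} {g : Matrix ι ι R} {Γ : ι → Matrix ι ι R}

theorem covVec_eq (ht : ∀ a b k, Γ a k b = Γ b k a) (X : ι → R) :
    covVec d Γ X = (Matrix.of fun k a => d a (X k)) + ∑ c, X c • Γ c := by
  ext k a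
  simp only [covVec, Matrix.of_apply, Matrix.add_apply, Matrix.sum_apply, Matrix.smul_apply,
    smul_eq_mul, Matrix.mulVec, dotProduct]
  congr 1
  exact Finset.sum_congr rfl fun c _ => by rw [ht a c k]; ring

theorem curv_swap (a b : ι) : curv d Γ b a = - curv d Γ a b := by
  simp only [curv]; abel

theorem covEndo_mul (a : ι) (A B : Matrix ι ι R) :
    covEndo d Γ a (A * B) = covEndo d Γ a A * B + A * covEndo d Γ a B := by
  simp only [covEndo, map_mul_deriv]; noncomm_ring

theorem trace_covEndo (a : ι) (A : Matrix ι ι R) :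
    (covEndo d Γ a A).trace = d a A.trace := by
  simp only [covEndo, Matrix.trace_add, Matrix.trace_sub, deriv_trace]
  rw [Matrix.trace_mul_comm (Γ a) A]; ring

theorem covVec_mulVec (A : Matrix ι ι R) (X : ι → R) (k a : ι) :
    covVec d Γ (A *ᵥ X) k a = (covEndo d Γ a A *ᵥ X) k + (A * covVec d Γ X) k a := by
  have h : (A * covVec d Γ X) k a = (A *ᵥ fun j => d a (X j)) k + (A *ᵥ (Γ a *ᵥ X)) k := by
    simp only [Matrix.mul_apply, covVec, Matrix.of_apply, Matrix.mulVec, dotProduct, mul_add,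
      Finset.sum_add_distrib]
  rw [h]
  simp only [covVec, Matrix.of_apply, covEndo, deriv_mulVec, Matrix.add_mulVec, Matrix.sub_mulVec,
    Pi.add_apply, Pi.sub_apply, Matrix.mulVec_mulVec]
  ring

theorem covVec_smul (f : R) (X : ι → R) (k a : ι) :
    covVec d Γ (f • X) k a = d a f * X k + f * covVec d Γ X k a := by
  simp only [covVec, Matrix.of_apply, Matrix.mulVec_smul, Pi.smul_apply, smul_eq_mul,
    Derivation.leibniz]
  ring

theorem trace_covVec_smul (f : R) (X : ι → R) :
    (covVec d Γ (f • X)).trace = (∑ a, d a f * X a) + f * (covVec d Γ X).trace := by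
  simp only [Matrix.trace, Matrix.diag_apply, covVec_smul, Finset.sum_add_distrib, Finset.mul_sum]

theorem covVec_add (X Y : ι → R) : covVec d Γ (X + Y) = covVec d Γ X + covVec d Γ Y := by
  ext k a
  simp only [covVec, Matrix.of_apply, Matrix.mulVec_add, Pi.add_apply, map_add, Matrix.add_apply]
  ring

namespace IsLeviCivita

variable (h : IsLeviCivita d g Γ)
include h

theorem metric_comm (u v : ι → R) : u ⬝ᵥ g *ᵥ v = v ⬝ᵥ g *ᵥ u := by
  conv_lhs => rw [← h.symm]
  rw [Matrix.mulVec_transpose, dotProduct_comm, ← Matrix.dotProduct_mulVec]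

theorem map_comm (A : Matrix ι ι R) (a b : ι) :
    (A.map (d a)).map (d b) = (A.map (d b)).map (d a) := by
  ext i j; exact h.comm _ _ _

/-- The second derivatives of `g` commute. Expanding both orders through metric compatibility, their
difference is, up to sign, the left-hand side. -/
theorem curv_skew (a b : ι) : (curv d Γ a b)ᵀ * g + g * curv d Γ a b = 0 := by
  have e := h.map_comm g a b
  have tr : ∀ a b, ((Γ a)ᵀ).map (d b) = ((Γ a).map (d b))ᵀ := fun _ _ => rfl
  have ma : ∀ (A B : Matrix ι ι R) (c : ι), (A + B).map (d c) = A.map (d c) + B.map (d c) :=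
    fun A B c => by ext; simp
  simp only [h.compat, ma, map_mul_deriv, tr] at e
  simp only [curv, Matrix.transpose_add, Matrix.transpose_sub, Matrix.transpose_mul]
  rw [← sub_eq_zero] at e
  rw [← neg_eq_zero, ← e]
  noncomm_ring

theorem bianchi (a b c k : ι) :
    curv d Γ a b k c + curv d Γ b c k a + curv d Γ c a k b = 0 := by
  have key : ∀ a b c, (Γ a * Γ b) k c = (Γ a * Γ c) k b := fun a b c => by
    simp only [Matrix.mul_apply, h.torsion b c]
  simp only [curv, Matrix.add_apply, Matrix.sub_apply, Matrix.map_apply]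
  rw [key a b c, key b a c, key c b a, h.torsion b c, h.torsion a c, h.torsion a b]
  ring

/-- The Ricci identity. The terms `∇X * Γ a` are symmetric under the exchange of `a` and `b` because
there is no torsion, so they cancel in the alternation. -/
theorem covVec_comm (X : ι → R) (a b k : ι) :
    covEndo d Γ a (covVec d Γ X) k b - covEndo d Γ b (covVec d Γ X) k a
      = (curv d Γ a b *ᵥ X) k := by
  have e1 : ∀ a b, (covVec d Γ X * Γ a) k b = (covVec d Γ X * Γ b) k a := fun a b => by
    simp only [Matrix.mul_apply, h.torsion a b]
  have e2 : ∀ a b, (Γ a * covVec d Γ X) k b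
      = (Γ a *ᵥ fun j => d b (X j)) k + ((Γ a * Γ b) *ᵥ X) k := fun a b => by
    rw [← Matrix.mulVec_mulVec]
    simp only [Matrix.mul_apply, covVec, Matrix.of_apply, Matrix.mulVec, dotProduct, mul_add,
      Finset.sum_add_distrib]
  have e3 : ∀ a b, ((covVec d Γ X).map (d a)) k b = d a (d b (X k)) +
      (((Γ b).map (d a) *ᵥ X) k + (Γ b *ᵥ fun j => d a (X j)) k) := fun a b => by
    rw [← deriv_mulVec]; simp [covVec]
  simp only [covEndo, Matrix.add_apply, Matrix.sub_apply, e2, e3, e1 b a, h.comm b a, curv,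
    Matrix.add_mulVec, Matrix.sub_mulVec, Pi.add_apply, Pi.sub_apply]
  ring

/-- In this form the Killing equation says that `g * ∇X` is skew, which is how it enters all later
arguments. -/
theorem lieMetric_eq (X : ι → R) :
    lieMetric d g X = (covVec d Γ X)ᵀ * g + g * covVec d Γ X := by
  rw [covVec_eq h.torsion, lieMetric]
  simp only [h.compat, Matrix.transpose_add, Matrix.transpose_sum, Matrix.transpose_smul,
    Matrix.add_mul, Matrix.mul_add, Matrix.sum_mul, Matrix.mul_sum, Matrix.smul_mul,
    Matrix.mul_smul, smul_add, Finset.sum_add_distrib]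
  abel

/-- `∇ g = 0`, for endomorphisms composed with the metric. -/
theorem map_metric_mul (a : ι) (A : Matrix ι ι R) :
    (g * A).map (d a) = g * covEndo d Γ a A + (Γ a)ᵀ * (g * A) + (g * A) * Γ a := by
  rw [map_mul_deriv, h.compat, covEndo]; noncomm_ring

/-- Treats symmetric and skew endomorphisms together: the cases of interest are `s = 1` and `s =
-1`, where `d a s = 0`. -/
theorem metric_covEndo_transpose (a : ι) (A : Matrix ι ι R) (s : R)
    (hA : (g * A)ᵀ = s • (g * A)) :
    (g * covEndo d Γ a A)ᵀ = (d a s) • (g * A) + s • (g * covEndo d Γ a A) := by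
  have e := h.map_metric_mul a A
  have e1 : g * covEndo d Γ a A = (g * A).map (d a) - (Γ a)ᵀ * (g * A) - (g * A) * Γ a := by
    rw [e]; abel
  have e2 : ((g * A).map (d a))ᵀ = d a s • (g * A) + s • (g * A).map (d a) := by
    have : ((g * A).map (d a))ᵀ = ((g * A)ᵀ).map (d a) := rfl
    rw [this, hA]
    ext i j
    simp [Derivation.leibniz]
    ring
  rw [e1]
  simp only [Matrix.transpose_sub, e2]
  rw [Matrix.transpose_mul, Matrix.transpose_mul (g * A), hA, Matrix.transpose_transpose]
  simp only [smul_sub, Matrix.smul_mul, Matrix.mul_smul]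
  abel

theorem metric_covEndo_symm (a : ι) (A : Matrix ι ι R) (hA : (g * A)ᵀ = g * A) :
    (g * covEndo d Γ a A)ᵀ = g * covEndo d Γ a A := by
  simpa using h.metric_covEndo_transpose a A 1 (by simpa using hA)

theorem metric_covEndo_skew (a : ι) (A : Matrix ι ι R) (hA : (g * A)ᵀ = - (g * A)) :
    (g * covEndo d Γ a A)ᵀ = - (g * covEndo d Γ a A) := by
  simpa using h.metric_covEndo_transpose a A (-1) (by simpa using hA)

/-- Kostant's formula for the second covariant derivative of a Killing field. -/
theorem covEndo_covVec_of_killing (X : ι → R)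
    (hX : (g * covVec d Γ X)ᵀ = - (g * covVec d Γ X)) (a b c : ι) :
    (g * covEndo d Γ a (covVec d Γ X)) c b = (g *ᵥ (curv d Γ c b *ᵥ X)) a := by
  have sk : ∀ a b c, (g * covEndo d Γ a (covVec d Γ X)) c b
      = - (g * covEndo d Γ a (covVec d Γ X)) b c := fun a b c => by
    have := congrFun (congrFun (h.metric_covEndo_skew a _ hX) b) c
    simpa using this
  have df : ∀ a b c, (g * covEndo d Γ a (covVec d Γ X)) c b
      - (g * covEndo d Γ b (covVec d Γ X)) c a = (g *ᵥ (curv d Γ a b *ᵥ X)) c := fun a b c => by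
    simp only [Matrix.mul_apply, ← Finset.sum_sub_distrib, ← mul_sub, h.covVec_comm X a b]
    rfl
  have sw : ∀ a b c, (g *ᵥ (curv d Γ b a *ᵥ X)) c = - (g *ᵥ (curv d Γ a b *ᵥ X)) c :=
    fun a b c => by rw [curv_swap, Matrix.neg_mulVec, Matrix.mulVec_neg]; rfl
  have tk : ∀ a b c, (g *ᵥ (curv d Γ a b *ᵥ X)) c = - ∑ k, (g *ᵥ X) k * curv d Γ a b k c :=
    fun a b c => by
      have e := h.curv_skew a b
      have e' : g * curv d Γ a b = - ((curv d Γ a b)ᵀ * g) := by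
        rw [eq_neg_iff_add_eq_zero, add_comm, e]
      rw [Matrix.mulVec_mulVec, e', Matrix.neg_mulVec, ← Matrix.mulVec_mulVec]
      exact congrArg Neg.neg (Finset.sum_congr rfl fun _ _ => mul_comm _ _)
  have cy : (g *ᵥ (curv d Γ a b *ᵥ X)) c + (g *ᵥ (curv d Γ b c *ᵥ X)) a
      + (g *ᵥ (curv d Γ c a *ᵥ X)) b = 0 := by
    rw [tk, tk, tk, ← neg_add, ← neg_add, ← Finset.sum_add_distrib, ← Finset.sum_add_distrib,
      neg_eq_zero]
    exact Finset.sum_eq_zero fun k _ => by rw [← mul_add, ← mul_add, h.bianchi a b c k, mul_zero]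
  -- Koszul's trick: the left-hand side is skew in `(b, c)` and its alternation in `(a, b)` is a
  -- curvature term. Permuting the indices determines twice the left-hand side, and the cyclic
  -- identity `cy` merges the three curvature terms into one.
  rw [← sub_eq_zero]
  apply eq_zero_of_add_self
  linear_combination df a b c + sk b a c - df b c a - sk c b a + df c a b + sk a c b + cy
    - 2 * sw b c a

/-- An almost Kähler structure is parallel if it is integrable. -/
theorem covEndo_eq_zero_of_kahler {J : Matrix ι ι R} (hJ : J * J = -1)
    (hs : (g * J)ᵀ = - (g * J)) (hN : ∀ c a b, nij d J c a b = 0)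
    (hc : ∀ a b c, d a ((Jᵀ * g) b c) + d b ((Jᵀ * g) c a) + d c ((Jᵀ * g) a b) = 0) (a : ι) :
    covEndo d Γ a J = 0 := by
  set K := fun a => covEndo d Γ a J with hK
  have hJg : Jᵀ * g = - (g * J) := by
    rw [← hs, Matrix.transpose_mul, h.symm]
  have anti : ∀ a, K a * J = - (J * K a) := fun a => by
    have e := covEndo_mul (d := d) (Γ := Γ) a J J
    rw [hJ] at e
    have : covEndo d Γ a (-1) = (0 : Matrix ι ι R) := by
      have : ((-1 : Matrix ι ι R)).map (d a) = 0 := by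
        ext i j
        by_cases hij : i = j
        · simp [hij]
        · simp [hij]
      rw [covEndo, this]; noncomm_ring
    rw [this] at e
    exact (eq_neg_of_add_eq_zero_left e.symm)
  have skK : ∀ a c b, (g * K a) c b = - (g * K a) b c := fun a c b => by
    have := congrFun (congrFun (h.metric_covEndo_skew a _ hs) b) c
    simpa using this
  -- As `∇_a J` anticommutes with `J`, the form `M a` is skew again. It is enough to show `M a = 0`,
  -- since `J` and `g` are invertible.
  set M := fun a => Jᵀ * (g * K a) with hM
  have MJ : ∀ a, M a = g * K a * J := fun a => by
    simp only [hM]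
    rw [← Matrix.mul_assoc, hJg, Matrix.mul_assoc, anti]; noncomm_ring
  have skM : ∀ a c b, M a c b = - M a b c := fun a c b => by
    have e : (g * K a)ᵀ = - (g * K a) := by ext i j; simpa using skK a j i
    have : (M a)ᵀ = - M a := by
      rw [MJ a, Matrix.transpose_mul, e, ← MJ a]
      simp only [hM, Matrix.mul_neg]
    have := congrFun (congrFun this b) c
    simpa using this
  -- closedness of the Kähler form
  have E1 : ∀ a b c, (g * K a) c b + (g * K b) a c + (g * K c) b a = 0 := fun a b c => by
    have e : ∀ a, (Jᵀ * g).map (d a) = - (g * K a) + (Γ a)ᵀ * (Jᵀ * g) + (Jᵀ * g) * Γ a :=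
      fun a => by
        have : ((-(g * J)).map (d a)) = - ((g * J).map (d a)) := by ext; simp
        rw [hJg, this, h.map_metric_mul]; noncomm_ring
    have e' : ∀ a b c, d a ((Jᵀ * g) b c) = - (g * K a) b c + ((Γ a)ᵀ * (Jᵀ * g)) b c
        + ((Jᵀ * g) * Γ a) b c := fun a b c => by
      have := congrFun (congrFun (e a) b) c
      simpa using this
    have cl := hc a b c
    rw [e', e', e', hJg] at cl
    have t : ∀ a b c, ((Γ a)ᵀ * -(g * J)) b c = ∑ e, Γ a e b * - (g * J) e c := fun a b c => by
      simp [Matrix.mul_apply]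
    have t' : ∀ a b c, (-(g * J) * Γ a) b c = ∑ e, Γ a e c * (g * J) e b := fun a b c => by
      rw [Matrix.mul_apply]
      refine Finset.sum_congr rfl fun e _ => ?_
      have := congrFun (congrFun hs b) e
      simp only [Matrix.transpose_apply] at this
      rw [← this, mul_comm]
    have tt : ∀ a b c, ∑ e, Γ a e b * - (g * J) e c = - ∑ e, Γ b e a * (g * J) e c :=
      fun a b c => by
        rw [← Finset.sum_neg_distrib]
        exact Finset.sum_congr rfl fun e _ => by rw [h.torsion a b]; simp
    rw [t, t, t, t', t', t', tt a b c, tt b c a, tt c a b] at cl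
    linear_combination cl + skK a c b + skK b a c + skK c b a
  -- integrability
  have E2 : ∀ a b c, (∑ e, J e a * (g * K e) c b) - (∑ e, J e b * (g * K e) c a)
      + M a c b - M b c a = 0 := by
    have dJ : ∀ e, J.map (d e) = K e - (Γ e * J - J * Γ e) := fun e => by
      simp only [hK, covEndo]; abel
    have dJ' : ∀ e x y, d e (J x y) = K e x y - ((Γ e * J) x y - (J * Γ e) x y) :=
      fun e x y => by
        have := congrFun (congrFun (dJ e) x) y
        simpa using this
    have n1 : ∀ a b x, (∑ e, J e a * K e x b) - (∑ e, J e b * K e x a)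
        - (J * K a) x b + (J * K b) x a = 0 := fun a b x => by
      have n := hN x a b
      simp only [nij] at n
      rw [Finset.sum_sub_distrib, Finset.sum_sub_distrib] at n
      have r1 : ∀ a b, ∑ e, J e a * d e (J x b) = ∑ e, J e a * K e x b
          - ((∑ e, J e a * (Γ e * J) x b) - (J * (Γ b * J)) x a) := fun a b => by
        have : (J * (Γ b * J)) x a = ∑ e, J e a * (J * Γ e) x b := by
          rw [← Matrix.mul_assoc, Matrix.mul_apply]
          refine Finset.sum_congr rfl fun e _ => ?_
          rw [mul_comm]; congr 1
          simp only [Matrix.mul_apply, h.torsion b e]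
        rw [this, ← Finset.sum_sub_distrib, ← Finset.sum_sub_distrib]
        exact Finset.sum_congr rfl fun e _ => by rw [dJ']; ring
      have r2 : ∑ e, J x e * (d a (J e b) - d b (J e a)) = ((J * K a) x b - (J * (Γ a * J)) x b)
          - ((J * K b) x a - (J * (Γ b * J)) x a) := by
        have : ∀ a b, ∑ e, J x e * d a (J e b) = (J * K a) x b - ((J * (Γ a * J)) x b
            - (J * (J * Γ a)) x b) := fun a b => by
          simp only [dJ', mul_sub, Finset.sum_sub_distrib]
          rfl
        simp only [mul_sub, Finset.sum_sub_distrib, this]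
        have : (J * (J * Γ a)) x b = (J * (J * Γ b)) x a := by
          rw [← Matrix.mul_assoc, ← Matrix.mul_assoc, hJ]
          simp [h.torsion a b]
        rw [this]; ring
      have r3 : ∀ a b, ∑ e, J e a * (Γ e * J) x b = ∑ e, J e b * (Γ e * J) x a := fun a b => by
        simp only [Matrix.mul_apply, Finset.mul_sum]
        rw [Finset.sum_comm]
        exact Finset.sum_congr rfl fun e _ => Finset.sum_congr rfl fun y _ => by
          rw [h.torsion y e]; ring
      rw [r1, r1, r2, r3 a b] at n
      linear_combination n
    intro a b c
    have s1 : ∀ a b, ∑ e, J e a * (g * K e) c b = ∑ x, g c x * ∑ e, J e a * K e x b :=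
      fun a b => by
        simp only [Matrix.mul_apply, Finset.mul_sum]
        rw [Finset.sum_comm]
        exact Finset.sum_congr rfl fun e _ => Finset.sum_congr rfl fun y _ => by ring
    have s2 : ∀ a b, M a c b = - ∑ x, g c x * (J * K a) x b := fun a b => by
      simp only [hM]
      rw [← Matrix.mul_assoc, hJg, Matrix.neg_mul, Matrix.mul_assoc]
      rfl
    rw [s1, s1, s2, s2, ← Finset.sum_sub_distrib, ← sub_eq_add_neg, ← Finset.sum_sub_distrib,
      sub_neg_eq_add, ← Finset.sum_add_distrib]
    refine Finset.sum_eq_zero fun x _ => ?_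
    have := n1 a b x
    linear_combination g c x * this
  -- By `E2` this expression is symmetric in `(a, b)`. It is also skew in `(b, c)`, and a
  -- three-index expression with both properties is zero.
  have q0 : ∀ a b c, (∑ e, J e a * (g * K e) c b) + M a c b = 0 := fun a b c => by
    have sk1 : ∀ a b c, ∑ e, J e a * (g * K e) c b = - ∑ e, J e a * (g * K e) b c :=
      fun a b c => by
        rw [← Finset.sum_neg_distrib]
        exact Finset.sum_congr rfl fun e _ => by rw [skK e c b]; ring
    apply eq_zero_of_add_self
    linear_combination E2 a b c + sk1 b a c + skM b c a - E2 b c a - sk1 c b a - skM c a b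
      + E2 c a b + sk1 a c b + skM a b c
  -- Closedness `E1` contracted with `J` in one index; `q0` rewrites the term where `J` meets the
  -- index of differentiation.
  have F : ∀ a b c, - M a c b + M b a c + M c b a = 0 := fun a b c => by
    have e2 : ∑ e, J e a * (g * K b) e c = M b a c := rfl
    have e3 : ∑ e, J e a * (g * K c) b e = M c b a := by
      rw [MJ, Matrix.mul_apply]
      exact Finset.sum_congr rfl fun e _ => mul_comm _ _
    rw [← e2, ← e3, ← eq_neg_of_add_eq_zero_left (q0 a b c), ← Finset.sum_add_distrib,
      ← Finset.sum_add_distrib]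
    exact Finset.sum_eq_zero fun e _ => by rw [← mul_add, ← mul_add, E1, mul_zero]
  -- Two cyclic permutations of `F` add up to twice an entry of `M a`.
  have M0 : M a = 0 := by
    ext c b
    exact eq_zero_of_add_self (by linear_combination F b c a + F c a b)
  have : g * K a = 0 := by
    have e : g * K a * J * J = 0 := by rw [← MJ, M0, Matrix.zero_mul]
    rw [Matrix.mul_assoc, hJ] at e
    simpa using e
  calc K a = g⁻¹ * (g * K a) := by rw [← Matrix.mul_assoc, Matrix.nonsing_inv_mul _ h.isUnit,
        Matrix.one_mul]
    _ = 0 := by rw [this, Matrix.mul_zero]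

section Kahler

variable {J : Matrix ι ι R} (hJ : J * J = -1) (hs : (g * J)ᵀ = - (g * J))
  (hp : ∀ a, covEndo d Γ a J = 0)

-- Parallelism expresses the first derivatives of `J` by commutators with `Γ`. Equality of its mixed
-- second derivatives is then the vanishing of the commutator of `J` with the curvature.
omit h in
theorem curv_mul_comm_of_parallel (hcomm : ∀ a b f, d a (d b f) = d b (d a f))
    (hp : ∀ a, covEndo d Γ a J = 0) (a b : ι) :
    curv d Γ a b * J = J * curv d Γ a b := by
  have e : ∀ a, J.map (d a) = J * Γ a - Γ a * J := fun a => by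
    have := hp a
    rw [covEndo] at this
    rw [eq_neg_of_add_eq_zero_left this]; abel
  have ma : ∀ (A B : Matrix ι ι R) (c : ι), (A - B).map (d c) = A.map (d c) - B.map (d c) :=
    fun A B c => by ext; simp
  have ee : (J.map (d a)).map (d b) = (J.map (d b)).map (d a) := by ext; exact hcomm _ _ _
  simp only [e, ma, map_mul_deriv] at ee
  rw [← sub_eq_zero] at ee ⊢
  rw [← ee, curv]
  noncomm_ring

include hJ hs hp

theorem skew_mul_inv : (J * g⁻¹)ᵀ = - (J * g⁻¹) := by
  have e : Jᵀ * g = - (g * J) := by rw [← hs, Matrix.transpose_mul, h.symm]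
  rw [Matrix.transpose_mul, Matrix.transpose_nonsing_inv, h.symm]
  calc g⁻¹ * Jᵀ = g⁻¹ * (Jᵀ * g) * g⁻¹ := by
        rw [Matrix.mul_assoc, Matrix.mul_assoc, Matrix.mul_nonsing_inv _ h.isUnit, Matrix.mul_one]
    _ = - (J * g⁻¹) := by
        rw [e, Matrix.mul_neg, ← Matrix.mul_assoc, Matrix.nonsing_inv_mul _ h.isUnit,
          Matrix.one_mul, Matrix.neg_mul]

/-- The contraction of the curvature with the Kähler form is the Ricci form. -/
theorem sum_curv_eq_ric :
    g * ∑ b, ∑ e, (J * g⁻¹) b e • curv d Γ e b = (2 : ℝ) • (ric d Γ * J)ᵀ := by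
  set P := J * g⁻¹ with hP
  have skP : ∀ b e, P b e = - P e b := fun b e => by
    have := congrFun (congrFun (h.skew_mul_inv hJ hs hp) e) b
    simpa using this
  -- The Bianchi identity contracted with the skew bivector `P`: two of the three terms become
  -- equal, which is the origin of the factor 2.
  have bi : ∀ k c, (∑ b, ∑ e, P b e * curv d Γ e b k c)
      = - (2 : ℝ) • ∑ b, ∑ e, P b e * curv d Γ b c k e := fun k c => by
    have e1 : ∑ b, ∑ e, P b e * curv d Γ c e k b = ∑ b, ∑ e, P b e * curv d Γ b c k e := by
      rw [Finset.sum_comm]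
      refine Finset.sum_congr rfl fun b _ => Finset.sum_congr rfl fun e _ => ?_
      rw [skP e b, curv_swap b c]; simp
    have e2 : ∑ b, ∑ e, P b e * (curv d Γ e b k c + curv d Γ b c k e + curv d Γ c e k b) = 0 :=
      Finset.sum_eq_zero fun b _ => Finset.sum_eq_zero fun e _ => by
        rw [h.bianchi, mul_zero]
    simp only [mul_add, Finset.sum_add_distrib, e1] at e2
    rw [neg_smul, two_smul]
    linear_combination e2
  ext x c
  have gl : (g * ∑ b, ∑ e, P b e • curv d Γ e b) x c
      = ∑ k, g x k * ∑ b, ∑ e, P b e * curv d Γ e b k c := by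
    simp [Matrix.mul_apply, Matrix.sum_apply]
  have e3 : ∑ k, g x k * ∑ b, ∑ e, P b e * curv d Γ b c k e
      = ∑ b, ∑ e, P b e * (g * curv d Γ b c) x e := by
    simp only [Matrix.mul_apply, Finset.mul_sum]
    rw [Finset.sum_comm]
    refine Finset.sum_congr rfl fun b _ => ?_
    rw [Finset.sum_comm]
    exact Finset.sum_congr rfl fun e _ => Finset.sum_congr rfl fun k _ => by ring
  -- Exchanging the two indices of the skew form `g * curv` costs a sign, and `P * g = J` turns the
  -- contraction into a product with `J`.
  have e4 : ∀ b, ∑ e, P b e * (g * curv d Γ b c) x e = - (J * curv d Γ b c) b x := fun b => by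
    have e5 : (g * curv d Γ b c) = - ((curv d Γ b c)ᵀ * g) := by
      rw [eq_neg_iff_add_eq_zero, add_comm, h.curv_skew]
    have e6 : J * curv d Γ b c = P * (g * curv d Γ b c) := by
      rw [hP, Matrix.mul_assoc, ← Matrix.mul_assoc g⁻¹, Matrix.nonsing_inv_mul _ h.isUnit,
        Matrix.one_mul]
    rw [e6, Matrix.mul_apply, ← Finset.sum_neg_distrib]
    refine Finset.sum_congr rfl fun e _ => ?_
    have e7 : (g * curv d Γ b c) x e = - (g * curv d Γ b c) e x := by
      have : ((curv d Γ b c)ᵀ * g) x e = (g * curv d Γ b c) e x := by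
        have : (curv d Γ b c)ᵀ * g = (g * curv d Γ b c)ᵀ := by
          rw [Matrix.transpose_mul, h.symm]
        rw [this]; rfl
      conv_lhs => rw [e5]
      rw [Matrix.neg_apply, this]
    rw [e7, mul_neg]
  have e8 : ∑ b, (J * curv d Γ b c) b x = (ric d Γ * J) c x := by
    simp only [← curv_mul_comm_of_parallel h.comm hp]
    simp only [Matrix.mul_apply, ric, Matrix.of_apply, Finset.sum_mul]
    rw [Finset.sum_comm]
  rw [gl]
  simp only [bi, mul_smul_comm, ← Finset.smul_sum]
  rw [e3]
  simp only [e4, Finset.sum_neg_distrib]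
  rw [e8, neg_smul, smul_neg, neg_neg]
  rfl

/-- The contracted curvature on the other side of `sum_curv_eq_ric` is a combination of skew forms.
-/
theorem ric_mul_skew : (ric d Γ * J)ᵀ = - (ric d Γ * J) := by
  have e := h.sum_curv_eq_ric hJ hs hp
  have e2 : (g * ∑ b, ∑ e, (J * g⁻¹) b e • curv d Γ e b)ᵀ
      = - (g * ∑ b, ∑ e, (J * g⁻¹) b e • curv d Γ e b) := by
    have : ∀ a b, (curv d Γ a b)ᵀ * g = - (g * curv d Γ a b) := fun a b =>
      eq_neg_of_add_eq_zero_left (h.curv_skew a b)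
    simp only [Matrix.transpose_mul, h.symm, Matrix.transpose_sum, Matrix.transpose_smul,
      this, Finset.mul_sum, Matrix.mul_smul, smul_neg,
      Finset.sum_neg_distrib]
  rw [e, Matrix.transpose_smul, Matrix.transpose_transpose, ← smul_neg] at e2
  exact (neg_eq_iff_eq_neg.2 (two_smul_cancel e2)).symm

/-- The Ricci tensor of a Kähler metric is `J`-invariant. -/
theorem ric_invariant : Jᵀ * ric d Γ * J = ric d Γ := by
  have e := h.sum_curv_eq_ric hJ hs hp
  have hJg : g * J = - (Jᵀ * g) := by
    rw [eq_neg_iff_add_eq_zero, ← neg_eq_zero, neg_add, ← hs, Matrix.transpose_mul, h.symm]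
    abel
  set S := ∑ b, ∑ e, (J * g⁻¹) b e • curv d Γ e b with hS
  -- Each curvature endomorphism commutes with `J`, so their contraction does; through
  -- `sum_curv_eq_ric` this becomes the invariance of the Ricci tensor.
  have c : S * J = J * S := by
    simp only [hS, Finset.sum_mul, Finset.mul_sum, Matrix.smul_mul, Matrix.mul_smul,
      curv_mul_comm_of_parallel h.comm hp]
  have e2 : (2 : ℝ) • ((ric d Γ * J)ᵀ * J) = - ((2 : ℝ) • (Jᵀ * (ric d Γ * J)ᵀ)) := by
    rw [← Matrix.smul_mul, ← Matrix.mul_smul, ← e, Matrix.mul_assoc, c, ← Matrix.mul_assoc, hJg]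
    rw [Matrix.neg_mul, Matrix.mul_assoc]
  rw [← smul_neg] at e2
  have e3 := two_smul_cancel e2
  rw [h.ric_mul_skew hJ hs hp] at e3
  rw [Matrix.neg_mul, Matrix.mul_assoc, hJ, Matrix.mul_neg, neg_neg, Matrix.mul_neg,
    Matrix.mul_one, neg_neg] at e3
  rw [Matrix.mul_assoc, ← e3]

/-- For a Killing field `X`, `d (tr (J ∇X)) = - 2 Ric (·, J X)`. -/
theorem deriv_trace_of_killing (X : ι → R)
    (hX : (g * covVec d Γ X)ᵀ = - (g * covVec d Γ X)) (c : ι) :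
    d c (J * covVec d Γ X).trace = - (2 : ℝ) • (ric d Γ *ᵥ (J *ᵥ X)) c := by
  have e1 : (J * covEndo d Γ c (covVec d Γ X))
      = (J * g⁻¹) * (g * covEndo d Γ c (covVec d Γ X)) := by
    rw [Matrix.mul_assoc, ← Matrix.mul_assoc g⁻¹, Matrix.nonsing_inv_mul _ h.isUnit,
      Matrix.one_mul]
  -- A derivative of a trace is the trace of the covariant derivative, and `J` is parallel. Only
  -- `∇_c ∇X` remains, and Kostant's formula makes it a curvature.
  rw [← trace_covEndo (Γ := Γ), covEndo_mul, hp, Matrix.zero_mul, zero_add, e1]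
  have e2 : ((J * g⁻¹) * (g * covEndo d Γ c (covVec d Γ X))).trace
      = ((g * ∑ b, ∑ e, (J * g⁻¹) b e • curv d Γ e b) *ᵥ X) c := by
    simp only [Matrix.trace, Matrix.diag_apply, Matrix.mul_apply (M := J * g⁻¹),
      h.covEndo_covVec_of_killing X hX, ← Matrix.mulVec_mulVec, Matrix.sum_mulVec,
      Matrix.mulVec_sum, Matrix.smul_mulVec, Matrix.mulVec_smul, Finset.sum_apply, Pi.smul_apply,
      smul_eq_mul]
  rw [e2, h.sum_curv_eq_ric hJ hs hp, h.ric_mul_skew hJ hs hp, Matrix.mulVec_mulVec]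
  simp [Matrix.smul_mulVec, Matrix.neg_mulVec]

/-- The divergence of `∇_Y Y + J ∇_{J Y} Y` for a field `Y` with symmetric `∇Y`. -/
theorem trace_covVec_of_symm (Y : ι → R)
    (hY : (g * covVec d Γ Y)ᵀ = g * covVec d Γ Y) :
    (covVec d Γ (covVec d Γ Y *ᵥ Y + (J * covVec d Γ Y * J) *ᵥ Y)).trace
      = (∑ a, Y a * d a (covVec d Γ Y).trace) + (2 : ℝ) • (Y ⬝ᵥ ric d Γ *ᵥ Y)
        + (covVec d Γ Y * covVec d Γ Y + J * covVec d Γ Y * J * covVec d Γ Y).trace := by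
  set B := covVec d Γ Y with hB
  -- Bochner's computation: the Ricci identity moves the contracted derivative onto the trace of
  -- `B`, at the price of one Ricci term.
  have c1 : (covVec d Γ (B *ᵥ Y)).trace = (∑ a, Y a * d a B.trace) + Y ⬝ᵥ ric d Γ *ᵥ Y
      + (B * B).trace := by
    have e1 : ∀ a b, covEndo d Γ a B a b = covEndo d Γ b B a a + (curv d Γ a b *ᵥ Y) a :=
      fun a b => by rw [← h.covVec_comm Y a b a]; ring
    have e2 : ∑ a, (covEndo d Γ a B *ᵥ Y) a = (∑ b, Y b * d b B.trace)
        + ∑ b, Y b * ∑ a, (curv d Γ a b *ᵥ Y) a := by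
      have m : ∀ a, (covEndo d Γ a B *ᵥ Y) a = ∑ b, covEndo d Γ a B a b * Y b := fun _ => rfl
      have t : ∀ b, d b B.trace = ∑ a, covEndo d Γ b B a a := fun b => by
        rw [← trace_covEndo (Γ := Γ)]; rfl
      simp only [m, t, e1, Finset.mul_sum]
      rw [Finset.sum_comm, ← Finset.sum_add_distrib]
      refine Finset.sum_congr rfl fun b _ => ?_
      rw [← Finset.sum_add_distrib]
      exact Finset.sum_congr rfl fun a _ => by ring
    have e3 : ∀ b, ∑ a, (curv d Γ a b *ᵥ Y) a = (ric d Γ *ᵥ Y) b := fun b => by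
      simp only [Matrix.mulVec, dotProduct, ric, Matrix.of_apply, Finset.sum_mul]
      rw [Finset.sum_comm]
    simp only [e3] at e2
    simp only [Matrix.trace, Matrix.diag_apply, covVec_mulVec, Finset.sum_add_distrib] at e2 ⊢
    rw [e2]; rfl
  -- The derivative of `B` is contracted with the skew bivector `P`, so only its alternation
  -- survives. That is a curvature, whose contraction with `P` is twice the Ricci form; this yields
  -- a second copy of `Ric(Y, Y)`.
  have c2 : (covVec d Γ ((J * B * J) *ᵥ Y)).trace = Y ⬝ᵥ ric d Γ *ᵥ Y
      + (J * B * J * B).trace := by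
    set P := J * g⁻¹ with hP
    set Z := J *ᵥ Y with hZ
    have skP : ∀ b e, P b e = - P e b := fun b e => by
      have := congrFun (congrFun (h.skew_mul_inv hJ hs hp) e) b
      simpa using this
    have e0 : ∀ a, covEndo d Γ a (J * B * J) = J * covEndo d Γ a B * J := fun a => by
      simp [covEndo_mul, hp]
    have e1 : ∀ a, (J * covEndo d Γ a B * J) *ᵥ Y = P *ᵥ ((g * covEndo d Γ a B) *ᵥ Z) :=
      fun a => by
        rw [hP, hZ, Matrix.mulVec_mulVec, Matrix.mulVec_mulVec, ← Matrix.mul_assoc,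
          Matrix.mul_assoc J g⁻¹ g, Matrix.nonsing_inv_mul _ h.isUnit, Matrix.mul_one]
    have sy : ∀ a c e, (g * covEndo d Γ a B) c e = (g * covEndo d Γ a B) e c := fun a c e => by
      have := congrFun (congrFun (h.metric_covEndo_symm a B hY) e) c
      simpa using this
    have cm : ∀ a e c, (g * covEndo d Γ a B) c e - (g * covEndo d Γ e B) c a
        = ((g * curv d Γ a e) *ᵥ Y) c := fun a e c => by
      rw [← Matrix.mulVec_mulVec]
      simp only [Matrix.mul_apply, ← Finset.sum_sub_distrib, ← mul_sub]
      simp only [hB, h.covVec_comm Y a e]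
      rfl
    have e2 : ∑ a, (P *ᵥ ((g * covEndo d Γ a B) *ᵥ Z)) a
        = ∑ a, ∑ e, P a e * ∑ c, (g * covEndo d Γ a B) c e * Z c := by
      refine Finset.sum_congr rfl fun a _ => Finset.sum_congr rfl fun e _ => ?_
      congr 1
      exact Finset.sum_congr rfl fun c _ => by rw [sy a c e]
    have e3 : ∑ a, ∑ e, P a e * ∑ c, (g * covEndo d Γ a B) c e * Z c
        = - ∑ a, ∑ e, P a e * ∑ c, (g * covEndo d Γ e B) c a * Z c := by
      rw [Finset.sum_comm]
      simp only [← Finset.sum_neg_distrib]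
      exact Finset.sum_congr rfl fun b _ => Finset.sum_congr rfl fun e _ => by
        rw [skP e b]; ring
    have e4 : ∑ a, ∑ e, P a e * ∑ c, ((g * curv d Γ a e) *ᵥ Y) c * Z c
        = (∑ a, ∑ e, P a e * ∑ c, (g * covEndo d Γ a B) c e * Z c)
          - ∑ a, ∑ e, P a e * ∑ c, (g * covEndo d Γ e B) c a * Z c := by
      simp only [← cm, sub_mul, mul_sub, Finset.sum_sub_distrib]
    have e5 : ∑ a, ∑ e, P a e * ∑ c, ((g * curv d Γ a e) *ᵥ Y) c * Z c
        = - (Z ⬝ᵥ (g * ∑ b, ∑ e, P b e • curv d Γ e b) *ᵥ Y) := by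
      simp only [Finset.mul_sum, Matrix.mul_smul, Matrix.sum_mulVec, Matrix.smul_mulVec,
        dotProduct_sum, dotProduct_smul, ← Finset.sum_neg_distrib, smul_eq_mul]
      refine Finset.sum_congr rfl fun a _ => Finset.sum_congr rfl fun e _ => ?_
      rw [curv_swap a e]
      simp only [Matrix.mul_neg, Matrix.neg_mulVec, Pi.neg_apply, dotProduct, Finset.mul_sum,
        ← Finset.sum_neg_distrib]
      exact Finset.sum_congr rfl fun c _ => by ring
    rw [h.sum_curv_eq_ric hJ hs hp, h.ric_mul_skew hJ hs hp] at e5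
    have e6 : Z ⬝ᵥ ((2 : ℝ) • -(ric d Γ * J)) *ᵥ Y = - ((2 : ℝ) • (Y ⬝ᵥ ric d Γ *ᵥ Y)) := by
      have : Y ⬝ᵥ ric d Γ *ᵥ Y = Z ⬝ᵥ (ric d Γ * J) *ᵥ Y := by
        conv_lhs => rw [← h.ric_invariant hJ hs hp]
        rw [hZ, Matrix.mul_assoc, ← Matrix.mulVec_mulVec, Matrix.dotProduct_mulVec,
          Matrix.vecMul_transpose]
      rw [this, smul_neg, Matrix.neg_mulVec, Matrix.smul_mulVec, dotProduct_neg, dotProduct_smul]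
    have e7 : ∑ a, (P *ᵥ ((g * covEndo d Γ a B) *ᵥ Z)) a = Y ⬝ᵥ ric d Γ *ᵥ Y := by
      apply two_smul_cancel
      rw [e6, neg_neg] at e5
      rw [← e5, e4, e2, two_smul]
      linear_combination e3
    have e8 : (covVec d Γ ((J * B * J) *ᵥ Y)).trace
        = (∑ a, (P *ᵥ ((g * covEndo d Γ a B) *ᵥ Z)) a) + (J * B * J * B).trace := by
      simp only [Matrix.trace, Matrix.diag_apply, covVec_mulVec, e0, e1, Finset.sum_add_distrib]
      rfl
    rw [e8, e7]
  rw [covVec_add, Matrix.trace_add, c1, c2, Matrix.trace_add, two_smul]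
  ring

/-- The one-form dual to `∇_Y Y + J ∇_{J Y} Y` in terms of differentials of functions and
one-forms. -/
theorem metric_mulVec_of_symm (Y : ι → R)
    (hY : (g * covVec d Γ Y)ᵀ = g * covVec d Γ Y) (b : ι) :
    (g *ᵥ (covVec d Γ Y *ᵥ Y + (J * covVec d Γ Y * J) *ᵥ Y)) b
      = d b (Y ⬝ᵥ g *ᵥ Y) + ∑ a, (J *ᵥ Y) a * (d a ((g *ᵥ (J *ᵥ Y)) b)
        - d b ((g *ᵥ (J *ᵥ Y)) a)) := by
  have lower : ∀ (X : ι → R) a c, d a ((g *ᵥ X) c) = (g * covVec d Γ X) c a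
      + ((Γ a)ᵀ *ᵥ (g *ᵥ X)) c := fun X a c => by
    have e : (g * covVec d Γ X) c a = (g *ᵥ fun j => d a (X j)) c + (g *ᵥ (Γ a *ᵥ X)) c := by
      simp only [Matrix.mul_apply, covVec, Matrix.of_apply, Matrix.mulVec, dotProduct, mul_add,
        Finset.sum_add_distrib]
    rw [deriv_mulVec, e, h.compat]
    simp only [Matrix.add_mulVec, Matrix.mulVec_mulVec, Pi.add_apply]
    ring
  set B := covVec d Γ Y with hB
  have hJg : Jᵀ * g = - (g * J) := by rw [← hs, Matrix.transpose_mul, h.symm]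
  have hBg : Bᵀ * g = g * B := by rw [← hY, Matrix.transpose_mul, h.symm]
  have e1 : d b (Y ⬝ᵥ g *ᵥ Y) = (2 : ℝ) • ((g * B) *ᵥ Y) b := by
    have q : d b (Y ⬝ᵥ g *ᵥ Y) = (∑ c, d b (Y c) * (g *ᵥ Y) c)
        + ∑ c, Y c * ((g * B) c b + ((Γ b)ᵀ *ᵥ (g *ᵥ Y)) c) := by
      rw [deriv_dotProduct]
      simp only [lower]; rfl
    have q2 : ∑ c, Y c * ((Γ b)ᵀ *ᵥ (g *ᵥ Y)) c = ∑ c, (Γ b *ᵥ Y) c * (g *ᵥ Y) c := by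
      change Y ⬝ᵥ (Γ b)ᵀ *ᵥ (g *ᵥ Y) = (Γ b *ᵥ Y) ⬝ᵥ (g *ᵥ Y)
      rw [Matrix.dotProduct_mulVec, Matrix.vecMul_transpose]
    have q3 : ∀ c, d b (Y c) + (Γ b *ᵥ Y) c = B c b := fun c => rfl
    have q4 : ∑ c, B c b * (g *ᵥ Y) c = ((g * B) *ᵥ Y) b := by
      rw [← hBg, ← Matrix.mulVec_mulVec]; rfl
    have q5 : ∑ c, Y c * (g * B) c b = ((g * B) *ᵥ Y) b := by
      conv_rhs => rw [← hY]
      exact Finset.sum_congr rfl fun c _ => mul_comm _ _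
    simp only [mul_add, Finset.sum_add_distrib, q2, q5] at q
    rw [q, two_smul, ← q4]
    simp only [← q3, add_mul, Finset.sum_add_distrib]
    ring
  have e2 : covVec d Γ (J *ᵥ Y) = J * B := by
    ext k a
    rw [covVec_mulVec, hp, Matrix.zero_mulVec]; simp [hB]
  have e3 : ∀ a, d a ((g *ᵥ (J *ᵥ Y)) b) - d b ((g *ᵥ (J *ᵥ Y)) a)
      = (g * (J * B)) b a - (g * (J * B)) a b := fun a => by
    have : ((Γ a)ᵀ *ᵥ (g *ᵥ (J *ᵥ Y))) b = ((Γ b)ᵀ *ᵥ (g *ᵥ (J *ᵥ Y))) a := by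
      exact Finset.sum_congr rfl fun e _ => congrArg (· * _) (h.torsion a b e)
    rw [lower, lower, e2, this]; ring
  have e4 : ∑ a, (J *ᵥ Y) a * ((g * (J * B)) b a - (g * (J * B)) a b)
      = ((g * (J * B)) *ᵥ (J *ᵥ Y)) b + ((g * (B * J)) *ᵥ (J *ᵥ Y)) b := by
    have t : (g * (J * B))ᵀ = - (g * (B * J)) := by
      rw [Matrix.transpose_mul, Matrix.transpose_mul, h.symm, Matrix.mul_assoc, hJg,
        Matrix.mul_neg, ← Matrix.mul_assoc, hBg, Matrix.mul_assoc]
    have t' : ∀ a, (g * (B * J)) b a = - (g * (J * B)) a b := fun a => by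
      have := congrFun (congrFun t b) a
      simp only [Matrix.transpose_apply, Matrix.neg_apply] at this
      rw [this, neg_neg]
    have m : ∀ (A : Matrix ι ι R) x, (A *ᵥ x) b = ∑ a, A b a * x a := fun _ _ => rfl
    rw [m, m, ← Finset.sum_add_distrib]
    simp only [t']
    exact Finset.sum_congr rfl fun a _ => by ring
  simp only [e3]
  rw [e1, e4]
  have f1 : (g * (J * B)) *ᵥ (J *ᵥ Y) = (g * (J * B * J)) *ᵥ Y := by
    rw [Matrix.mulVec_mulVec]; noncomm_ring
  have f2 : (g * (B * J)) *ᵥ (J *ᵥ Y) = - ((g * B) *ᵥ Y) := by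
    rw [Matrix.mulVec_mulVec, Matrix.mul_assoc, Matrix.mul_assoc, hJ]
    simp [Matrix.neg_mulVec]
  rw [f1, f2, Matrix.mulVec_add, Matrix.mulVec_mulVec, Matrix.mulVec_mulVec, two_smul]
  simp only [Pi.add_apply, Pi.neg_apply, Matrix.mul_assoc]
  ring

end Kahler

/-- The Hessian of a function is symmetric. -/
theorem covVec_grad_symm {Y : ι → R} {f : R} (hY : ∀ a, (g *ᵥ Y) a = d a f) :
    (g * covVec d Γ Y)ᵀ = g * covVec d Γ Y := by
  have lower : ∀ a c, (g * covVec d Γ Y) c a = d a (d c f) - ((Γ a)ᵀ *ᵥ (g *ᵥ Y)) c :=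
    fun a c => by
      have e : (g * covVec d Γ Y) c a = (g *ᵥ fun j => d a (Y j)) c + (g *ᵥ (Γ a *ᵥ Y)) c := by
        simp only [Matrix.mul_apply, covVec, Matrix.of_apply, Matrix.mulVec, dotProduct, mul_add,
          Finset.sum_add_distrib]
      rw [← hY c, deriv_mulVec, e, h.compat]
      simp only [Matrix.add_mulVec, Matrix.mulVec_mulVec, Pi.add_apply]
      ring
  ext a c
  rw [Matrix.transpose_apply, lower, lower, h.comm]
  congr 1
  exact Finset.sum_congr rfl fun e _ => congrArg (· * _) (h.torsion a c e)

end IsLeviCivita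

end

end DiffAlg

end

/-! ### The Levi-Civita connection, commuting Killing fields, and naturality of the divergence. -/

section

namespace DiffAlg

open Matrix Finset

variable {R : Type*} [CommRing R] [Algebra ℝ R] {ι : Type*} [Fintype ι] [DecidableEq ι]
  {d : ι → Derivation ℝ R R} {g : Matrix ι ι R} {Γ : ι → Matrix ι ι R}

/-- The matrices of the Christoffel symbols of the metric `g` with inverse `g'`. -/
def chris (d : ι → Derivation ℝ R R) (g g' : Matrix ι ι R) (a : ι) : Matrix ι ι R :=
  Matrix.of fun k b => (1 / 2 : ℝ) • ∑ l, g' k l * (d a (g b l) + d b (g a l) - d l (g a b))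

theorem isLeviCivita_chris {g' : Matrix ι ι R} (hcomm : ∀ a b f, d a (d b f) = d b (d a f))
    (hs : gᵀ = g) (hg : g * g' = 1) : IsLeviCivita d g (chris d g g') := by
  have hsa : ∀ a b, g a b = g b a := fun a b => by
    conv_lhs => rw [← hs]
    rfl
  have hu : IsUnit g := ⟨⟨g, g', hg, mul_eq_one_comm.1 hg⟩, rfl⟩
  refine ⟨hcomm, hs, (Matrix.isUnit_iff_isUnit_det g).1 hu, fun a b k => ?_, fun a => ?_⟩
  · simp only [chris, Matrix.of_apply, hsa a b]
    congr 1
    exact Finset.sum_congr rfl fun l _ => by ring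
  · have e : ∀ c b x, (g * chris d g g' c) x b
        = (1 / 2 : ℝ) • (d c (g b x) + d b (g c x) - d x (g c b)) := fun c b x => by
      have : (g * chris d g g' c) x b = (1 / 2 : ℝ) • ∑ l, (g * g') x l *
          (d c (g b l) + d b (g c l) - d l (g c b)) := by
        simp only [chris, Matrix.mul_apply, Matrix.of_apply, mul_smul_comm, Finset.mul_sum,
          ← Finset.smul_sum, Finset.sum_mul]
        rw [Finset.sum_comm]
        congr 1
        exact Finset.sum_congr rfl fun l _ => Finset.sum_congr rfl fun k _ => by ring
      rw [this, hg]
      simp [Matrix.one_apply]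
    ext x y
    have e2 : ((chris d g g' a)ᵀ * g) x y = (g * chris d g g' a) y x := by
      have : (chris d g g' a)ᵀ * g = (g * chris d g g' a)ᵀ := by
        rw [Matrix.transpose_mul, hs]
      rw [this]; rfl
    rw [Matrix.add_apply, e2, e, e, ← smul_add, Matrix.map_apply, hsa y x, hsa a y, hsa a x]
    apply two_smul_cancel
    rw [smul_smul]
    norm_num
    rw [two_smul]
    ring

namespace IsLeviCivita

variable (h : IsLeviCivita d g Γ)
include h

theorem deriv_metric (X Y : ι → R) (a : ι) :
    d a (X ⬝ᵥ g *ᵥ Y) = ((covVec d Γ X)ᵀ *ᵥ (g *ᵥ Y)) a + ((covVec d Γ Y)ᵀ *ᵥ (g *ᵥ X)) a := by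
  have e1 : ∀ X Y : ι → R, ((covVec d Γ X)ᵀ *ᵥ (g *ᵥ Y)) a = (fun k => d a (X k)) ⬝ᵥ (g *ᵥ Y)
      + (Γ a *ᵥ X) ⬝ᵥ (g *ᵥ Y) := fun X Y => by
    rw [← add_dotProduct]; rfl
  rw [e1, e1, deriv_dotProduct]
  have e2 : (fun j => d a ((g *ᵥ Y) j)) = g.map (d a) *ᵥ Y + g *ᵥ fun j => d a (Y j) := by
    ext j; rw [deriv_mulVec]; rfl
  rw [e2, h.compat, Matrix.add_mulVec, ← Matrix.mulVec_mulVec, ← Matrix.mulVec_mulVec,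
    dotProduct_add, dotProduct_add, Matrix.dotProduct_mulVec X (Γ a)ᵀ, Matrix.vecMul_transpose,
    h.metric_comm X, h.metric_comm X]
  ring

theorem bracket_eq (X Y : ι → R) (k : ι) :
    ∑ a, (X a * d a (Y k) - Y a * d a (X k))
      = (covVec d Γ Y *ᵥ X) k - (covVec d Γ X *ᵥ Y) k := by
  have e : ∀ X Y : ι → R, (covVec d Γ Y *ᵥ X) k = (∑ a, X a * d a (Y k))
      + ∑ a, ∑ j, Γ a k j * Y j * X a := fun X Y => by
    simp only [covVec, Matrix.mulVec, dotProduct, Matrix.of_apply, add_mul, Finset.sum_add_distrib,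
      Finset.sum_mul]
    congr 1
    exact Finset.sum_congr rfl fun a _ => mul_comm _ _
  rw [e, e, Finset.sum_sub_distrib]
  have : ∑ a, ∑ j, Γ a k j * Y j * X a = ∑ a, ∑ j, Γ a k j * X j * Y a := by
    rw [Finset.sum_comm]
    exact Finset.sum_congr rfl fun a _ => Finset.sum_congr rfl fun j _ => by
      rw [h.torsion a j]; ring
  rw [this]; ring

/-- The metric pairing of commuting Killing fields with symmetric `J ∇` has constant
`g (J X, Y)`. -/
theorem deriv_kahler_pairing {J : Matrix ι ι R} (hs : (g * J)ᵀ = - (g * J))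
    (hp : ∀ a, covEndo d Γ a J = 0) {X Y : ι → R}
    (hY : (g * covVec d Γ Y)ᵀ = - (g * covVec d Γ Y))
    (hX' : (g * (J * covVec d Γ X))ᵀ = g * (J * covVec d Γ X))
    (hY' : (g * (J * covVec d Γ Y))ᵀ = g * (J * covVec d Γ Y))
    (hXY : ∀ k, ∑ a, (X a * d a (Y k) - Y a * d a (X k)) = 0) (a : ι) :
    d a ((J *ᵥ X) ⬝ᵥ g *ᵥ Y) = 0 := by
  have e2 : covVec d Γ (J *ᵥ X) = J * covVec d Γ X := by
    ext k a
    rw [covVec_mulVec, hp, Matrix.zero_mulVec]; simp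
  have t : ∀ A : Matrix ι ι R, Aᵀ * g = (g * A)ᵀ := fun A => by rw [Matrix.transpose_mul, h.symm]
  -- If `∇Y` is skew and `J * ∇Y` is symmetric, then `∇Y` commutes with `J`.
  have sw : g * (covVec d Γ Y * J) = g * (J * covVec d Γ Y) := by
    rw [← hY', ← Matrix.mul_assoc g J, Matrix.transpose_mul, hs, Matrix.mul_neg,
      ← Matrix.mul_assoc _ g, t, hY, Matrix.neg_mul, neg_neg, Matrix.mul_assoc]
  rw [h.deriv_metric, e2, Matrix.mulVec_mulVec, Matrix.mulVec_mulVec, t, t, hX', hY,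
    Matrix.mulVec_mulVec, Matrix.neg_mul, Matrix.mul_assoc, sw, Matrix.neg_mulVec]
  have e3 : covVec d Γ Y *ᵥ X = covVec d Γ X *ᵥ Y := by
    ext k; rw [← sub_eq_zero, ← h.bracket_eq, hXY]
  simp only [← Matrix.mulVec_mulVec, Pi.neg_apply, e3]
  ring

theorem lieMetric_smul_apply (c : R) (X : ι → R) (u v : ι) :
    lieMetric d g (c • X) u v = c * lieMetric d g X u v + d u c * (g *ᵥ X) v
      + (g *ᵥ X) u * d v c := by
  have hsa : ∀ a b, g a b = g b a := fun a b => by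
    conv_lhs => rw [← h.symm]
    rfl
  have e : ∀ (X : ι → R) u v, lieMetric d g X u v = (∑ k, X k * d k (g u v))
      + (∑ k, d u (X k) * g k v) + ∑ k, g u k * d v (X k) := fun X u v => by
    simp [lieMetric, Matrix.mul_apply, Matrix.sum_apply]
  rw [e, e]
  simp only [Pi.smul_apply, smul_eq_mul, Derivation.leibniz, add_mul, mul_add,
    Finset.sum_add_distrib, Finset.mul_sum, Matrix.mulVec, dotProduct, Finset.sum_mul]
  have e1 : ∑ x, X x * d u c * g x v = ∑ x, d u c * (g v x * X x) :=
    Finset.sum_congr rfl fun x _ => by rw [hsa x v]; ring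
  have e2 : ∑ x, g u x * (X x * d v c) = ∑ x, g u x * X x * d v c :=
    Finset.sum_congr rfl fun x _ => by ring
  have e3 : ∑ x, g u x * (c * d v (X x)) = ∑ x, c * (g u x * d v (X x)) :=
    Finset.sum_congr rfl fun x _ => by ring
  rw [e1, e2, e3]
  simp only [mul_assoc]
  ring

/-- A Killing field which is a combination of commuting independent Killing fields, and commutes
with them, is a combination with constant coefficients. -/
theorem deriv_coeff_eq_zero {κ : Type*} [Fintype κ] {X : κ → ι → R} {c : κ → R}
    (hX : ∀ j, lieMetric d g (X j) = 0) (h0 : lieMetric d g (∑ j, c j • X j) = 0)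
    (hc : ∀ i j k, ∑ a, (X i a * d a (X j k) - X j a * d a (X i k)) = 0)
    (hc0 : ∀ i k, ∑ a, (X i a * d a ((∑ j, c j • X j) k) - (∑ j, c j • X j) a * d a (X i k)) = 0)
    (hG : ∀ y : κ → R, (∀ k, ∑ j, y j * (X k ⬝ᵥ g *ᵥ X j) = 0) → y = 0) (u : ι) (j : κ) :
    d u (c j) = 0 := by
  -- Bracketing the combination with `X k` leaves only the derivatives of the coefficients along `X
  -- k`. The nondegenerate Gram matrix `hG` separates them.
  have i1 : ∀ k j, ∑ a, X k a * d a (c j) = 0 := fun k => by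
    have : (fun j => ∑ a, X k a * d a (c j)) = 0 := by
      apply hG
      intro k'
      have e : ∑ j, (∑ a, X k a * d a (c j)) • X j = 0 := by
        ext y
        have q := hc0 k y
        simp only [Finset.sum_apply, Pi.smul_apply, smul_eq_mul, map_sum, Derivation.leibniz,
          Finset.mul_sum, mul_add, Finset.sum_add_distrib, Finset.sum_sub_distrib,
          Finset.sum_mul] at q ⊢
        have e1 : ∑ a, ∑ j, X k a * (c j * d a (X j y)) - ∑ a, ∑ j, c j * X j a * d a (X k y)
            = 0 := by
          rw [← Finset.sum_sub_distrib]
          simp only [← Finset.sum_sub_distrib]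
          rw [Finset.sum_comm]
          refine Finset.sum_eq_zero fun j _ => ?_
          rw [← mul_zero (c j), ← hc k j y, Finset.mul_sum]
          exact Finset.sum_congr rfl fun a _ => by ring
        have e2 : ∑ a, ∑ j, X k a * (X j y * d a (c j)) = ∑ j, ∑ a, X k a * d a (c j) * X j y := by
          rw [Finset.sum_comm]
          exact Finset.sum_congr rfl fun a _ => Finset.sum_congr rfl fun j _ => by ring
        rw [e2] at q
        simp only [Pi.zero_apply]
        linear_combination q - e1
      have e' := congrArg (fun w => X k' ⬝ᵥ g *ᵥ w) e
      simpa [Matrix.mulVec_sum, Matrix.mulVec_smul, dotProduct_sum, dotProduct_smul] using e'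
    exact fun j => congrFun this j
  have lsum : ∀ Z : κ → ι → R, lieMetric d g (∑ j, Z j) = ∑ j, lieMetric d g (Z j) := fun Z => by
    ext u v
    simp only [lieMetric, Matrix.add_apply, Matrix.mul_apply, Matrix.sum_apply, Finset.sum_apply,
      Matrix.smul_apply, Matrix.map_apply, smul_eq_mul, Matrix.transpose_apply, Matrix.of_apply,
      map_sum, Finset.sum_mul, Finset.mul_sum, Finset.sum_add_distrib]
    rw [Finset.sum_comm]
    congr 1
    · congr 1
      rw [Finset.sum_comm]
    · rw [Finset.sum_comm]
  -- The Killing equation of the combination reduces to `∑ dc_j ⊙ g(X_j, ·) = 0`. Contracted with `X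
  -- k`, half of it dies by `i1`, and `hG` applies to the rest.
  have i2 : ∀ v, ∑ j, (d u (c j) * (g *ᵥ X j) v + (g *ᵥ X j) u * d v (c j)) = 0 := fun v => by
    rw [lsum] at h0
    have := congrFun (congrFun h0 u) v
    simpa [Matrix.sum_apply, h.lieMetric_smul_apply, hX] using this
  have : (fun j => d u (c j)) = 0 := by
    apply hG
    intro k
    have q : ∑ v, X k v * ∑ j, (d u (c j) * (g *ᵥ X j) v + (g *ᵥ X j) u * d v (c j)) = 0 :=
      Finset.sum_eq_zero fun v _ => by rw [i2, mul_zero]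
    simp only [Finset.mul_sum, mul_add, Finset.sum_add_distrib] at q
    rw [Finset.sum_comm] at q
    have q2 : ∑ v, ∑ j, X k v * ((g *ᵥ X j) u * d v (c j)) = 0 := by
      rw [Finset.sum_comm]
      refine Finset.sum_eq_zero fun j _ => ?_
      rw [← mul_zero ((g *ᵥ X j) u), ← i1 k j, Finset.mul_sum]
      exact Finset.sum_congr rfl fun a _ => by ring
    rw [q2, add_zero] at q
    rw [← q]
    refine Finset.sum_congr rfl fun j _ => ?_
    simp only [dotProduct, Finset.mul_sum]
    exact Finset.sum_congr rfl fun a _ => by ring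
  exact congrFun this j

end IsLeviCivita

/-- The trace of the connection matrix in terms of the metric. -/
theorem two_smul_trace_covVec (h : IsLeviCivita d g Γ) (X : ι → R) :
    (2 : ℝ) • (covVec d Γ X).trace = (2 : ℝ) • (∑ a, d a (X a))
      + ∑ c, X c * (g⁻¹ * g.map (d c)).trace := by
  rw [covVec_eq h.torsion, Matrix.trace_add, smul_add]
  congr 1
  rw [Matrix.trace_sum, Finset.smul_sum]
  refine Finset.sum_congr rfl fun c _ => ?_
  have : (g⁻¹ * g.map (d c)).trace = (2 : ℝ) • (Γ c).trace := by
    rw [h.compat, Matrix.mul_add, ← Matrix.mul_assoc g⁻¹ g, Matrix.nonsing_inv_mul _ h.isUnit,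
      Matrix.one_mul, Matrix.trace_add, Matrix.trace_mul_comm, Matrix.mul_assoc,
      Matrix.mul_nonsing_inv _ h.isUnit, Matrix.mul_one, Matrix.trace_transpose, two_smul]
  rw [this, Matrix.trace_smul, smul_eq_mul, mul_smul_comm]

/-- Naturality of the divergence under a change of coordinates. -/
theorem trace_covVec_natural {R' : Type*} [CommRing R'] [Algebra ℝ R']
    {d' : ι → Derivation ℝ R' R'} {g' : Matrix ι ι R'} {Γ' : ι → Matrix ι ι R'}
    (h : IsLeviCivita d g Γ) (h' : IsLeviCivita d' g' Γ') (φ : R' →+* R) (P : Matrix ι ι R)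
    (hP : IsUnit P.det) (hφ : ∀ a u, d a (φ u) = ∑ k, P k a * φ (d' k u))
    (hPs : ∀ a b k, d a (P k b) = d b (P k a)) (hg : Pᵀ * g'.map φ * P = g)
    {X : ι → R} {X' : ι → R'} (hX : ∀ k, φ (X' k) = (P *ᵥ X) k) :
    φ (covVec d' Γ' X').trace = (covVec d Γ X).trace := by
  apply two_smul_cancel
  have e0 : (2 : ℝ) • φ (covVec d' Γ' X').trace = φ ((2 : ℝ) • (covVec d' Γ' X').trace) := by
    rw [two_smul, two_smul, map_add]
  rw [e0, two_smul_trace_covVec h, two_smul_trace_covVec h', map_add]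
  -- `D` is the derivative along `X`. Twice the divergence is `2 ∑ ∂_a X^a + tr (g⁻¹ D g)`. Passing
  -- from `g'` to `g` adds `2 tr (P⁻¹ D P)` to the second term, which is what the first term loses.
  set D : Derivation ℝ R R := ∑ a, X a • d a with hD
  have hDu : ∀ u, D u = ∑ a, X a * d a u := fun u => by
    simp only [hD]
    induction (Finset.univ : Finset ι) using Finset.induction_on with
    | empty => simp
    | insert a s ha ih => rw [Finset.sum_insert ha, Finset.sum_insert ha, ← ih]; rfl
  set G := g'.map φ with hG
  have hGu : IsUnit G.det := by
    have : G.det = φ g'.det := (RingHom.map_det φ g').symm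
    rw [this]
    exact h'.isUnit.map φ
  have hGi : (g'⁻¹).map φ = G⁻¹ := by
    have : (g'⁻¹).map φ * G = 1 := by
      rw [hG, ← Matrix.map_mul, Matrix.nonsing_inv_mul _ h'.isUnit]
      simp
    exact (Matrix.inv_eq_left_inv this).symm
  have e1 : φ (∑ a, d' a (X' a)) = (∑ a, d a (X a)) + (P⁻¹ * P.map D).trace := by
    set E : Matrix ι ι R := Matrix.of fun k l => φ (d' l (X' k)) with hE
    have q : E * P = P.map D + P * Matrix.of fun k a => d a (X k) := by
      ext k a
      have q1 := hφ a (X' k)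
      rw [hX, deriv_mulVec] at q1
      rw [Matrix.mul_apply]
      simp only [hE, Matrix.of_apply, Matrix.add_apply, Matrix.map_apply, hDu]
      rw [Finset.sum_congr rfl fun l _ => mul_comm (φ _) _, ← q1]
      congr 1
      exact Finset.sum_congr rfl fun b _ => by
        change d a (P k b) * X b = _
        rw [hPs, mul_comm]
    have q2 : E = (E * P) * P⁻¹ := by
      rw [Matrix.mul_assoc, Matrix.mul_nonsing_inv _ hP, Matrix.mul_one]
    have q3 : φ (∑ a, d' a (X' a)) = E.trace := by
      simp [hE, Matrix.trace]
    rw [q3, q2, q, Matrix.trace_mul_comm, Matrix.mul_add, Matrix.trace_add, ← Matrix.mul_assoc,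
      Matrix.nonsing_inv_mul _ hP, Matrix.one_mul, add_comm]
    rfl
  have e2 : φ (∑ c, X' c * (g'⁻¹ * g'.map (d' c)).trace) = (G⁻¹ * G.map D).trace := by
    have q1 : G.map D = ∑ k, (P *ᵥ X) k • (g'.map (d' k)).map φ := by
      ext i j
      simp only [hG, Matrix.map_apply, hDu, hφ, Matrix.sum_apply, Matrix.smul_apply, smul_eq_mul,
        Finset.mul_sum, Matrix.mulVec, dotProduct, Finset.sum_mul]
      rw [Finset.sum_comm]
      exact Finset.sum_congr rfl fun a _ => Finset.sum_congr rfl fun b _ => by ring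
    rw [q1, Finset.mul_sum, Matrix.trace_sum, map_sum]
    refine Finset.sum_congr rfl fun k _ => ?_
    have q2 : φ (g'⁻¹ * g'.map (d' k)).trace = (G⁻¹ * (g'.map (d' k)).map φ).trace := by
      rw [← hGi, ← Matrix.map_mul, Matrix.trace, map_sum]
      rfl
    rw [map_mul, hX, q2, Matrix.mul_smul, Matrix.trace_smul, smul_eq_mul]
  have e3 : ∑ c, X c * (g⁻¹ * g.map (d c)).trace = (g⁻¹ * g.map D).trace := by
    have q1 : g.map D = ∑ c, X c • g.map (d c) := by
      ext i j
      simp [hDu, Matrix.sum_apply]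
    rw [q1, Finset.mul_sum, Matrix.trace_sum]
    exact Finset.sum_congr rfl fun c _ => by rw [Matrix.mul_smul, Matrix.trace_smul, smul_eq_mul]
  have e4 : (g⁻¹ * g.map D).trace = (2 : ℝ) • (P⁻¹ * P.map D).trace + (G⁻¹ * G.map D).trace := by
    have tr : (Pᵀ).map D = (P.map D)ᵀ := rfl
    have i1 : P * P⁻¹ = 1 := Matrix.mul_nonsing_inv _ hP
    have i2 : Pᵀ⁻¹ * Pᵀ = 1 := Matrix.nonsing_inv_mul _ (by rwa [Matrix.det_transpose])
    have i3 : G⁻¹ * G = 1 := Matrix.nonsing_inv_mul _ hGu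
    have i4 : G * G⁻¹ = 1 := Matrix.mul_nonsing_inv _ hGu
    rw [← hg, map_mul_deriv, map_mul_deriv, tr, Matrix.mul_inv_rev, Matrix.mul_inv_rev]
    have t1 : (P⁻¹ * (G⁻¹ * Pᵀ⁻¹) * ((P.map D)ᵀ * G * P)).trace = (P⁻¹ * P.map D).trace := by
      calc _ = ((P⁻¹ * (G⁻¹ * Pᵀ⁻¹) * ((P.map D)ᵀ * G)) * P).trace := by
            rw [← Matrix.mul_assoc _ _ P]
        _ = ((P * P⁻¹) * (G⁻¹ * (Pᵀ⁻¹ * (P.map D)ᵀ) * G)).trace := by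
            rw [Matrix.trace_mul_comm]; simp only [Matrix.mul_assoc]
        _ = ((G * G⁻¹) * (Pᵀ⁻¹ * (P.map D)ᵀ)).trace := by
            rw [i1, Matrix.one_mul, Matrix.trace_mul_comm, Matrix.mul_assoc]
        _ = (P⁻¹ * P.map D).trace := by
            rw [i4, Matrix.one_mul, ← Matrix.transpose_nonsing_inv, ← Matrix.transpose_mul,
              Matrix.trace_transpose, Matrix.trace_mul_comm]
    have t2 : (P⁻¹ * (G⁻¹ * Pᵀ⁻¹) * (Pᵀ * G.map D * P)).trace = (G⁻¹ * G.map D).trace := by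
      calc _ = ((P⁻¹ * (G⁻¹ * ((Pᵀ⁻¹ * Pᵀ) * G.map D))) * P).trace := by
            simp only [Matrix.mul_assoc]
        _ = _ := by rw [i2, Matrix.one_mul, Matrix.trace_mul_comm, ← Matrix.mul_assoc, i1,
              Matrix.one_mul]
    have t3 : (P⁻¹ * (G⁻¹ * Pᵀ⁻¹) * (Pᵀ * G * P.map D)).trace = (P⁻¹ * P.map D).trace := by
      calc _ = (P⁻¹ * (G⁻¹ * ((Pᵀ⁻¹ * Pᵀ) * (G * P.map D)))).trace := by
            simp only [Matrix.mul_assoc]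
        _ = _ := by rw [i2, Matrix.one_mul, ← Matrix.mul_assoc G⁻¹, i3, Matrix.one_mul]
    simp only [Matrix.add_mul, Matrix.mul_add, Matrix.trace_add]
    rw [t1, t2, t3, two_smul]
    ring
  have e5 : φ ((2 : ℝ) • ∑ a, d' a (X' a)) = (2 : ℝ) • φ (∑ a, d' a (X' a)) := by
    rw [two_smul, two_smul, map_add]
  rw [e5, e1, e2, e3, e4, smul_add]
  ring

end DiffAlg

end

/-! ### The ring of smooth functions on a coordinate domain, and the concrete tensors as its
matrices. -/

section

open DiffAlg

variable {m : ℕ} {O : Set (Fin m → ℝ)}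

/-- The algebra of smooth functions on `O`. -/
def smoothFn (O : Set (Fin m → ℝ)) : Subalgebra ℝ (O → ℝ) where
  carrier := {f | ∃ F : (Fin m → ℝ) → ℝ, ContDiffOn ℝ ∞ F O ∧ ∀ z : O, F z = f z}
  mul_mem' := by
    rintro f f' ⟨F, hF, h⟩ ⟨F', hF', h'⟩
    exact ⟨fun z => F z * F' z, hF.mul hF', fun z => by simp [h, h']⟩
  add_mem' := by
    rintro f f' ⟨F, hF, h⟩ ⟨F', hF', h'⟩
    exact ⟨fun z => F z + F' z, hF.add hF', fun z => by simp [h, h']⟩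
  algebraMap_mem' r := ⟨fun _ => r, contDiffOn_const, fun _ => rfl⟩

namespace smoothFn

/-- An extension of a smooth function on `O` to the whole space. -/
def rep (f : smoothFn O) : (Fin m → ℝ) → ℝ := f.2.choose

theorem contDiffOn_rep (f : smoothFn O) : ContDiffOn ℝ ∞ (rep f) O := f.2.choose_spec.1

theorem rep_apply (f : smoothFn O) (z : O) : (rep f) z = f.1 z := f.2.choose_spec.2 z

/-- The restriction to `O` of a function which is smooth on `O`. -/
def of (F : (Fin m → ℝ) → ℝ) (hF : ContDiffOn ℝ ∞ F O) : smoothFn O :=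
  ⟨fun z => F z, F, hF, fun _ => rfl⟩

/-- Evaluation at a point. -/
def ev (z : O) : smoothFn O →+* ℝ where
  toFun f := f.1 z
  map_one' := rfl
  map_mul' _ _ := rfl
  map_zero' := rfl
  map_add' _ _ := rfl

theorem ev_injective {f f' : smoothFn O} (h : ∀ z, ev z f = ev z f') : f = f' :=
  Subtype.ext (funext h)

@[simp] theorem ev_of (F : (Fin m → ℝ) → ℝ) (hF : ContDiffOn ℝ ∞ F O) (z : O) :
    ev z (of F hF) = F z := rfl

theorem ev_smul (z : O) (r : ℝ) (f : smoothFn O) : ev z (r • f) = r * ev z f := rfl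

theorem contDiffOn_of_ev {F : (Fin m → ℝ) → ℝ} {f : smoothFn O} (h : ∀ z : O, F z = ev z f) :
    ContDiffOn ℝ ∞ F O :=
  (contDiffOn_rep f).congr fun z hz => (h ⟨z, hz⟩).trans (rep_apply f ⟨z, hz⟩).symm

theorem isUnit_of_ne_zero {f : smoothFn O} (h : ∀ z, ev z f ≠ 0) : IsUnit f := by
  have hc : ContDiffOn ℝ ∞ (fun z => ((rep f) z)⁻¹) O :=
    (contDiffOn_rep f).inv fun z hz => by rw [rep_apply f ⟨z, hz⟩]; exact h ⟨z, hz⟩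
  refine IsUnit.of_mul_eq_one (of _ hc) (ev_injective fun z => ?_)
  rw [map_mul, ev_of, rep_apply f, map_one]
  exact mul_inv_cancel₀ (h z)

end smoothFn

open smoothFn

theorem Coord.pderiv_congr {F F' : (Fin m → ℝ) → ℝ} (hO : IsOpen O) (h : ∀ z ∈ O, F z = F' z)
    {z : Fin m → ℝ} (hz : z ∈ O) (k : Fin m) : Coord.pderiv k F z = Coord.pderiv k F' z := by
  have : F =ᶠ[𝓝 z] F' := Filter.eventuallyEq_of_mem (hO.mem_nhds hz) h
  rw [Coord.pderiv, Coord.pderiv, this.fderiv_eq]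

theorem Coord.contDiffOn_pderiv {F : (Fin m → ℝ) → ℝ} (hO : IsOpen O) (hF : ContDiffOn ℝ ∞ F O)
    (k : Fin m) : ContDiffOn ℝ ∞ (Coord.pderiv k F) O :=
  (hF.fderiv_of_isOpen hO (by simp)).clm_apply contDiffOn_const

theorem smoothFn.differentiableAt_rep (hO : IsOpen O) (f : smoothFn O) (z : O) :
    DifferentiableAt ℝ (rep f) z :=
  (((contDiffOn_rep f).differentiableOn (by simp)) z z.2).differentiableAt (hO.mem_nhds z.2)

/-- The partial derivative as a derivation of the algebra of smooth functions. -/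
def pd (hO : IsOpen O) (k : Fin m) : Derivation ℝ (smoothFn O) (smoothFn O) :=
  Derivation.mk'
    { toFun := fun f => of (Coord.pderiv k (rep f)) (Coord.contDiffOn_pderiv hO (contDiffOn_rep f) k)
      map_add' := fun f f' => ev_injective fun z => by
        rw [map_add, ev_of, ev_of, ev_of, Coord.pderiv_congr hO
          (F' := fun y => (rep f) y + (rep f') y) (fun y hy => by
            rw [rep_apply (f + f') ⟨y, hy⟩, rep_apply f ⟨y, hy⟩, rep_apply f' ⟨y, hy⟩]; rfl) z.2 k]
        simp only [Coord.pderiv]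
        rw [fderiv_fun_add (differentiableAt_rep hO f z) (differentiableAt_rep hO f' z)]
        rfl
      map_smul' := fun r f => ev_injective fun z => by
        rw [RingHom.id_apply, ev_smul, ev_of, ev_of, Coord.pderiv_congr hO
          (F' := fun y => r * (rep f) y) (fun y hy => by
            rw [rep_apply (r • f) ⟨y, hy⟩, rep_apply f ⟨y, hy⟩]; rfl) z.2 k]
        simp only [Coord.pderiv]
        rw [fderiv_const_mul (differentiableAt_rep hO f z)]
        rfl }
    (fun f f' => ev_injective fun z => by
      simp only [LinearMap.coe_mk, AddHom.coe_mk, smul_eq_mul, map_add, map_mul, ev_of]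
      rw [Coord.pderiv_congr hO (F' := fun y => (rep f) y * (rep f') y) (fun y hy => by
            rw [rep_apply (f * f') ⟨y, hy⟩, rep_apply f ⟨y, hy⟩, rep_apply f' ⟨y, hy⟩]; rfl) z.2 k]
      simp only [Coord.pderiv]
      rw [fderiv_fun_mul (differentiableAt_rep hO f z) (differentiableAt_rep hO f' z),
        rep_apply f z, rep_apply f' z]
      rfl)

/-- The bridge between calculus and algebra: as `O` is open, the partial derivatives do not depend
on how the function is extended off `O`. -/
theorem pderiv_eq_ev (hO : IsOpen O) {F : (Fin m → ℝ) → ℝ} {f : smoothFn O}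
    (h : ∀ z : O, F z = ev z f) (k : Fin m) (z : O) :
    Coord.pderiv k F z = ev z (pd hO k f) :=
  Coord.pderiv_congr hO (fun y hy => (h ⟨y, hy⟩).trans (rep_apply f ⟨y, hy⟩).symm) z.2 k

theorem pd_comm (hO : IsOpen O) (a b : Fin m) (f : smoothFn O) :
    pd hO a (pd hO b f) = pd hO b (pd hO a f) := by
  refine ev_injective fun z => ?_
  rw [← pderiv_eq_ev hO (f := pd hO b f) (F := Coord.pderiv b (rep f)) (fun _ => rfl) a z,
    ← pderiv_eq_ev hO (f := pd hO a f) (F := Coord.pderiv a (rep f)) (fun _ => rfl) b z]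
  have hc : ContDiffAt ℝ ∞ (rep f) z := (contDiffOn_rep f).contDiffAt (hO.mem_nhds z.2)
  have hs : IsSymmSndFDerivAt ℝ (rep f) z := hc.isSymmSndFDerivAt (by simp only [minSmoothness_of_isRCLikeNormedField]; exact WithTop.coe_le_coe.2 le_top)
  have hd : DifferentiableAt ℝ (fderiv ℝ (rep f)) z :=
    (hc.fderiv_right (m := 1) (by norm_cast)).differentiableAt (by simp)
  have e : ∀ a b : Fin m, Coord.pderiv a (Coord.pderiv b (rep f)) z
      = fderiv ℝ (fderiv ℝ (rep f)) z (Pi.single a 1) (Pi.single b 1) := fun a b => by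
    have : (Coord.pderiv b (rep f)) = fun y => fderiv ℝ (rep f) y (Pi.single b 1) := rfl
    rw [Coord.pderiv, this, fderiv_clm_apply hd (differentiableAt_const _)]
    simp
  rw [e, e, hs.eq]

theorem fderiv_apply_eq_sum {F : (Fin m → ℝ) → ℝ} {z : Fin m → ℝ} (v : Fin m → ℝ) :
    fderiv ℝ F z v = ∑ k, v k * Coord.pderiv k F z := by
  conv_lhs => rw [pi_eq_sum_univ' v, map_sum]
  refine Finset.sum_congr rfl fun k _ => ?_
  rw [map_smul]
  rfl

/-! ### Tensors over the algebra of smooth functions -/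

/-- A matrix of smooth functions. -/
def ofMat {ι κ : Type*} (A : (Fin m → ℝ) → Matrix ι κ ℝ)
    (hA : ∀ a b, ContDiffOn ℝ ∞ (fun z => A z a b) O) : Matrix ι κ (smoothFn O) :=
  Matrix.of fun a b => of _ (hA a b)

theorem map_ev_inv {ι : Type*} [Fintype ι] [DecidableEq ι] {A : Matrix ι ι (smoothFn O)}
    (hA : IsUnit A.det) (z : O) : (A⁻¹).map (ev z) = (A.map (ev z))⁻¹ := by
  have : (A⁻¹).map (ev z) * A.map (ev z) = 1 := by
    rw [← Matrix.map_mul, Matrix.nonsing_inv_mul _ hA]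
    simp
  exact (Matrix.inv_eq_left_inv this).symm

theorem isUnit_det_of_ev {ι : Type*} [Fintype ι] [DecidableEq ι] {A : Matrix ι ι (smoothFn O)}
    (hA : ∀ z, IsUnit (A.map (ev z)).det) : IsUnit A.det :=
  isUnit_of_ne_zero fun z => by
    rw [RingHom.map_det]
    exact (hA z).ne_zero

theorem matrix_ev_injective {ι κ : Type*} {A B : Matrix ι κ (smoothFn O)}
    (h : ∀ z, A.map (ev z) = B.map (ev z)) : A = B := by
  refine Matrix.ext fun a b => ?_
  exact ev_injective fun z => congrFun (congrFun (h z) a) b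

theorem ev_dotProduct {ι : Type*} [Fintype ι] (z : O) (u v : ι → smoothFn O) :
    ev z (u ⬝ᵥ v) = (fun k => ev z (u k)) ⬝ᵥ fun k => ev z (v k) := by
  simp [dotProduct, map_sum]

theorem ev_mulVec {ι κ : Type*} [Fintype κ] (z : O) (A : Matrix ι κ (smoothFn O))
    (v : κ → smoothFn O) (k : ι) :
    ev z ((A *ᵥ v) k) = (A.map (ev z) *ᵥ fun k => ev z (v k)) k := by
  simp [Matrix.mulVec, dotProduct, map_sum]

/-- A smooth Riemannian metric in a coordinate domain. -/
structure IsMetricOn (g : (Fin m → ℝ) → Matrix (Fin m) (Fin m) ℝ) (O : Set (Fin m → ℝ)) :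
    Prop where
  isOpen : IsOpen O
  smooth : ∀ a b, ContDiffOn ℝ ∞ (fun z => g z a b) O
  posDef : ∀ z ∈ O, (g z).PosDef

namespace IsMetricOn

variable {g : (Fin m → ℝ) → Matrix (Fin m) (Fin m) ℝ} (h : IsMetricOn g O)

/-- The metric as a matrix of smooth functions. -/
def met (h : IsMetricOn g O) : Matrix (Fin m) (Fin m) (smoothFn O) := ofMat g h.smooth

/-- The Christoffel symbols as matrices of smooth functions. -/
def conn (h : IsMetricOn g O) : Fin m → Matrix (Fin m) (Fin m) (smoothFn O) :=
  chris (pd h.isOpen) h.met h.met⁻¹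

include h

theorem mono {O' : Set (Fin m → ℝ)} (hO' : IsOpen O') (hs : O' ⊆ O) : IsMetricOn g O' :=
  ⟨hO', fun a b => (h.smooth a b).mono hs, fun z hz => h.posDef z (hs hz)⟩

theorem isUnit_det (z : O) : IsUnit (g z).det := (h.posDef z z.2).det_pos.ne'.isUnit

theorem isUnit_det_met : IsUnit h.met.det :=
  isUnit_det_of_ev fun z => h.isUnit_det z

theorem inv_met_map (z : O) : (h.met⁻¹).map (ev z) = (g z)⁻¹ := map_ev_inv h.isUnit_det_met z

theorem isLeviCivita : IsLeviCivita (pd h.isOpen) h.met h.conn := by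
  refine isLeviCivita_chris (pd_comm h.isOpen) ?_ (Matrix.mul_nonsing_inv _ h.isUnit_det_met)
  refine matrix_ev_injective fun z => ?_
  have := (h.posDef z z.2).isHermitian.eq
  rw [Matrix.conjTranspose_eq_transpose_of_trivial] at this
  exact this

theorem christoffel_eq (k a b : Fin m) (z : O) :
    Coord.christoffel g k a b z = ev z (h.conn a k b) := by
  simp only [Coord.christoffel, conn, chris, Matrix.of_apply, ev_smul, map_sum, map_mul, map_add,
    map_sub]
  congr 1
  refine Finset.sum_congr rfl fun l _ => ?_
  have e : ev z (h.met⁻¹ k l) = (g z)⁻¹ k l := congrFun (congrFun (h.inv_met_map z) k) l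
  have q : ∀ a b c, Coord.pderiv a (fun y => g y b c) z = ev z (pd h.isOpen a (h.met b c)) :=
    fun a b c => pderiv_eq_ev h.isOpen (fun _ => rfl) a z
  rw [e, q, q, q]

theorem riemann_eq (k a b c : Fin m) (z : O) :
    Coord.riemann g k a b c z = ev z (curv (pd h.isOpen) h.conn a b k c) := by
  have q : ∀ a b k c, Coord.pderiv a (Coord.christoffel g k b c) z
      = ev z (pd h.isOpen a (h.conn b k c)) :=
    fun a b k c => pderiv_eq_ev h.isOpen (fun z => h.christoffel_eq k b c z) a z
  simp only [Coord.riemann, curv, Matrix.add_apply, Matrix.sub_apply, Matrix.map_apply,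
    Matrix.mul_apply, map_add, map_sub, map_sum, map_mul, q, h.christoffel_eq,
    Finset.sum_sub_distrib]

theorem ricci_eq (z : O) : Coord.ricci g z = (ric (pd h.isOpen) h.conn).map (ev z) := by
  ext b c
  simp [Coord.ricci, ric, h.riemann_eq]

/-- The gradient of a smooth function. -/
def gr (h : IsMetricOn g O) (f : smoothFn O) : Fin m → smoothFn O :=
  h.met⁻¹ *ᵥ fun a => pd h.isOpen a f

theorem met_gr (f : smoothFn O) (a : Fin m) : (h.met *ᵥ h.gr f) a = pd h.isOpen a f := by
  rw [gr, Matrix.mulVec_mulVec, Matrix.mul_nonsing_inv _ h.isUnit_det_met, Matrix.one_mulVec]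

theorem grad_eq {F : (Fin m → ℝ) → ℝ} {f : smoothFn O} (hF : ∀ z : O, F z = ev z f) (k : Fin m)
    (z : O) : Coord.grad g F z k = ev z (h.gr f k) := by
  rw [gr, ev_mulVec, h.inv_met_map]
  simp only [Coord.grad, pderiv_eq_ev h.isOpen hF]
  rfl

theorem divergence_eq {X : (Fin m → ℝ) → (Fin m → ℝ)} {Y : Fin m → smoothFn O}
    (hX : ∀ (z : O) k, X z k = ev z (Y k)) (z : O) :
    Coord.divergence g X z = ev z (covVec (pd h.isOpen) h.conn Y).trace := by
  simp only [Coord.divergence, covVec, Matrix.trace, Matrix.diag_apply, Matrix.of_apply, map_sum,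
    map_add, Matrix.mulVec, dotProduct, map_mul, hX, h.christoffel_eq]
  refine Finset.sum_congr rfl fun k _ => ?_
  rw [pderiv_eq_ev h.isOpen (fun z => hX z k)]

theorem laplacian_eq {F : (Fin m → ℝ) → ℝ} {f : smoothFn O} (hF : ∀ z : O, F z = ev z f) (z : O) :
    Coord.laplacian g F z = - ev z (covVec (pd h.isOpen) h.conn (h.gr f)).trace := by
  rw [Coord.laplacian, h.divergence_eq (fun z k => h.grad_eq hF k z)]

end IsMetricOn

end

/-! ### Naturality of gradients and of `∇_Y Y + J ∇_{J Y} Y`; Kähler structures in a coordinate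
domain. -/

section

namespace DiffAlg

open Matrix Finset

variable {R R' : Type*} [CommRing R] [Algebra ℝ R] [CommRing R'] [Algebra ℝ R'] {ι : Type*}
  [Fintype ι] [DecidableEq ι]
  {d : ι → Derivation ℝ R R} {g : Matrix ι ι R} {Γ : ι → Matrix ι ι R}
  {d' : ι → Derivation ℝ R' R'} {g' : Matrix ι ι R'} {Γ' : ι → Matrix ι ι R'}

theorem map_mulVec_apply {κ : Type*} (φ : R' →+* R) (A : Matrix κ ι R') (v : ι → R') (k : κ) :
    φ ((A *ᵥ v) k) = (A.map φ *ᵥ fun j => φ (v j)) k := by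
  simp [Matrix.mulVec, dotProduct, map_sum]

/-- Reduces the naturality of a vector field to that of the dual one-form, for which the chain rule
suffices. -/
theorem map_eq_mulVec_of_lower (φ : R' →+* R) (P : Matrix ι ι R) (hgu : IsUnit g.det)
    (hP : IsUnit P.det) (hg : Pᵀ * g'.map φ * P = g) {X : ι → R} {X' : ι → R'}
    (hX : g *ᵥ X = Pᵀ *ᵥ fun k => φ ((g' *ᵥ X') k)) (k : ι) : φ (X' k) = (P *ᵥ X) k := by
  have hG : IsUnit (g'.map φ).det := by
    have := hgu
    rw [← hg, Matrix.det_mul, Matrix.det_mul] at this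
    exact isUnit_of_mul_isUnit_right (isUnit_of_mul_isUnit_left this)
  have hPt : IsUnit (Pᵀ).det := by rwa [Matrix.det_transpose]
  have : (fun k => φ ((g' *ᵥ X') k)) = g'.map φ *ᵥ fun k => φ (X' k) := by
    ext k; rw [map_mulVec_apply]
  rw [this, ← hg, Matrix.mul_assoc, ← Matrix.mulVec_mulVec] at hX
  have h2 := congrArg (fun v => (Pᵀ)⁻¹ *ᵥ v) hX
  simp only [Matrix.mulVec_mulVec] at h2
  rw [← Matrix.mul_assoc, Matrix.nonsing_inv_mul _ hPt, Matrix.one_mul, ← Matrix.mul_assoc,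
    Matrix.nonsing_inv_mul _ hPt, Matrix.one_mul, ← Matrix.mulVec_mulVec] at h2
  have h3 := congrArg (fun v => (g'.map φ)⁻¹ *ᵥ v) h2
  simp only [Matrix.mulVec_mulVec _ (g'.map φ)⁻¹] at h3
  rw [Matrix.nonsing_inv_mul _ hG, Matrix.one_mulVec, Matrix.one_mulVec] at h3
  exact (congrFun h3 k).symm

theorem grad_natural (φ : R' →+* R) (P : Matrix ι ι R) (hgu : IsUnit g.det)
    (hP : IsUnit P.det) (hφ : ∀ a u, d a (φ u) = ∑ k, P k a * φ (d' k u))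
    (hg : Pᵀ * g'.map φ * P = g) {Y : ι → R} {Y' : ι → R'} {f' : R'}
    (hY : ∀ a, (g *ᵥ Y) a = d a (φ f')) (hY' : ∀ a, (g' *ᵥ Y') a = d' a f') (k : ι) :
    φ (Y' k) = (P *ᵥ Y) k := by
  refine map_eq_mulVec_of_lower φ P hgu hP hg ?_ k
  ext a
  rw [hY, hφ]
  simp only [hY']
  rfl

/-- Naturality of the field `∇_Y Y + J ∇_{J Y} Y` for a gradient field `Y`. -/
theorem kahlerField_natural (h : IsLeviCivita d g Γ) (h' : IsLeviCivita d' g' Γ') (φ : R' →+* R)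
    (P : Matrix ι ι R) (hP : IsUnit P.det) (hφ : ∀ a u, d a (φ u) = ∑ k, P k a * φ (d' k u))
    (hPs : ∀ a b k, d a (P k b) = d b (P k a)) (hg : Pᵀ * g'.map φ * P = g)
    {J : Matrix ι ι R} (hJ : J * J = -1) (hs : (g * J)ᵀ = - (g * J))
    (hp : ∀ a, covEndo d Γ a J = 0) {J' : Matrix ι ι R'} (hJ' : J' * J' = -1)
    (hs' : (g' * J')ᵀ = - (g' * J')) (hp' : ∀ a, covEndo d' Γ' a J' = 0)
    (hJP : J'.map φ * P = P * J) {Y : ι → R} {Y' : ι → R'} {f' : R'}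
    (hY : ∀ a, (g *ᵥ Y) a = d a (φ f')) (hY' : ∀ a, (g' *ᵥ Y') a = d' a f') (k : ι) :
    φ ((covVec d' Γ' Y' *ᵥ Y' + (J' * covVec d' Γ' Y' * J') *ᵥ Y') k)
      = (P *ᵥ (covVec d Γ Y *ᵥ Y + (J * covVec d Γ Y * J) *ᵥ Y)) k := by
  have nY := grad_natural φ P h.isUnit hP hφ hg hY hY'
  have mv := fun (A : Matrix ι ι R') (v : ι → R') => map_mulVec_apply φ A v
  have nYf : (fun k => φ (Y' k)) = P *ᵥ Y := funext nY
  have nZ : ∀ k, φ ((J' *ᵥ Y') k) = (P *ᵥ (J *ᵥ Y)) k := fun k => by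
    rw [mv, nYf, Matrix.mulVec_mulVec, hJP, Matrix.mulVec_mulVec]
  have nZf : (fun k => φ ((J' *ᵥ Y') k)) = P *ᵥ (J *ᵥ Y) := funext nZ
  have low : ∀ (X : ι → R) (X' : ι → R'), (∀ k, φ (X' k) = (P *ᵥ X) k) →
      g *ᵥ X = Pᵀ *ᵥ fun k => φ ((g' *ᵥ X') k) := fun X X' hX => by
    have : (fun k => φ ((g' *ᵥ X') k)) = g'.map φ *ᵥ (P *ᵥ X) := by
      ext k; rw [mv, funext hX]
    rw [this, ← hg, Matrix.mulVec_mulVec, Matrix.mulVec_mulVec, Matrix.mul_assoc]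
  -- By `metric_mulVec_of_symm` the dual one-form is built from differentials of a function and of a
  -- one-form only. No transformation rule for Christoffel symbols is needed.
  refine map_eq_mulVec_of_lower φ P h.isUnit hP hg ?_ k
  have nu : φ (Y' ⬝ᵥ g' *ᵥ Y') = Y ⬝ᵥ g *ᵥ Y := by
    rw [low Y Y' nY, Matrix.dotProduct_mulVec Y, Matrix.vecMul_transpose, ← nYf]
    simp [dotProduct, map_sum]
  have nζ := low _ _ nZ
  have nζ' : ∀ b, (g *ᵥ (J *ᵥ Y)) b = ∑ k, P k b * φ ((g' *ᵥ (J' *ᵥ Y')) k) := fun b => by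
    rw [nζ]; rfl
  -- The exterior derivative is natural: the second derivatives of the coordinate change are
  -- symmetric by `hPs` and cancel.
  have ext : ∀ a b, d a ((g *ᵥ (J *ᵥ Y)) b) - d b ((g *ᵥ (J *ᵥ Y)) a)
      = ∑ k, ∑ l, P k b * P l a * φ (d' l ((g' *ᵥ (J' *ᵥ Y')) k) - d' k ((g' *ᵥ (J' *ᵥ Y')) l)) := by
    intro a b
    have q : ∀ a b, d a ((g *ᵥ (J *ᵥ Y)) b) = (∑ k, φ ((g' *ᵥ (J' *ᵥ Y')) k) * d a (P k b))
        + ∑ k, ∑ l, P k b * P l a * φ (d' l ((g' *ᵥ (J' *ᵥ Y')) k)) := fun a b => by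
      rw [nζ', map_sum, ← Finset.sum_add_distrib]
      refine Finset.sum_congr rfl fun k _ => ?_
      rw [Derivation.leibniz, hφ, smul_eq_mul, smul_eq_mul, Finset.mul_sum, add_comm]
      congr 1
      exact Finset.sum_congr rfl fun l _ => by ring
    rw [q, q]
    simp only [map_sub, mul_sub, Finset.sum_sub_distrib, hPs b a]
    rw [Finset.sum_comm (f := fun k l => P k b * P l a * φ (d' k _))]
    have : ∑ k, ∑ l, P k a * P l b * φ (d' l ((g' *ᵥ (J' *ᵥ Y')) k))
      = ∑ k, ∑ l, P l b * P k a * φ (d' l ((g' *ᵥ (J' *ᵥ Y')) k)) :=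
        Finset.sum_congr rfl fun k _ => Finset.sum_congr rfl fun l _ => by ring
    rw [this]; ring
  ext b
  rw [h.metric_mulVec_of_symm hJ hs hp Y (h.covVec_grad_symm hY), ← nu, hφ]
  have q : ∑ a, (J *ᵥ Y) a * (d a ((g *ᵥ (J *ᵥ Y)) b) - d b ((g *ᵥ (J *ᵥ Y)) a))
      = ∑ k, P k b * φ (∑ l, (J' *ᵥ Y') l * (d' l ((g' *ᵥ (J' *ᵥ Y')) k)
        - d' k ((g' *ᵥ (J' *ᵥ Y')) l))) := by
    simp only [ext, map_sum, map_mul, nZ, Finset.mul_sum]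
    rw [Finset.sum_comm]
    refine Finset.sum_congr rfl fun k _ => ?_
    rw [Finset.sum_comm]
    refine Finset.sum_congr rfl fun l _ => ?_
    have m : ∀ x, (P *ᵥ x) l = ∑ a, P l a * x a := fun _ => rfl
    rw [m, Finset.sum_mul, Finset.mul_sum]
    exact Finset.sum_congr rfl fun a _ => by ring
  rw [q, ← Finset.sum_add_distrib]
  refine Finset.sum_congr rfl fun k _ => ?_
  rw [← mul_add, ← map_add, ← h'.metric_mulVec_of_symm hJ' hs' hp' Y' (h'.covVec_grad_symm hY')]
  rfl

end DiffAlg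

open DiffAlg smoothFn

variable {m : ℕ} {O : Set (Fin m → ℝ)}

/-- A Kähler structure in a coordinate domain. -/
structure IsKahlerOn (g J : (Fin m → ℝ) → Matrix (Fin m) (Fin m) ℝ) (O : Set (Fin m → ℝ)) :
    Prop extends IsMetricOn g O where
  smoothJ : ∀ a b, ContDiffOn ℝ ∞ (fun z => J z a b) O
  J_mul_J : ∀ z ∈ O, J z * J z = -1
  skew : ∀ z ∈ O, ((J z)ᵀ * g z)ᵀ = - ((J z)ᵀ * g z)
  nij : ∀ z ∈ O, ∀ c a b, Coord.nijenhuis J c a b z = 0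
  closed : ∀ z ∈ O, ∀ a b c, Coord.extDeriv₂ (fun z => (J z)ᵀ * g z) a b c z = 0

namespace IsKahlerOn

variable {g J : (Fin m → ℝ) → Matrix (Fin m) (Fin m) ℝ} (h : IsKahlerOn g J O)

/-- The complex structure as a matrix of smooth functions. -/
def cs (h : IsKahlerOn g J O) : Matrix (Fin m) (Fin m) (smoothFn O) := ofMat J h.smoothJ

include h

theorem mono {O' : Set (Fin m → ℝ)} (hO' : IsOpen O') (hs : O' ⊆ O) : IsKahlerOn g J O' :=
  { h.toIsMetricOn.mono hO' hs with
    smoothJ := fun a b => (h.smoothJ a b).mono hs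
    J_mul_J := fun z hz => h.J_mul_J z (hs hz)
    skew := fun z hz => h.skew z (hs hz)
    nij := fun z hz => h.nij z (hs hz)
    closed := fun z hz => h.closed z (hs hz) }

theorem cs_mul_cs : h.cs * h.cs = -1 :=
  matrix_ev_injective fun z => by
    rw [Matrix.map_mul]
    have : ((-1 : Matrix (Fin m) (Fin m) (smoothFn O))).map (ev z) = -1 := by
      ext i j
      by_cases hij : i = j <;> simp [hij]
    rw [this]
    exact h.J_mul_J z z.2

theorem cs_skew : (h.met * h.cs)ᵀ = - (h.met * h.cs) := by
  have e : (h.csᵀ * h.met)ᵀ = - (h.csᵀ * h.met) :=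
    matrix_ev_injective fun z => by
      have e1 : ((h.csᵀ * h.met)ᵀ).map (ev z) = ((J z)ᵀ * g z)ᵀ := by
        rw [Matrix.transpose_map, Matrix.map_mul]; rfl
      have e2 : (- (h.csᵀ * h.met)).map (ev z) = - ((J z)ᵀ * g z) := by
        have : (h.csᵀ * h.met).map (ev z) = (J z)ᵀ * g z := by rw [Matrix.map_mul]; rfl
        rw [← this]
        refine Matrix.ext fun a b => ?_
        exact map_neg (ev z) _
      rw [e1, e2, h.skew z z.2]
  rw [Matrix.transpose_mul, h.isLeviCivita.symm, Matrix.transpose_transpose] at e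
  rw [Matrix.transpose_mul, h.isLeviCivita.symm, e, neg_neg]

theorem parallel (a : Fin m) : covEndo (pd h.isOpen) h.conn a h.cs = 0 := by
  refine h.isLeviCivita.covEndo_eq_zero_of_kahler h.cs_mul_cs h.cs_skew ?_ ?_ a
  · intro c a b
    refine ev_injective fun z => ?_
    have q : ∀ a b c, Coord.pderiv a (fun y => J y b c) z = ev z (pd h.isOpen a (h.cs b c)) :=
      fun a b c => pderiv_eq_ev h.isOpen (fun _ => rfl) a z
    rw [map_zero, ← h.nij z z.2 c a b]
    simp only [DiffAlg.nij, Coord.nijenhuis, map_sum, map_sub, map_mul, q]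
    rfl
  · intro a b c
    refine ev_injective fun z => ?_
    have q : ∀ a b c, Coord.pderiv a (fun y => ((J y)ᵀ * g y) b c) z
        = ev z (pd h.isOpen a ((h.csᵀ * h.met) b c)) :=
      fun a b c => pderiv_eq_ev h.isOpen (fun z => by
        have : (h.csᵀ * h.met).map (ev z) = (J z)ᵀ * g z := by rw [Matrix.map_mul]; rfl
        rw [← this]; rfl) a z
    rw [map_zero, ← h.closed z z.2 a b c]
    simp only [Coord.extDeriv₂, map_add, q]

end IsKahlerOn

end

/-! ### Killing potentials, Hessians and Kähler fields in a chart; effect of a change of chart. -/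

section

open DiffAlg smoothFn Matrix

-- The matrix `C = B + J B J` is twice the part of `B` anticommuting with `J`, and `tr C²` is twice
-- the trace in question. Since `C` is symmetric for `G`, one has `tr C² = tr (G⁻¹ Cᵀ G C)`, the
-- squared norm of `C`.
open scoped MatrixOrder in
theorem trace_add_conj_nonneg {ι : Type*} [Fintype ι] [DecidableEq ι] {G B J : Matrix ι ι ℝ}
    (hG : G.PosDef) (hJ : J * J = -1) (hs : (G * J)ᵀ = - (G * J)) (hB : (G * B)ᵀ = G * B) :
    0 ≤ (B * B + J * B * J * B).trace := by
  have hGt : Gᵀ = G := by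
    have := hG.isHermitian.eq
    rwa [Matrix.conjTranspose_eq_transpose_of_trivial] at this
  have hGu : IsUnit G.det := hG.det_pos.ne'.isUnit
  set C := B + J * B * J with hC
  have hJG : Jᵀ * G = - (G * J) := by rw [← hs, Matrix.transpose_mul, hGt]
  have hBG : Bᵀ * G = G * B := by rw [← hB, Matrix.transpose_mul, hGt]
  have hCG : Cᵀ * G = G * C := by
    rw [hC, Matrix.transpose_add, Matrix.add_mul, hBG, Matrix.transpose_mul, Matrix.transpose_mul,
      Matrix.mul_assoc, Matrix.mul_assoc, hJG, Matrix.mul_neg, Matrix.mul_neg, ← Matrix.mul_assoc Bᵀ,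
      hBG, Matrix.mul_assoc G, ← Matrix.mul_assoc Jᵀ, hJG]
    noncomm_ring
  have e1 : (C * C).trace = 2 * (B * B + J * B * J * B).trace := by
    have e : C * C = B * B + B * (J * B * J) + J * B * J * B + J * (B * (J * J) * B * J) := by
      rw [hC]; noncomm_ring
    have e2 : (J * (B * (J * J) * B * J)).trace = (B * B).trace := by
      rw [Matrix.trace_mul_comm, hJ]
      have : B * -1 * B * J * J = -(B * B * (J * J)) := by noncomm_ring
      rw [this, hJ]; simp
    rw [e]
    simp only [Matrix.trace_add]
    rw [e2, Matrix.trace_mul_comm B (J * B * J)]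
    ring
  have e3 : 0 ≤ (C * C).trace := by
    have hM : (Cᵀ * G * C).PosSemidef := by
      have := hG.posSemidef.conjTranspose_mul_mul_same C
      rwa [Matrix.conjTranspose_eq_transpose_of_trivial] at this
    obtain ⟨S, hS⟩ := CStarAlgebra.nonneg_iff_eq_star_mul_self.mp hG.inv.posSemidef.nonneg
    have e : C * C = G⁻¹ * (Cᵀ * G * C) := by
      rw [hCG, Matrix.mul_assoc, ← Matrix.mul_assoc, Matrix.nonsing_inv_mul _ hGu, Matrix.one_mul]
    rw [e, hS, Matrix.mul_assoc, Matrix.trace_mul_comm]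
    exact (hM.mul_mul_conjTranspose_same S).trace_nonneg
  linarith

variable {m : ℕ} {O : Set (Fin m → ℝ)}

namespace IsMetricOn

variable {g : (Fin m → ℝ) → Matrix (Fin m) (Fin m) ℝ} (h : IsMetricOn g O)
include h

theorem ev_metric (z : O) (u v : Fin m → smoothFn O) :
    ev z (u ⬝ᵥ h.met *ᵥ v) = (fun k => ev z (u k)) ⬝ᵥ g z *ᵥ fun k => ev z (v k) := by
  rw [ev_dotProduct]
  simp only [ev_mulVec]
  rfl

theorem killing_skew {X : Fin m → smoothFn O} (hX : lieMetric (pd h.isOpen) h.met X = 0) :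
    (h.met * covVec (pd h.isOpen) h.conn X)ᵀ = - (h.met * covVec (pd h.isOpen) h.conn X) := by
  rw [h.isLeviCivita.lieMetric_eq] at hX
  rw [Matrix.transpose_mul, h.isLeviCivita.symm]
  exact eq_neg_of_add_eq_zero_left hX

theorem sum_pd_mul (f : smoothFn O) (X : Fin m → smoothFn O) :
    ∑ a, pd h.isOpen a f * X a = h.gr f ⬝ᵥ h.met *ᵥ X := by
  rw [h.isLeviCivita.metric_comm]
  simp only [dotProduct, h.met_gr]
  exact Finset.sum_congr rfl fun _ _ => mul_comm _ _

end IsMetricOn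

namespace IsKahlerOn

variable {g J : (Fin m → ℝ) → Matrix (Fin m) (Fin m) ℝ} (h : IsKahlerOn g J O)

/-- The Hamiltonian vector field `J grad f`. -/
def ham (h : IsKahlerOn g J O) (f : smoothFn O) : Fin m → smoothFn O := h.cs *ᵥ h.gr f

/-- The Hessian of `f` as an endomorphism field. -/
def hess (h : IsKahlerOn g J O) (f : smoothFn O) : Matrix (Fin m) (Fin m) (smoothFn O) :=
  covVec (pd h.isOpen) h.conn (h.gr f)

/-- The field `∇_Y Y + J ∇_{J Y} Y` for `Y = grad f`. -/
def kfield (h : IsKahlerOn g J O) (f : smoothFn O) : Fin m → smoothFn O :=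
  h.hess f *ᵥ h.gr f + (h.cs * h.hess f * h.cs) *ᵥ h.gr f

/-- `f` is the Hamiltonian of a Killing field. -/
def IsKillingPotential (h : IsKahlerOn g J O) (f : smoothFn O) : Prop :=
  lieMetric (pd h.isOpen) h.met (h.ham f) = 0

include h

theorem cs_ham (f : smoothFn O) : h.cs *ᵥ h.ham f = - h.gr f := by
  rw [ham, Matrix.mulVec_mulVec, h.cs_mul_cs, Matrix.neg_mulVec, Matrix.one_mulVec]

theorem covVec_ham (f : smoothFn O) :
    covVec (pd h.isOpen) h.conn (h.ham f) = h.cs * h.hess f := by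
  ext k a : 2
  rw [ham, covVec_mulVec, h.parallel, Matrix.zero_mulVec]
  simp [hess]

theorem hess_symm (f : smoothFn O) : (h.met * h.hess f)ᵀ = h.met * h.hess f :=
  h.isLeviCivita.covVec_grad_symm (h.met_gr f)

theorem cs_mul_covVec_ham (f : smoothFn O) :
    h.cs * covVec (pd h.isOpen) h.conn (h.ham f) = - h.hess f := by
  rw [covVec_ham, ← Matrix.mul_assoc, h.cs_mul_cs, Matrix.neg_mul, Matrix.one_mul]

/-- Lichnerowicz: `d (Δ f) = 2 Ric (grad f, ·)` for a Killing potential. -/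
theorem pd_trace_hess {f : smoothFn O} (hf : h.IsKillingPotential f) (c : Fin m) :
    pd h.isOpen c (h.hess f).trace = - (2 : ℝ) • (ric (pd h.isOpen) h.conn *ᵥ h.gr f) c := by
  have e := h.isLeviCivita.deriv_trace_of_killing h.cs_mul_cs h.cs_skew h.parallel _
    (h.killing_skew hf) c
  rw [cs_mul_covVec_ham, cs_ham, Matrix.trace_neg, map_neg, Matrix.mulVec_neg, Pi.neg_apply,
    smul_neg, neg_inj] at e
  exact e

theorem ricci_invariant (z : O) : (J z)ᵀ * Coord.ricci g z * J z = Coord.ricci g z := by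
  have e := congrArg (fun A => A.map (ev z))
    (h.isLeviCivita.ric_invariant h.cs_mul_cs h.cs_skew h.parallel)
  simp only [Matrix.map_mul] at e
  rw [h.ricci_eq]
  exact e

/-- The function differentiated is `df` applied to the Hamiltonian field of `f'`, that is, their
Poisson bracket up to sign. Its constancy is the local half of the isotropy of torus orbits. -/
theorem pd_pairing {f f' : smoothFn O} (hf' : h.IsKillingPotential f')
    (hc : ∀ k, ∑ a, (h.ham f a * pd h.isOpen a (h.ham f' k)
      - h.ham f' a * pd h.isOpen a (h.ham f k)) = 0) (a : Fin m) :
    pd h.isOpen a (h.gr f ⬝ᵥ h.met *ᵥ h.ham f') = 0 := by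
  have s : ∀ f, (h.met * (h.cs * covVec (pd h.isOpen) h.conn (h.ham f)))ᵀ
      = h.met * (h.cs * covVec (pd h.isOpen) h.conn (h.ham f)) := fun f => by
    rw [cs_mul_covVec_ham, Matrix.mul_neg, Matrix.transpose_neg, hess_symm]
  have e := h.isLeviCivita.deriv_kahler_pairing h.cs_skew h.parallel (h.killing_skew hf') (s f)
    (s f') hc a
  rw [cs_ham, neg_dotProduct, map_neg, neg_eq_zero] at e
  exact e

theorem trace_covVec_kfield (f : smoothFn O) :
    (covVec (pd h.isOpen) h.conn (h.kfield f)).trace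
      = (∑ a, h.gr f a * pd h.isOpen a (h.hess f).trace)
        + (2 : ℝ) • (h.gr f ⬝ᵥ ric (pd h.isOpen) h.conn *ᵥ h.gr f)
        + (h.hess f * h.hess f + h.cs * h.hess f * h.cs * h.hess f).trace :=
  h.isLeviCivita.trace_covVec_of_symm h.cs_mul_cs h.cs_skew h.parallel _ (h.hess_symm f)

theorem ev_trace_nonneg (f : smoothFn O) (z : O) :
    0 ≤ ev z (h.hess f * h.hess f + h.cs * h.hess f * h.cs * h.hess f).trace := by
  have e : ev z (h.hess f * h.hess f + h.cs * h.hess f * h.cs * h.hess f).trace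
      = ((h.hess f).map (ev z) * (h.hess f).map (ev z)
        + J z * (h.hess f).map (ev z) * J z * (h.hess f).map (ev z)).trace := by
    have e1 : ∀ A : Matrix (Fin m) (Fin m) (smoothFn O), ev z A.trace = (A.map (ev z)).trace :=
      fun A => by simp [Matrix.trace, map_sum]
    have e2 : ∀ A B : Matrix (Fin m) (Fin m) (smoothFn O), (A + B).map (ev z)
        = A.map (ev z) + B.map (ev z) := fun A B => by
      refine Matrix.ext fun a b => ?_
      exact map_add (ev z) _ _
    rw [e1, e2]
    simp only [Matrix.map_mul]
    rfl
  rw [e]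
  have hg : h.met.map (ev z) = g z := rfl
  have hJ : h.cs.map (ev z) = J z := rfl
  refine trace_add_conj_nonneg (h.posDef z z.2) (h.J_mul_J z z.2) ?_ ?_
  · have e := congrArg (fun A => A.map (ev z)) h.cs_skew
    have e1 : (h.met * h.cs).map (ev z) = g z * J z := by rw [Matrix.map_mul, hg, hJ]
    have e2 : (- (h.met * h.cs)).map (ev z) = - (g z * J z) := by
      rw [← e1]
      refine Matrix.ext fun a b => ?_
      exact map_neg (ev z) _
    rw [← e2, ← e, ← e1]
    rfl
  · have e := congrArg (fun A => A.map (ev z)) (h.hess_symm f)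
    have e1 : (h.met * h.hess f).map (ev z) = g z * (h.hess f).map (ev z) := by
      rw [Matrix.map_mul, hg]
    rw [← e1]
    exact e

end IsKahlerOn

/-! ### Changes of coordinates -/

section CoordChange

variable (e : OpenPartialHomeomorph (Fin m → ℝ) (Fin m → ℝ)) (he : ContDiffOn ℝ ∞ e e.source)

/-- The pull-back of smooth functions. -/
def pullback (he : ContDiffOn ℝ ∞ e e.source) : smoothFn e.target →+* smoothFn e.source where
  toFun f := ⟨fun z => f.1 ⟨e z, e.map_source z.2⟩, fun z => rep f (e z),
    (contDiffOn_rep f).comp he fun _ hz => e.map_source hz,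
    fun z => rep_apply f ⟨e z, e.map_source z.2⟩⟩
  map_one' := rfl
  map_mul' _ _ := rfl
  map_zero' := rfl
  map_add' _ _ := rfl

variable {e}

theorem ev_pullback (f : smoothFn e.target) (z : e.source) :
    ev z (pullback e he f) = ev ⟨e z, e.map_source z.2⟩ f := rfl

include he in
theorem contDiffOn_comp (k : Fin m) : ContDiffOn ℝ ∞ (fun z => e z k) e.source :=
  (contDiffOn_pi.1 he) k

include he in
theorem contDiffOn_jacobian (a b : Fin m) :
    ContDiffOn ℝ ∞ (fun z => Coord.jacobian e z a b) e.source :=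
  Coord.contDiffOn_pderiv e.open_source (contDiffOn_comp he a) b

/-- The Jacobian as a matrix of smooth functions. -/
def jac (he : ContDiffOn ℝ ∞ e e.source) : Matrix (Fin m) (Fin m) (smoothFn e.source) :=
  ofMat (Coord.jacobian e) (contDiffOn_jacobian he)

theorem jac_eq (k b : Fin m) : jac he k b = pd e.open_source b (of _ (contDiffOn_comp he k)) :=
  ev_injective fun z => pderiv_eq_ev e.open_source (fun _ => rfl) b z

theorem pd_jac (a b k : Fin m) :
    pd e.open_source a (jac he k b) = pd e.open_source b (jac he k a) := by
  rw [jac_eq, jac_eq, pd_comm]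

include he in
theorem jacobian_mulVec {z : Fin m → ℝ} (hz : z ∈ e.source) (v : Fin m → ℝ) :
    Coord.jacobian e z *ᵥ v = fderiv ℝ e z v := by
  have hd : DifferentiableAt ℝ e z :=
    (he.differentiableOn (by simp) z hz).differentiableAt (e.open_source.mem_nhds hz)
  ext k
  have : fderiv ℝ (fun y => e y k) z = (ContinuousLinearMap.proj k).comp (fderiv ℝ e z) :=
    ((ContinuousLinearMap.proj (R := ℝ) (φ := fun _ : Fin m => ℝ) k).hasFDerivAt.comp z
      hd.hasFDerivAt).fderiv
  have e2 : fderiv ℝ e z v k = fderiv ℝ (fun y => e y k) z v := by rw [this]; rfl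
  rw [e2, fderiv_apply_eq_sum]
  simp only [Matrix.mulVec, dotProduct, Coord.jacobian, Matrix.of_apply]
  exact Finset.sum_congr rfl fun l _ => mul_comm _ _

theorem pd_pullback (a : Fin m) (f : smoothFn e.target) :
    pd e.open_source a (pullback e he f)
      = ∑ k, jac he k a * pullback e he (pd e.open_target k f) := by
  refine ev_injective fun z => ?_
  have hd : DifferentiableAt ℝ e z :=
    (he.differentiableOn (by simp) z z.2).differentiableAt (e.open_source.mem_nhds z.2)
  have e1 : ev z (pd e.open_source a (pullback e he f))
      = Coord.pderiv a (fun y => rep f (e y)) z :=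
    (pderiv_eq_ev e.open_source (fun z => rep_apply f ⟨e z, e.map_source z.2⟩) a z).symm
  have hf : DifferentiableAt ℝ (rep f) (e z) :=
    differentiableAt_rep e.open_target f ⟨e z, e.map_source z.2⟩
  have e2 : fderiv ℝ (fun y => rep f (e y)) z = (fderiv ℝ (rep f) (e z)).comp (fderiv ℝ e z) :=
    (hf.hasFDerivAt.comp z.1 hd.hasFDerivAt).fderiv
  rw [e1, Coord.pderiv, e2, ContinuousLinearMap.comp_apply, fderiv_apply_eq_sum, map_sum]
  refine Finset.sum_congr rfl fun k _ => ?_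
  rw [map_mul, ev_pullback, ← jacobian_mulVec he z.2, Matrix.mulVec_single_one]
  congr 1

variable {g g' : (Fin m → ℝ) → Matrix (Fin m) (Fin m) ℝ} (h : IsMetricOn g e.source)
  (h' : IsMetricOn g' e.target)
  (hg : ∀ z ∈ e.source, (Coord.jacobian e z)ᵀ * g' (e z) * Coord.jacobian e z = g z)

include hg

theorem jac_met : (jac he)ᵀ * h'.met.map (pullback e he) * jac he = h.met := by
  refine matrix_ev_injective fun z => ?_
  rw [Matrix.map_mul, Matrix.map_mul]
  exact hg z z.2

include h in
theorem isUnit_det_jacobian {z : Fin m → ℝ} (hz : z ∈ e.source) :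
    IsUnit (Coord.jacobian e z).det := by
  have := h.isUnit_det ⟨z, hz⟩
  simp only at this
  rw [← hg z hz, Matrix.det_mul] at this
  exact isUnit_of_mul_isUnit_right this

include h in
theorem isUnit_det_jac : IsUnit (jac he).det :=
  isUnit_det_of_ev fun z : e.source => isUnit_det_jacobian h hg z.2

theorem ev_gr_natural (f : smoothFn e.target) (z : e.source) (k : Fin m) :
    ev ⟨e z, e.map_source z.2⟩ (h'.gr f k)
      = (Coord.jacobian e z *ᵥ fun l => ev z (h.gr (pullback e he f) l)) k := by
  have := grad_natural (pullback e he) (jac he) h.isUnit_det_met (isUnit_det_jac he h hg)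
    (pd_pullback he) (jac_met he h h' hg) (h.met_gr _) (h'.met_gr f) k
  rw [← ev_pullback he, this, ev_mulVec]
  rfl

omit h h' in
theorem ev_kfield_natural {J J' : (Fin m → ℝ) → Matrix (Fin m) (Fin m) ℝ}
    (h : IsKahlerOn g J e.source) (h' : IsKahlerOn g' J' e.target)
    (hJ : ∀ z ∈ e.source, J' (e z) * Coord.jacobian e z = Coord.jacobian e z * J z)
    (f : smoothFn e.target) (z : e.source) (k : Fin m) :
    ev ⟨e z, e.map_source z.2⟩ (h'.kfield f k)
      = (Coord.jacobian e z *ᵥ fun l => ev z (h.kfield (pullback e he f) l)) k := by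
  have hJP : h'.cs.map (pullback e he) * jac he = jac he * h.cs := by
    refine matrix_ev_injective fun z => ?_
    rw [Matrix.map_mul, Matrix.map_mul]
    exact hJ z z.2
  have := kahlerField_natural h.isLeviCivita h'.isLeviCivita (pullback e he) (jac he)
    (isUnit_det_jac he h.toIsMetricOn hg) (pd_pullback he) (pd_jac he)
    (jac_met he h.toIsMetricOn h'.toIsMetricOn hg) h.cs_mul_cs h.cs_skew h.parallel h'.cs_mul_cs
    h'.cs_skew h'.parallel hJP (h.met_gr _) (h'.met_gr f) k
  rw [← ev_pullback he]
  refine (congrArg (ev z) this).trans ?_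
  rw [ev_mulVec]
  rfl

end CoordChange

end

/-! ### The local group of an orbifold chart and its fixed points. -/

section

open Set MeasureTheory

namespace OrbifoldChart

variable {m : ℕ} {M : Type*} [TopologicalSpace M] (c : OrbifoldChart m M)

/-- An element of the local group, extended by the identity to the whole space. -/
def act (γ : Equiv.Perm c.dom) (z : Fin m → ℝ) : Fin m → ℝ :=
  open Classical in if h : z ∈ c.dom then γ ⟨z, h⟩ else z

variable {c}

theorem act_coe (γ : Equiv.Perm c.dom) (z : c.dom) : c.act γ z = γ z := by
  simp [act]

theorem act_of_mem (γ : Equiv.Perm c.dom) {z : Fin m → ℝ} (hz : z ∈ c.dom) :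
    c.act γ z = γ ⟨z, hz⟩ := act_coe γ ⟨z, hz⟩

theorem act_mem (γ : Equiv.Perm c.dom) {z : Fin m → ℝ} (hz : z ∈ c.dom) : c.act γ z ∈ c.dom := by
  rw [act_of_mem γ hz]; exact (γ _).2

theorem act_mul (γ δ : Equiv.Perm c.dom) {z : Fin m → ℝ} (hz : z ∈ c.dom) :
    c.act (γ * δ) z = c.act γ (c.act δ z) := by
  rw [act_of_mem _ hz, act_of_mem _ (act_mem δ hz)]
  have : (⟨c.act δ z, act_mem δ hz⟩ : c.dom) = δ ⟨z, hz⟩ := Subtype.ext (act_of_mem δ hz)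
  rw [this]
  rfl

theorem act_one {z : Fin m → ℝ} (hz : z ∈ c.dom) : c.act 1 z = z := by
  rw [act_of_mem _ hz]; rfl

theorem act_inv_act (γ : Equiv.Perm c.dom) {z : Fin m → ℝ} (hz : z ∈ c.dom) :
    c.act γ⁻¹ (c.act γ z) = z := by
  rw [← act_mul _ _ hz, inv_mul_cancel, act_one hz]

theorem act_act_inv (γ : Equiv.Perm c.dom) {z : Fin m → ℝ} (hz : z ∈ c.dom) :
    c.act γ (c.act γ⁻¹ z) = z := by
  rw [← act_mul _ _ hz, mul_inv_cancel, act_one hz]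

theorem contDiffOn_act {γ : Equiv.Perm c.dom} (hγ : γ ∈ c.group) :
    ContDiffOn ℝ ∞ (c.act γ) c.dom := by
  obtain ⟨f, hf, h⟩ := c.smooth_group γ hγ
  exact hf.congr fun z hz => by rw [act_of_mem γ hz, ← h ⟨z, hz⟩]

theorem proj_act {γ : Equiv.Perm c.dom} (hγ : γ ∈ c.group) {z : Fin m → ℝ} (hz : z ∈ c.dom) :
    c.proj (c.act γ z) = c.proj z := by
  have := (c.proj_eq_iff ⟨z, hz⟩ (γ ⟨z, hz⟩)).2 ⟨γ, hγ, rfl⟩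
  rw [act_of_mem γ hz]
  exact this.symm

theorem exists_act_eq {z w : Fin m → ℝ} (hz : z ∈ c.dom) (hw : w ∈ c.dom)
    (h : c.proj z = c.proj w) : ∃ γ ∈ c.group, c.act γ z = w := by
  obtain ⟨γ, hγ, e⟩ := (c.proj_eq_iff ⟨z, hz⟩ ⟨w, hw⟩).1 h
  exact ⟨γ, hγ, by rw [act_of_mem γ hz, e]⟩

/-- An element of the local group as a diffeomorphism of the domain. -/
def actHomeo {γ : Equiv.Perm c.dom} (hγ : γ ∈ c.group) :
    OpenPartialHomeomorph (Fin m → ℝ) (Fin m → ℝ) where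
  toFun := c.act γ
  invFun := c.act γ⁻¹
  source := c.dom
  target := c.dom
  map_source' _ := act_mem γ
  map_target' _ := act_mem γ⁻¹
  left_inv' _ := act_inv_act γ
  right_inv' _ := act_act_inv γ
  open_source := c.isOpen_dom
  open_target := c.isOpen_dom
  continuousOn_toFun := (contDiffOn_act hγ).continuousOn
  continuousOn_invFun := (contDiffOn_act (inv_mem hγ)).continuousOn

theorem isLocalLift_actHomeo {γ : Equiv.Perm c.dom} (hγ : γ ∈ c.group) :
    IsLocalLift id c c (actHomeo hγ) where
  source_subset := subset_rfl
  target_subset := subset_rfl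
  contDiffOn := contDiffOn_act hγ
  contDiffOn_symm := contDiffOn_act (inv_mem hγ)
  proj_apply _ hz := proj_act hγ hz

theorem differentiableAt_act {γ : Equiv.Perm c.dom} (hγ : γ ∈ c.group) {z : Fin m → ℝ}
    (hz : z ∈ c.dom) : DifferentiableAt ℝ (c.act γ) z :=
  ((contDiffOn_act hγ).differentiableOn (by simp) z hz).differentiableAt
    (c.isOpen_dom.mem_nhds hz)

/-- A local group element which is tangent to the identity at a fixed point is the identity
nearby. -/
theorem eventually_act_eq_self {γ : Equiv.Perm c.dom} (hγ : γ ∈ c.group) {z : Fin m → ℝ}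
    (hz : z ∈ c.dom) (hfix : c.act γ z = z)
    (hd : fderiv ℝ (c.act γ) z = ContinuousLinearMap.id ℝ (Fin m → ℝ)) :
    ∀ᶠ y in 𝓝 z, c.act γ y = y := by
  have : Finite c.group := c.finite_group
  obtain ⟨N, hN, hγN⟩ : ∃ N : ℕ, 0 < N ∧ γ ^ N = 1 := by
    have := isOfFinOrder_of_finite (⟨γ, hγ⟩ : c.group)
    obtain ⟨N, hN, h⟩ := isOfFinOrder_iff_pow_eq_one.1 this
    exact ⟨N, hN, congrArg Subtype.val h⟩
  have hst : ∀ {δ : Equiv.Perm c.dom}, δ ∈ c.group →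
      HasStrictFDerivAt (c.act δ) (fderiv ℝ (c.act δ) z) z := fun {δ} hδ =>
    ((contDiffOn_act hδ).contDiffAt (c.isOpen_dom.mem_nhds hz)).hasStrictFDerivAt (by simp)
  have hpow : ∀ k : ℕ, c.act (γ ^ k) z = z ∧
      HasStrictFDerivAt (c.act (γ ^ k)) (ContinuousLinearMap.id ℝ (Fin m → ℝ)) z := by
    intro k
    induction k with
    | zero =>
      refine ⟨by rw [pow_zero, act_one hz], ?_⟩
      refine (hasStrictFDerivAt_id z).congr_of_eventuallyEq ?_
      filter_upwards [c.isOpen_dom.mem_nhds hz] with y hy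
      rw [pow_zero, act_one hy]; rfl
    | succ k ih =>
      refine ⟨by rw [pow_succ, act_mul _ _ hz, hfix, ih.1], ?_⟩
      have h1 : HasStrictFDerivAt (c.act γ) (ContinuousLinearMap.id ℝ (Fin m → ℝ)) z := by
        rw [← hd]; exact hst hγ
      have h2 : HasStrictFDerivAt (c.act (γ ^ k)) (ContinuousLinearMap.id ℝ (Fin m → ℝ))
          (c.act γ z) := by rw [hfix]; exact ih.2
      refine (h2.comp z h1).congr_of_eventuallyEq ?_
      filter_upwards [c.isOpen_dom.mem_nhds hz] with y hy
      rw [pow_succ, act_mul _ _ hy]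
  -- The average over the powers of `γ` is unchanged by composition with `γ`, and its derivative at
  -- `z` is the identity. It is therefore injective near `z`, and this forces `γ y = y` there.
  set Φ : (Fin m → ℝ) → (Fin m → ℝ) := fun y => (N : ℝ)⁻¹ • ∑ k ∈ Finset.range N, c.act (γ ^ k) y
    with hΦ
  have hΦd : HasStrictFDerivAt Φ
      ((ContinuousLinearEquiv.refl ℝ (Fin m → ℝ) : (Fin m → ℝ) →L[ℝ] (Fin m → ℝ))) z := by
    have h1 := (HasStrictFDerivAt.fun_sum (u := Finset.range N)
      fun k _ => (hpow k).2).const_smul ((N : ℝ)⁻¹)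
    have e : ((N : ℝ)⁻¹ • ∑ _k ∈ Finset.range N, ContinuousLinearMap.id ℝ (Fin m → ℝ))
        = ContinuousLinearMap.id ℝ (Fin m → ℝ) := by
      rw [Finset.sum_const, Finset.card_range, ← Nat.cast_smul_eq_nsmul ℝ, smul_smul,
        inv_mul_cancel₀ (by positivity), one_smul]
    rw [e] at h1
    exact h1
  have hinv : ∀ y ∈ c.dom, Φ (c.act γ y) = Φ y := fun y hy => by
    simp only [hΦ]
    congr 1
    have : ∀ k, c.act (γ ^ k) (c.act γ y) = c.act (γ ^ (k + 1)) y := fun k => by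
      rw [pow_succ, act_mul _ _ hy]
    simp only [this]
    have s := Finset.sum_range_succ' (fun k => c.act (γ ^ k) y) N
    rw [Finset.sum_range_succ, hγN, pow_zero] at s
    exact (add_right_cancel s).symm
  have hsrc : (hΦd.toOpenPartialHomeomorph Φ).source ∈ 𝓝 z :=
    (hΦd.toOpenPartialHomeomorph Φ).open_source.mem_nhds
      hΦd.mem_toOpenPartialHomeomorph_source
  have hcont : Filter.Tendsto (c.act γ) (𝓝 z) (𝓝 z) := by
    have := (differentiableAt_act hγ hz).continuousAt.tendsto
    rwa [hfix] at this
  filter_upwards [hsrc, hcont hsrc, c.isOpen_dom.mem_nhds hz] with y h1 h2 h3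
  exact (hΦd.toOpenPartialHomeomorph Φ).injOn h2 h1 (hinv y h3)

/-- At almost every point of the fixed set the derivative of `γ` is the identity. A single such
point makes `γ` trivial on the whole connected domain, so a nontrivial `γ` has none. -/
theorem volume_fixed_eq_zero {γ : Equiv.Perm c.dom} (hγ : γ ∈ c.group) (h1 : γ ≠ 1) :
    volume {z ∈ c.dom | c.act γ z = z} = 0 := by
  set F := {z ∈ c.dom | c.act γ z = z} with hF
  have hcl : ∃ C, IsClosed C ∧ F = c.dom ∩ C := by
    have h : IsClosed {z : c.dom | c.act γ z = z} :=
      isClosed_eq ((contDiffOn_act hγ).continuousOn.domRestrict) continuous_subtype_val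
    obtain ⟨C, hC, e⟩ := isClosed_induced_iff.1 h
    refine ⟨C, hC, ?_⟩
    ext z
    constructor
    · rintro ⟨hz, hfz⟩
      have : (⟨z, hz⟩ : c.dom) ∈ Subtype.val ⁻¹' C := by rw [e]; exact hfz
      exact ⟨hz, this⟩
    · rintro ⟨hz, hzC⟩
      have : (⟨z, hz⟩ : c.dom) ∈ Subtype.val ⁻¹' C := hzC
      rw [e] at this
      exact ⟨hz, this⟩
  obtain ⟨C, hC, hFC⟩ := hcl
  have hFm : MeasurableSet F := by
    rw [hFC]; exact c.isOpen_dom.measurableSet.inter hC.measurableSet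
  -- On its fixed set the map is the identity with error constant 0, so the almost-everywhere bound
  -- on the derivative becomes an equality.
  have hap : ApproximatesLinearOn (c.act γ) (ContinuousLinearMap.id ℝ (Fin m → ℝ)) F 0 := by
    intro x hx y hy
    rw [hx.2, hy.2]
    simp
  have hae := hap.norm_fderiv_sub_le volume hFm (fun z => fderiv ℝ (c.act γ) z)
    fun z hz => (differentiableAt_act hγ hz.1).hasFDerivAt.hasFDerivWithinAt
  have hno : ∀ z ∈ F, fderiv ℝ (c.act γ) z ≠ ContinuousLinearMap.id ℝ (Fin m → ℝ) := by
    intro z0 hz0 hd0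
    have : PreconnectedSpace c.dom :=
      Subtype.preconnectedSpace c.isConnected_dom.isPreconnected
    -- Openness is `eventually_act_eq_self`, closedness is continuity of the map and of its
    -- derivative.
    have hcl : IsClopen {z : c.dom | c.act γ z = z ∧
        fderiv ℝ (c.act γ) z = ContinuousLinearMap.id ℝ (Fin m → ℝ)} := by
      constructor
      · refine (isClosed_eq ((contDiffOn_act hγ).continuousOn.domRestrict)
          continuous_subtype_val).inter (isClosed_eq ?_ continuous_const)
        exact ((contDiffOn_act hγ).continuousOn_fderiv_of_isOpen c.isOpen_dom (by simp)).domRestrict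
      · rw [isOpen_iff_mem_nhds]
        rintro ⟨z, hz⟩ ⟨hf, hd⟩
        have h := (eventually_act_eq_self hγ hz hf hd).eventually_nhds
        have h' := (continuous_subtype_val.tendsto (⟨z, hz⟩ : c.dom)).eventually h
        filter_upwards [h'] with y hy
        refine ⟨hy.self_of_nhds, ?_⟩
        have : c.act γ =ᶠ[𝓝 (y : Fin m → ℝ)] id := hy
        rw [this.fderiv_eq, fderiv_id]
    rcases isClopen_iff.1 hcl with h | h
    · have : (⟨z0, hz0.1⟩ : c.dom) ∈ (∅ : Set c.dom) := by rw [← h]; exact ⟨hz0.2, hd0⟩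
      exact this
    · apply h1
      ext z : 2
      have : z ∈ (univ : Set c.dom) := mem_univ z
      rw [← h] at this
      have := this.1
      rw [act_coe] at this
      exact this
  rw [ae_restrict_iff' hFm] at hae
  refine measure_mono_null (fun z hz => ?_) hae
  intro hcon
  have := hcon hz
  simp only [nonpos_iff_eq_zero, nnnorm_eq_zero, sub_eq_zero] at this
  exact hno z hz this

end OrbifoldChart

end

/-! ### Smooth partitions of unity on a compact orbifold. -/

section

open Set

namespace OrbifoldChart

variable {m : ℕ} {M : Type*} [TopologicalSpace M] {c : OrbifoldChart m M}

theorem isOpen_range : IsOpen (c.proj '' c.dom) := c.isOpen_image_proj _ subset_rfl c.isOpen_dom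

/-- The sum of `φ` over the orbits of the local group, as a function on the quotient. -/
def orbitSum (c : OrbifoldChart m M) (φ : (Fin m → ℝ) → ℝ) (q : M) : ℝ :=
  open Classical in if h : ∃ w ∈ c.dom, c.proj w = q then
    ∑ᶠ γ : c.group, φ (c.act γ h.choose) else 0

theorem orbitSum_proj (φ : (Fin m → ℝ) → ℝ) {w : Fin m → ℝ} (hw : w ∈ c.dom) :
    c.orbitSum φ (c.proj w) = ∑ᶠ γ : c.group, φ (c.act γ w) := by
  have h : ∃ w' ∈ c.dom, c.proj w' = c.proj w := ⟨w, hw, rfl⟩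
  rw [orbitSum, dif_pos h]
  obtain ⟨h1, h2⟩ := h.choose_spec
  obtain ⟨δ, hδ, e⟩ := exists_act_eq h1 hw h2
  -- The chosen preimage and `w` differ by some `δ`; right translation by `δ` reindexes the sum.
  rw [← finsum_comp_equiv (Equiv.mulRight (⟨δ, hδ⟩ : c.group)) (f := fun γ => φ (c.act γ h.choose))]
  refine finsum_congr fun γ => ?_
  have := act_mul (γ : Equiv.Perm c.dom) δ h1
  rw [e] at this
  rw [← this]
  rfl

theorem orbitSum_nonneg {φ : (Fin m → ℝ) → ℝ} (hφ : ∀ z, 0 ≤ φ z) (q : M) :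
    0 ≤ c.orbitSum φ q := by
  rw [orbitSum]
  split_ifs with h
  · exact finsum_nonneg fun γ => hφ _
  · exact le_rfl

theorem orbitSum_pos {φ : (Fin m → ℝ) → ℝ} (hφ : ∀ z, 0 ≤ φ z) {z : Fin m → ℝ} (hz : z ∈ c.dom)
    (h : 0 < φ z) : 0 < c.orbitSum φ (c.proj z) := by
  have : Finite c.group := c.finite_group
  rw [orbitSum_proj φ hz]
  refine finsum_pos (fun γ => hφ _) ⟨1, ?_⟩ (Set.toFinite _)
  rwa [Subgroup.coe_one, act_one hz]

theorem mem_image_of_orbitSum_ne_zero {φ : (Fin m → ℝ) → ℝ} {K : Set (Fin m → ℝ)}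
    (hK : ∀ z, φ z ≠ 0 → z ∈ K) {q : M} (h : c.orbitSum φ q ≠ 0) : q ∈ c.proj '' K := by
  by_cases hq : ∃ w ∈ c.dom, c.proj w = q
  · obtain ⟨w, hw, rfl⟩ := hq
    rw [orbitSum_proj φ hw] at h
    obtain ⟨γ, hγ⟩ : ∃ γ : c.group, φ (c.act γ w) ≠ 0 := by
      by_contra! hcon
      exact h (by simp [hcon])
    exact ⟨_, hK _ hγ, proj_act γ.2 hw⟩
  · exact absurd (by rw [orbitSum, dif_neg hq]) h

end OrbifoldChart

namespace OrbifoldAtlas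

open OrbifoldChart

variable {ι : Type*} {m : ℕ} {M : Type*} [TopologicalSpace M] (A : OrbifoldAtlas ι m M)

/-- Over the image of chart `i` a local lift exhibits the function as a finite sum of smooth ones.
Elsewhere it vanishes nearby, since the image of the compact `K` is closed in the Hausdorff space
`M`. -/
theorem isSmooth_orbitSum [T2Space M] (i : ι) {φ : (Fin m → ℝ) → ℝ} (hφ : ContDiff ℝ ∞ φ)
    {K : Set (Fin m → ℝ)} (hKc : IsCompact K) (hK : K ⊆ (A.chart i).dom)
    (hφK : ∀ z, φ z ≠ 0 → z ∈ K) : A.IsSmooth ((A.chart i).orbitSum φ) := by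
  intro j y hy
  refine ContDiffAt.contDiffWithinAt ?_
  by_cases hq : ∃ w ∈ (A.chart i).dom, (A.chart i).proj w = (A.chart j).proj y
  · obtain ⟨w, hw, e⟩ := hq
    obtain ⟨h, hl, hyh, hhy⟩ := A.compatible j i y hy w hw e.symm
    have : Finite (A.chart i).group := (A.chart i).finite_group
    have : Fintype (A.chart i).group := Fintype.ofFinite _
    have hs := h.open_source.mem_nhds hyh
    have h1 : ContDiffAt ℝ ∞ (fun y' => ∑ γ : (A.chart i).group, φ ((A.chart i).act γ (h y'))) y := by
      refine ContDiffAt.sum fun γ _ => ?_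
      have h2 : ContDiffAt ℝ ∞ ((A.chart i).act γ) (h y) :=
        (contDiffOn_act γ.2).contDiffAt ((A.chart i).isOpen_dom.mem_nhds
          (hl.target_subset (h.map_source hyh)))
      exact hφ.contDiffAt.comp y (h2.comp y (hl.contDiffOn.contDiffAt hs))
    refine h1.congr_of_eventuallyEq ?_
    filter_upwards [hs] with y' hy'
    have := hl.proj_apply y' hy'
    simp only [id] at this
    rw [← this, orbitSum_proj φ (hl.target_subset (h.map_source hy')), finsum_eq_sum_of_fintype]
  · have hcl : IsClosed ((A.chart i).proj '' K) :=
      (hKc.image_of_continuousOn ((A.chart i).continuousOn_proj.mono hK)).isClosed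
    have hn : (A.chart j).proj y ∉ (A.chart i).proj '' K := by
      rintro ⟨w, hw, e⟩
      exact hq ⟨w, hK hw, e⟩
    have hct := (A.chart j).continuousOn_proj.continuousAt ((A.chart j).isOpen_dom.mem_nhds hy)
    refine (contDiffAt_const (c := (0 : ℝ))).congr_of_eventuallyEq ?_
    filter_upwards [hct.eventually (hcl.isOpen_compl.mem_nhds hn)] with y' hy'
    by_contra hne
    exact hy' (mem_image_of_orbitSum_ne_zero hφK hne)

theorem exists_bump [T2Space M] (p : M) : ∃ (i : ι) (K : Set (Fin m → ℝ)) (χ : M → ℝ),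
    IsCompact K ∧ K ⊆ (A.chart i).dom ∧ A.IsSmooth χ ∧ (∀ q, 0 ≤ χ q) ∧
    (∀ q, χ q ≠ 0 → q ∈ (A.chart i).proj '' K) ∧ ∀ᶠ q in 𝓝 p, 0 < χ q := by
  obtain ⟨i, z, hz, rfl⟩ := A.cover p
  obtain ⟨r, hr, hball⟩ := Metric.nhds_basis_closedBall.mem_iff.1
    ((A.chart i).isOpen_dom.mem_nhds hz)
  let φ : ContDiffBump z := ⟨r / 2, r, by positivity, by linarith⟩
  have hφK : ∀ w, φ w ≠ 0 → w ∈ Metric.closedBall z r := fun w hw =>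
    Metric.ball_subset_closedBall (by rw [← φ.support_eq]; exact hw)
  refine ⟨i, Metric.closedBall z r, (A.chart i).orbitSum φ, isCompact_closedBall _ _, hball,
    A.isSmooth_orbitSum i φ.contDiff (isCompact_closedBall _ _) hball hφK,
    orbitSum_nonneg fun _ => φ.nonneg, fun q => mem_image_of_orbitSum_ne_zero hφK, ?_⟩
  have hsub : Metric.ball z r ⊆ (A.chart i).dom := Metric.ball_subset_closedBall.trans hball
  filter_upwards [((A.chart i).isOpen_image_proj _ hsub Metric.isOpen_ball).mem_nhds
    ⟨z, Metric.mem_ball_self hr, rfl⟩]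
  rintro _ ⟨w, hw, rfl⟩
  refine orbitSum_pos (fun _ => φ.nonneg) (hsub hw) (lt_of_le_of_ne φ.nonneg (Ne.symm ?_))
  have : w ∈ Function.support φ := by rw [φ.support_eq]; exact hw
  exact this

theorem exists_partition [T2Space M] [CompactSpace M] :
    ∃ (s : Finset M) (i : M → ι) (K : M → Set (Fin m → ℝ)) (ρ : M → M → ℝ),
      (∀ p, IsCompact (K p)) ∧ (∀ p, K p ⊆ (A.chart (i p)).dom) ∧ (∀ p, A.IsSmooth (ρ p)) ∧
      (∀ p q, 0 ≤ ρ p q) ∧ (∀ p q, ρ p q ≠ 0 → q ∈ (A.chart (i p)).proj '' K p) ∧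
      ∀ q, ∑ p ∈ s, ρ p q = 1 := by
  choose i K χ hK hKd hχ h0 hsupp hpos using A.exists_bump
  obtain ⟨s, -, hs⟩ := isCompact_univ.elim_nhds_subcover (fun p => {q | 0 < χ p q})
    fun p _ => hpos p
  have hsum : ∀ q, 0 < ∑ p ∈ s, χ p q := fun q => by
    obtain ⟨p, hp, hq⟩ := mem_iUnion₂.1 (hs (mem_univ q))
    exact Finset.sum_pos' (fun p _ => h0 p q) ⟨p, hp, hq⟩
  refine ⟨s, i, K, fun p q => χ p q / ∑ p' ∈ s, χ p' q, hK, hKd, fun p j => ?_,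
    fun p q => div_nonneg (h0 p q) (hsum q).le, fun p q h => hsupp p q fun h' => h (by simp [h']),
    fun q => ?_⟩
  · exact (hχ p j).div (ContDiffOn.sum fun p' _ => hχ p' j) fun z _ => (hsum _).ne'
  · rw [← Finset.sum_div, div_self (hsum q).ne']

end OrbifoldAtlas

end

/-! ### Jacobi's formula, the Riemannian density, and the divergence theorem in a chart. -/

section

open Set MeasureTheory

namespace DiffAlg

open Matrix Finset

variable {R : Type*} [CommRing R] [Algebra ℝ R] {ι : Type*} [Fintype ι] [DecidableEq ι]

theorem deriv_prod {κ : Type*} [DecidableEq κ] (D : Derivation ℝ R R) (s : Finset κ) (f : κ → R) :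
    D (∏ i ∈ s, f i) = ∑ i ∈ s, (∏ j ∈ s.erase i, f j) * D (f i) := by
  induction s using Finset.induction_on with
  | empty => simp
  | insert a s ha ih =>
    rw [Finset.prod_insert ha, Derivation.leibniz, Finset.sum_insert ha, Finset.erase_insert ha,
      smul_eq_mul, smul_eq_mul, ih, Finset.mul_sum, add_comm]
    congr 1
    refine Finset.sum_congr rfl fun i hi => ?_
    rw [Finset.erase_insert_of_ne fun h : a = i => ha (h ▸ hi), Finset.prod_insert (by simp [ha]),
      mul_assoc]

/-- Jacobi's formula. -/
theorem deriv_det (D : Derivation ℝ R R) (A : Matrix ι ι R) :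
    D A.det = (A.adjugate * A.map D).trace := by
  have h : ∀ i, (A.updateCol i fun k => D (A k i)).det = (A.adjugate * A.map D) i i := fun i => by
    rw [← cramer_apply, cramer_eq_adjugate_mulVec]
    rfl
  simp only [Matrix.trace, Matrix.diag_apply, ← h, det_apply', map_sum]
  rw [Finset.sum_comm]
  refine Finset.sum_congr rfl fun σ _ => ?_
  rw [Derivation.leibniz, Derivation.map_intCast, smul_zero, add_zero, deriv_prod, smul_eq_mul,
    Finset.mul_sum]
  refine Finset.sum_congr rfl fun i _ => ?_
  rw [← Finset.mul_prod_erase _ _ (Finset.mem_univ i)]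
  rw [updateCol_self, mul_comm (D _)]
  congr 2
  refine Finset.prod_congr rfl fun j hj => ?_
  rw [updateCol_ne (Finset.ne_of_mem_erase hj)]

theorem IsLeviCivita.deriv_det {d : ι → Derivation ℝ R R} {g : Matrix ι ι R} {Γ : ι → Matrix ι ι R}
    (h : IsLeviCivita d g Γ) (a : ι) : d a g.det = 2 * (g.det * (Γ a).trace) := by
  rw [DiffAlg.deriv_det, h.compat, Matrix.mul_add, Matrix.trace_add, ← Matrix.mul_assoc,
    ← Matrix.mul_assoc, Matrix.adjugate_mul, Matrix.trace_mul_comm, ← Matrix.mul_assoc,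
    Matrix.mul_adjugate]
  simp
  ring

end DiffAlg

variable {m : ℕ} {g : (Fin m → ℝ) → Matrix (Fin m) (Fin m) ℝ} {O : Set (Fin m → ℝ)}

open smoothFn in
/-- The density `√(det g)` of the volume of a metric satisfies `∂_a √(det g) = √(det g) Γ^b_{a b}`. -/
theorem IsMetricOn.exists_density (h : IsMetricOn g O) : ∃ s : smoothFn O,
    (∀ z : O, √(g z).det = ev z s) ∧ ∀ a, pd h.isOpen a s = s * (h.conn a).trace := by
  have hpos : ∀ z : O, 0 < ev z h.met.det := fun z => by
    rw [RingHom.map_det]; exact (h.posDef z z.2).det_pos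
  have hs : ContDiffOn ℝ ∞ (fun z => √(rep h.met.det z)) O :=
    (contDiffOn_rep _).sqrt fun z hz => by
      rw [rep_apply _ ⟨z, hz⟩]; exact (hpos ⟨z, hz⟩).ne'
  have hev : ∀ z : O, ev z (of _ hs) = √(ev z h.met.det) := fun z => by
    rw [ev_of, rep_apply]; rfl
  have hsq : of _ hs * of _ hs = h.met.det := ev_injective fun z => by
    rw [map_mul, hev, Real.mul_self_sqrt (hpos z).le]
  have hu : IsUnit (of _ hs) := isUnit_of_ne_zero fun z => by
    rw [hev]; exact (Real.sqrt_pos.2 (hpos z)).ne'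
  refine ⟨of _ hs, fun z => ?_, fun a => ?_⟩
  · rw [hev, RingHom.map_det]; rfl
  · have e := h.isLeviCivita.deriv_det a
    rw [← hsq, Derivation.leibniz, smul_eq_mul] at e
    have e2 : (2 : ℝ) • (of _ hs * (pd h.isOpen a (of _ hs) - of _ hs * (h.conn a).trace)) = 0 := by
      rw [two_smul]
      linear_combination e
    have e3 := DiffAlg.two_smul_cancel (x := of _ hs *
      (pd h.isOpen a (of _ hs) - of _ hs * (h.conn a).trace)) (y := 0) (by rw [e2, smul_zero])
    exact sub_eq_zero.1 (hu.mul_right_eq_zero.1 e3)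

section Support

variable {K : Set (Fin m → ℝ)} (hO : IsOpen O) (hK : IsCompact K) (hKO : K ⊆ O)
include hO hK hKO

theorem hasCompactSupport_indicator {W : (Fin m → ℝ) → ℝ} (hWK : ∀ z ∈ O, W z ≠ 0 → z ∈ K) :
    HasCompactSupport (O.indicator W) := by
  refine HasCompactSupport.intro hK fun z hz => ?_
  by_cases h : z ∈ O
  · rw [indicator_of_mem h]
    by_contra hne
    exact hz (hWK z h hne)
  · exact indicator_of_notMem h _

theorem eventually_indicator_eq {W : (Fin m → ℝ) → ℝ} (hWK : ∀ z ∈ O, W z ≠ 0 → z ∈ K)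
    (z : Fin m → ℝ) : (z ∈ O ∧ O.indicator W =ᶠ[𝓝 z] W) ∨ O.indicator W =ᶠ[𝓝 z] fun _ => 0 := by
  by_cases h : z ∈ O
  · exact .inl ⟨h, by filter_upwards [hO.mem_nhds h] with y hy using indicator_of_mem hy _⟩
  · refine .inr ?_
    filter_upwards [hK.isClosed.isOpen_compl.mem_nhds fun hz => h (hKO hz)] with y hy
    by_cases h' : y ∈ O
    · rw [indicator_of_mem h']
      by_contra hne
      exact hy (hWK y h' hne)
    · exact indicator_of_notMem h' _

theorem integrableOn_of_support {W : (Fin m → ℝ) → ℝ} (hW : ContinuousOn W O)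
    (hWK : ∀ z ∈ O, W z ≠ 0 → z ∈ K) : IntegrableOn W O := by
  rw [← integrable_indicator_iff hO.measurableSet]
  refine Continuous.integrable_of_hasCompactSupport ?_ (hasCompactSupport_indicator hO hK hKO hWK)
  refine continuous_iff_continuousAt.2 fun z => ?_
  rcases eventually_indicator_eq hO hK hKO hWK z with ⟨hz, h⟩ | h
  · exact (hW.continuousAt (hO.mem_nhds hz)).congr h.symm
  · exact continuousAt_const.congr h.symm

theorem integral_pderiv_eq_zero {W : (Fin m → ℝ) → ℝ} (hW : ContDiffOn ℝ ∞ W O)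
    (hWK : ∀ z ∈ O, W z ≠ 0 → z ∈ K) (k : Fin m) : ∫ z in O, Coord.pderiv k W z = 0 := by
  have hsm : ContDiff ℝ ∞ (O.indicator W) := contDiff_iff_contDiffAt.2 fun z => by
    rcases eventually_indicator_eq hO hK hKO hWK z with ⟨hz, h⟩ | h
    · exact (hW.contDiffAt (hO.mem_nhds hz)).congr_of_eventuallyEq h
    · exact contDiffAt_const.congr_of_eventuallyEq h
  have hcs := hasCompactSupport_indicator hO hK hKO hWK
  have hint : Integrable (fun z => fderiv ℝ (O.indicator W) z (Pi.single k 1)) :=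
    ((hsm.continuous_fderiv (by simp)).clm_apply continuous_const).integrable_of_hasCompactSupport
      (hcs.fderiv_apply ℝ _)
  have e : ∫ z in O, Coord.pderiv k W z = ∫ z, fderiv ℝ (O.indicator W) z (Pi.single k 1) := by
    rw [← integral_indicator hO.measurableSet]
    congr 1
    ext z
    rcases eventually_indicator_eq hO hK hKO hWK z with ⟨hz, h⟩ | h
    · rw [indicator_of_mem hz, h.fderiv_eq]; rfl
    · rw [h.fderiv_eq]
      by_cases hz : z ∈ O
      · have h' : W =ᶠ[𝓝 z] fun _ => 0 := by
          filter_upwards [h, hO.mem_nhds hz] with y hy hy'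
          rwa [indicator_of_mem hy'] at hy
        rw [indicator_of_mem hz, Coord.pderiv, h'.fderiv_eq]
      · rw [indicator_of_notMem hz]; simp
  rw [e]
  -- Integration by parts against the constant function 1.
  have := integral_mul_fderiv_eq_neg_fderiv_mul_of_integrable (μ := volume) (f := fun _ => (1 : ℝ))
    (g := O.indicator W) (v := Pi.single k 1) (by simp) (by simpa using hint)
    (by simpa using hsm.continuous.integrable_of_hasCompactSupport hcs)
    (fun _ _ => differentiableAt_const _) (fun z _ => hsm.differentiable (by simp) z)
  simpa using this

-- The integrand is `∑ ∂_k (√(det g) φ X^k)`, by the formula for the derivative of the density, and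
-- each summand is the derivative of a compactly supported function.
open smoothFn DiffAlg in
theorem IsMetricOn.integral_divergence (h : IsMetricOn g O) {X : (Fin m → ℝ) → (Fin m → ℝ)}
    (hX : ∀ k, ContDiffOn ℝ ∞ (fun z => X z k) O) {φ : (Fin m → ℝ) → ℝ} (hφ : ContDiffOn ℝ ∞ φ O)
    (hφK : ∀ z ∈ O, φ z ≠ 0 → z ∈ K) :
    ∫ z in O, √(g z).det * (φ z * Coord.divergence g X z + ∑ k, X z k * Coord.pderiv k φ z) = 0 := by
  obtain ⟨s, hs, hds⟩ := h.exists_density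
  have hsc : ContDiffOn ℝ ∞ (fun z => √(g z).det) O := contDiffOn_of_ev hs
  have hWc : ∀ k, ContDiffOn ℝ ∞ (fun z => √(g z).det * (φ z * X z k)) O := fun k =>
    hsc.mul (hφ.mul (hX k))
  have hWK : ∀ k, ∀ z ∈ O, √(g z).det * (φ z * X z k) ≠ 0 → z ∈ K := fun k z hz hne =>
    hφK z hz fun h0 => hne (by rw [h0]; ring)
  have key : ∀ z ∈ O,
      √(g z).det * (φ z * Coord.divergence g X z + ∑ k, X z k * Coord.pderiv k φ z)
      = ∑ k, Coord.pderiv k (fun z => √(g z).det * (φ z * X z k)) z := by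
    intro z hz
    have e1 : ∀ k, Coord.pderiv k (fun z => √(g z).det * (φ z * X z k)) z
        = ev ⟨z, hz⟩ (pd h.isOpen k (s * (of φ hφ * of _ (hX k)))) := fun k =>
      pderiv_eq_ev h.isOpen (F := fun z => √(g z).det * (φ z * X z k))
        (fun z => by rw [map_mul, map_mul, hs]; rfl) k ⟨z, hz⟩
    have e2 : ∀ k, Coord.pderiv k φ z = ev ⟨z, hz⟩ (pd h.isOpen k (of φ hφ)) := fun k =>
      pderiv_eq_ev h.isOpen (F := φ) (fun z => rfl) k ⟨z, hz⟩
    have e3 : Coord.divergence g X z = _ :=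
      h.divergence_eq (X := X) (Y := fun k => of _ (hX k)) (fun _ _ => rfl) ⟨z, hz⟩
    have e4 : ∀ k, X z k = ev ⟨z, hz⟩ (of _ (hX k)) := fun k => rfl
    have e5 : √(g z).det = ev ⟨z, hz⟩ s := hs ⟨z, hz⟩
    have e7 : φ z = ev ⟨z, hz⟩ (of φ hφ) := rfl
    rw [e3, e5, e7]
    simp only [e1, e2, e4]
    simp only [← map_mul, ← map_sum, ← map_add]
    congr 1
    simp only [Derivation.leibniz, smul_eq_mul, hds, Finset.sum_add_distrib]
    have e6 : (covVec (pd h.isOpen) h.conn fun k => of _ (hX k)).trace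
        = ∑ k, pd h.isOpen k (of _ (hX k)) + ∑ k, (h.conn k).trace * of _ (hX k) := by
      simp only [covVec, Matrix.trace, Matrix.diag_apply, Matrix.of_apply, Matrix.mulVec,
        dotProduct, Finset.sum_add_distrib, Finset.sum_mul]
      congr 1
      rw [Finset.sum_comm]
      exact Finset.sum_congr rfl fun k _ => Finset.sum_congr rfl fun l _ => by
        rw [h.isLeviCivita.torsion]
    rw [e6]
    simp only [mul_add, Finset.mul_sum, ← Finset.sum_add_distrib]
    exact Finset.sum_congr rfl fun k _ => by ring
  rw [setIntegral_congr_fun hO.measurableSet key, integral_finsetSum]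
  · exact Finset.sum_eq_zero fun k _ => integral_pderiv_eq_zero hO hK hKO (hWc k) (hWK k) k
  · intro k _
    refine integrableOn_of_support hO hK hKO
      (Coord.contDiffOn_pderiv hO (hWc k) k).continuousOn fun z hz hne => ?_
    by_contra hzK
    refine hne ?_
    have : (fun z => √(g z).det * (φ z * X z k)) =ᶠ[𝓝 z] fun _ => 0 := by
      filter_upwards [hO.mem_nhds hz, hK.isClosed.isOpen_compl.mem_nhds hzK] with y h1 h2
      by_contra h3
      exact h2 (hWK k y h1 h3)
    rw [Coord.pderiv, this.fderiv_eq]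
    simp

end Support

end

/-! ### Change of variables for the density, and counting the orbits of local groups. -/

section

open Set MeasureTheory

open scoped ENNReal

variable {m : ℕ}

/-- The Riemannian density of a metric. -/
def density (g : (Fin m → ℝ) → Matrix (Fin m) (Fin m) ℝ) (z : Fin m → ℝ) : ℝ≥0∞ :=
  ENNReal.ofReal √(g z).det

theorem aemeasurable_density {g : (Fin m → ℝ) → Matrix (Fin m) (Fin m) ℝ} {O : Set (Fin m → ℝ)}
    (h : IsMetricOn g O) : AEMeasurable (density g) (volume.restrict O) := by
  obtain ⟨s, hs, -⟩ := h.exists_density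
  exact ((smoothFn.contDiffOn_of_ev hs).continuousOn.aemeasurable h.isOpen.measurableSet).ennreal_ofReal

theorem det_fderiv_eq_det_jacobian {e : OpenPartialHomeomorph (Fin m → ℝ) (Fin m → ℝ)}
    (he : ContDiffOn ℝ ∞ e e.source) {z : Fin m → ℝ} (hz : z ∈ e.source) :
    (fderiv ℝ e z).det = (Coord.jacobian e z).det := by
  have : ((fderiv ℝ e z : (Fin m → ℝ) →L[ℝ] (Fin m → ℝ)) : (Fin m → ℝ) →ₗ[ℝ] (Fin m → ℝ))
      = Matrix.toLin' (Coord.jacobian e z) :=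
    LinearMap.ext fun v => by
      rw [Matrix.toLin'_apply, jacobian_mulVec he hz]; rfl
  rw [ContinuousLinearMap.det, this, LinearMap.det_toLin']

/-- The determinant of `g = Pᵀ g' P` supplies the factor `|det P|` required by the change of
variables. -/
theorem lintegral_density_comp {e : OpenPartialHomeomorph (Fin m → ℝ) (Fin m → ℝ)}
    (he : ContDiffOn ℝ ∞ e e.source) {g g' : (Fin m → ℝ) → Matrix (Fin m) (Fin m) ℝ}
    (hg : ∀ z ∈ e.source, (Coord.jacobian e z)ᵀ * g' (e z) * Coord.jacobian e z = g z)
    (H : (Fin m → ℝ) → ℝ≥0∞) :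
    ∫⁻ w in e.target, H w * density g' w = ∫⁻ z in e.source, H (e z) * density g z := by
  rw [← e.image_source_eq_target, lintegral_image_eq_lintegral_abs_det_fderiv_mul volume
    e.open_source.measurableSet (f' := fderiv ℝ e) (fun z hz =>
      ((he.differentiableOn (by simp) z hz).differentiableAt
        (e.open_source.mem_nhds hz)).hasFDerivAt.hasFDerivWithinAt) e.injOn]
  refine setLIntegral_congr_fun e.open_source.measurableSet fun z hz => ?_
  have e2 : √(g z).det = |(Coord.jacobian e z).det| * √(g' (e z)).det := by
    rw [← hg z hz, Matrix.det_mul, Matrix.det_mul, Matrix.det_transpose, mul_right_comm, ← pow_two,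
      Real.sqrt_mul (sq_nonneg _), Real.sqrt_sq_eq_abs]
  simp only [density]
  rw [det_fderiv_eq_det_jacobian he hz, e2, ENNReal.ofReal_mul (abs_nonneg _)]
  ring

namespace OrbifoldChart

variable {M : Type*} [TopologicalSpace M] {c c' : OrbifoldChart m M}

/-- The number of elements of the local group which send `z` to `U`. -/
def orbitCount (c : OrbifoldChart m M) (U : Set (Fin m → ℝ)) (z : Fin m → ℝ) : ℝ≥0∞ :=
  ∑' γ : c.group, U.indicator (fun _ => 1) (c.act γ z)

theorem orbitCount_act (U : Set (Fin m → ℝ)) {z : Fin m → ℝ} (hz : z ∈ c.dom) (γ : c.group) :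
    c.orbitCount U (c.act γ z) = c.orbitCount U z := by
  rw [orbitCount, orbitCount,
    ← (Equiv.mulRight γ).tsum_eq fun δ : c.group => U.indicator (fun _ => (1 : ℝ≥0∞)) (c.act δ z)]
  refine tsum_congr fun δ => ?_
  rw [← act_mul _ _ hz]
  rfl

theorem orbitCount_eq_zero_iff {U : Set (Fin m → ℝ)} (hU : U ⊆ c.dom) {z : Fin m → ℝ}
    (hz : z ∈ c.dom) : c.orbitCount U z = 0 ↔ c.proj z ∉ c.proj '' U := by
  rw [orbitCount, ENNReal.tsum_eq_zero]
  constructor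
  · rintro h ⟨w, hw, e⟩
    obtain ⟨γ, hγ, e'⟩ := exists_act_eq hz (hU hw) e.symm
    have := h ⟨γ, hγ⟩
    simp only at this
    rw [e', indicator_of_mem hw] at this
    exact one_ne_zero this
  · intro h γ
    refine indicator_of_notMem (fun hw => h ⟨_, hw, proj_act γ.2 hz⟩) _

theorem orbitCount_ne_top (U : Set (Fin m → ℝ)) (z : Fin m → ℝ) : c.orbitCount U z ≠ ⊤ := by
  have : Finite c.group := c.finite_group
  have : Fintype c.group := Fintype.ofFinite _
  rw [orbitCount, tsum_fintype]
  refine ENNReal.sum_ne_top.2 fun γ _ => ?_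
  by_cases h : c.act γ z ∈ U
  · rw [indicator_of_mem h]; exact ENNReal.one_ne_top
  · rw [indicator_of_notMem h]; exact ENNReal.zero_ne_top

theorem aemeasurable_orbitCount_term {U : Set (Fin m → ℝ)} (hU : IsOpen U) (γ : c.group) :
    AEMeasurable (fun z => U.indicator (fun _ => (1 : ℝ≥0∞)) (c.act γ z))
      (volume.restrict c.dom) :=
  (measurable_const.indicator hU.measurableSet).comp_aemeasurable
    ((contDiffOn_act γ.2).continuousOn.aemeasurable c.isOpen_dom.measurableSet)

variable [MeasurableSpace M] [BorelSpace M]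

theorem aemeasurable_proj : AEMeasurable c.proj (volume.restrict c.dom) :=
  c.continuousOn_proj.aemeasurable c.isOpen_dom.measurableSet

/-- Integration over the union of the translates of `U` by the local group. -/
theorem lintegral_saturation {g : (Fin m → ℝ) → Matrix (Fin m) (Fin m) ℝ} (hm : IsMetricOn g c.dom)
    (hg : ∀ γ ∈ c.group, ∀ z ∈ c.dom,
      (Coord.jacobian (c.act γ) z)ᵀ * g (c.act γ z) * Coord.jacobian (c.act γ) z = g z)
    {U : Set (Fin m → ℝ)} (hU : IsOpen U) (hUd : U ⊆ c.dom) {f : M → ℝ≥0∞} (hf : Measurable f) :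
    ∫⁻ z in c.dom, (c.proj '' U).indicator f (c.proj z) * density g z
      = ENat.card c.group * ∫⁻ z in U, f (c.proj z) / c.orbitCount U z * density g z := by
  have : Finite c.group := c.finite_group
  have : Countable c.group := Finite.to_countable
  -- Dividing by the number of translates in `U` makes the sum of `H` over an orbit equal to `f` on
  -- the saturation of `U` and to 0 elsewhere. By invariance of the metric every translate of `H`
  -- has the same integral, whence the factor `card`.
  set H : (Fin m → ℝ) → ℝ≥0∞ := U.indicator fun z => f (c.proj z) / c.orbitCount U z with hH
  have hterm : ∀ γ : c.group, ∀ z ∈ c.dom, H (c.act γ z)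
      = U.indicator (fun _ => (1 : ℝ≥0∞)) (c.act γ z) * (f (c.proj z) / c.orbitCount U z) := by
    intro γ z hz
    by_cases h : c.act γ z ∈ U
    · rw [hH, indicator_of_mem h, indicator_of_mem h, one_mul, orbitCount_act U hz,
        proj_act γ.2 hz]
    · rw [hH, indicator_of_notMem h, indicator_of_notMem h, zero_mul]
  have hsum : ∀ z ∈ c.dom, (c.proj '' U).indicator f (c.proj z) * density g z
      = ∑' γ : c.group, U.indicator (fun _ => (1 : ℝ≥0∞)) (c.act γ z)
        * (f (c.proj z) / c.orbitCount U z) * density g z := by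
    intro z hz
    rw [ENNReal.tsum_mul_right, ENNReal.tsum_mul_right]
    congr 1
    change _ = c.orbitCount U z * _
    by_cases h : c.proj z ∈ c.proj '' U
    · rw [indicator_of_mem h, ENNReal.mul_div_cancel ?_ (orbitCount_ne_top U z)]
      rw [Ne, orbitCount_eq_zero_iff hUd hz]
      exact not_not.2 h
    · rw [indicator_of_notMem h, (orbitCount_eq_zero_iff hUd hz).2 h, zero_mul]
  have hmeas : ∀ γ : c.group, AEMeasurable (fun z => U.indicator (fun _ => (1 : ℝ≥0∞)) (c.act γ z)
        * (f (c.proj z) / c.orbitCount U z) * density g z) (volume.restrict c.dom) := fun γ =>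
    ((aemeasurable_orbitCount_term hU γ).mul ((hf.comp_aemeasurable aemeasurable_proj).div
      (AEMeasurable.tsum fun γ => aemeasurable_orbitCount_term hU γ))).mul
      (aemeasurable_density hm)
  rw [setLIntegral_congr_fun c.isOpen_dom.measurableSet hsum, lintegral_tsum hmeas]
  have hint : ∀ γ : c.group, ∫⁻ z in c.dom, U.indicator (fun _ => (1 : ℝ≥0∞)) (c.act γ z)
        * (f (c.proj z) / c.orbitCount U z) * density g z
      = ∫⁻ z in U, f (c.proj z) / c.orbitCount U z * density g z := by
    intro γ
    have e1 : ∫⁻ z in c.dom, H (c.act γ z) * density g z = ∫⁻ z in c.dom, H z * density g z :=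
      (lintegral_density_comp (e := actHomeo γ.2) (contDiffOn_act γ.2) (hg γ γ.2) H).symm
    rw [← setLIntegral_congr_fun c.isOpen_dom.measurableSet
      (fun z hz => congrArg (· * density g z) (hterm γ z hz)), e1]
    have e2 : ∀ z, H z * density g z
        = U.indicator (fun z => f (c.proj z) / c.orbitCount U z * density g z) z := fun z => by
      by_cases h : z ∈ U
      · rw [hH, indicator_of_mem h, indicator_of_mem h]
      · rw [hH, indicator_of_notMem h, indicator_of_notMem h, zero_mul]
    simp only [e2]
    rw [lintegral_indicator hU.measurableSet, Measure.restrict_restrict hU.measurableSet,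
      inter_eq_left.2 hUd]
  rw [tsum_congr hint, ENNReal.tsum_const]

omit [MeasurableSpace M] [BorelSpace M]

/-- `z` is not fixed by any element of the local group other than the identity. -/
def IsFreeAt (c : OrbifoldChart m M) (z : Fin m → ℝ) : Prop :=
  ∀ γ ∈ c.group, c.act γ z = z → γ = 1

theorem volume_not_isFreeAt : volume {z ∈ c.dom | ¬ c.IsFreeAt z} = 0 := by
  have : Finite c.group := c.finite_group
  have : Countable c.group := Finite.to_countable
  have h : volume (⋃ γ : {γ : c.group // γ ≠ 1}, {z ∈ c.dom | c.act γ.1 z = z}) = 0 :=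
    measure_iUnion_null fun γ => volume_fixed_eq_zero γ.1.2 fun h => γ.2 (Subtype.ext h)
  refine measure_mono_null ?_ h
  rintro z ⟨hz, hfr⟩
  simp only [IsFreeAt, not_forall] at hfr
  obtain ⟨γ, hγ, e, hne⟩ := hfr
  exact mem_iUnion.2 ⟨⟨⟨γ, hγ⟩, fun h => hne (congrArg Subtype.val h)⟩, hz, e⟩

/-- At a free point the count is the number of points of `U` in the fibre of `proj`. This
description makes no reference to the group, so it can be compared between charts. -/
theorem orbitCount_eq_encard {U : Set (Fin m → ℝ)} (hU : U ⊆ c.dom) {z : Fin m → ℝ}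
    (hz : z ∈ c.dom) (hfr : c.IsFreeAt z) :
    c.orbitCount U z = ({w ∈ U | c.proj w = c.proj z}.encard : ℝ≥0∞) := by
  have e1 : c.orbitCount U z = ({γ : c.group | c.act γ z ∈ U}.encard : ℝ≥0∞) := by
    rw [← ENNReal.tsum_set_one, tsum_subtype {γ : c.group | c.act γ z ∈ U} (fun _ => (1 : ℝ≥0∞))]
    rfl
  have e2 : {w ∈ U | c.proj w = c.proj z} = (fun γ : c.group => c.act γ z) ''
      {γ : c.group | c.act γ z ∈ U} := by
    ext w
    constructor
    · rintro ⟨hw, e⟩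
      obtain ⟨γ, hγ, e'⟩ := exists_act_eq hz (hU hw) e.symm
      exact ⟨⟨γ, hγ⟩, by simpa [e'] using hw, e'⟩
    · rintro ⟨γ, hγ, rfl⟩
      exact ⟨hγ, proj_act γ.2 hz⟩
  have hinj : Function.Injective fun γ : c.group => c.act γ z := by
    intro γ δ h
    simp only at h
    have h1 := hfr (γ⁻¹ * δ : c.group) (γ⁻¹ * δ).2 (by
      rw [Subgroup.coe_mul, act_mul _ _ hz, ← h, ← act_mul _ _ hz, ← Subgroup.coe_mul,
        inv_mul_cancel, Subgroup.coe_one, act_one hz])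
    exact inv_mul_eq_one.1 (Subtype.ext h1)
  rw [e1, e2, hinj.encard_image]

theorem orbitCount_lift {h : OpenPartialHomeomorph (Fin m → ℝ) (Fin m → ℝ)}
    (hl : IsLocalLift id c c' h) {z : Fin m → ℝ} (hz : z ∈ h.source) (hfr : c.IsFreeAt z)
    (hfr' : c'.IsFreeAt (h z)) : c'.orbitCount h.target (h z) = c.orbitCount h.source z := by
  rw [orbitCount_eq_encard hl.source_subset (hl.source_subset hz) hfr,
    orbitCount_eq_encard hl.target_subset (hl.target_subset (h.map_source hz)) hfr']
  have : {w ∈ h.target | c'.proj w = c'.proj (h z)} = h '' {w ∈ h.source | c.proj w = c.proj z} := by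
    have hp := hl.proj_apply
    simp only [id] at hp
    ext w
    constructor
    · rintro ⟨hw, e⟩
      refine ⟨h.symm w, ⟨h.map_target hw, ?_⟩, h.right_inv hw⟩
      rw [← hp _ (h.map_target hw), h.right_inv hw, e, hp z hz]
    · rintro ⟨w, ⟨hw, e⟩, rfl⟩
      exact ⟨h.map_source hw, by rw [hp w hw, hp z hz, e]⟩
  rw [this, InjOn.encard_image (h.injOn.mono fun w hw => hw.1)]

/-- Non-free points form a null set in both charts, and `h.symm` maps null sets to null sets. -/
theorem ae_orbitCount_lift {h : OpenPartialHomeomorph (Fin m → ℝ) (Fin m → ℝ)}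
    (hl : IsLocalLift id c c' h) :
    ∀ᵐ z ∂volume.restrict h.source, c'.orbitCount h.target (h z) = c.orbitCount h.source z := by
  rw [ae_restrict_iff' h.open_source.measurableSet]
  have h1 : volume (h.symm '' {w ∈ h.target | ¬ c'.IsFreeAt w}) = 0 := by
    refine addHaar_image_eq_zero_of_differentiableOn_of_addHaar_eq_zero volume
      ((hl.contDiffOn_symm.differentiableOn (by simp)).mono fun w hw => hw.1) ?_
    refine measure_mono_null ?_ (volume_not_isFreeAt (c := c'))
    exact fun w hw => ⟨hl.target_subset hw.1, hw.2⟩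
  have h2 := measure_union_null h1 (volume_not_isFreeAt (c := c))
  refine measure_mono_null (fun z hz => ?_) h2
  simp only [mem_compl_iff, mem_ofPred_eq, Classical.not_imp] at hz
  obtain ⟨hz, hne⟩ := hz
  by_contra hcon
  rw [mem_union, not_or] at hcon
  refine hne (orbitCount_lift hl hz ?_ ?_)
  · by_contra hf
    exact hcon.2 ⟨hl.source_subset hz, hf⟩
  · by_contra hf
    exact hcon.1 ⟨h z, ⟨h.map_source hz, hf⟩, h.left_inv hz⟩

end OrbifoldChart

end

/-! ### Riemannian measures on chart images, their agreement on overlaps, and global vector fields.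
-/

section

open Set MeasureTheory

open scoped ENNReal

variable {m : ℕ} {M : Type*} [TopologicalSpace M]

namespace OrbifoldChart

variable [MeasurableSpace M] [BorelSpace M] {c c' : OrbifoldChart m M}
  {g g' : (Fin m → ℝ) → Matrix (Fin m) (Fin m) ℝ}

/-- The Riemannian measure on the image of an orbifold chart. -/
def chartMeasure (c : OrbifoldChart m M) (g : (Fin m → ℝ) → Matrix (Fin m) (Fin m) ℝ) :
    Measure M :=
  (ENat.card c.group : ℝ≥0∞)⁻¹ • ((volume.restrict c.dom).withDensity (density g)).map c.proj

theorem aemeasurable_proj_withDensity :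
    AEMeasurable c.proj ((volume.restrict c.dom).withDensity (density g)) :=
  aemeasurable_proj.mono_ac (withDensity_absolutelyContinuous _ _)

theorem card_group_ne_zero : (ENat.card c.group : ℝ≥0∞) ≠ 0 := by
  simp

theorem card_group_ne_top : (ENat.card c.group : ℝ≥0∞) ≠ ⊤ := by
  have : Finite c.group := c.finite_group
  simpa using this

theorem lintegral_chartMeasure (hm : IsMetricOn g c.dom) {f : M → ℝ≥0∞} (hf : Measurable f) :
    ∫⁻ q, f q ∂c.chartMeasure g
      = (ENat.card c.group : ℝ≥0∞)⁻¹ * ∫⁻ z in c.dom, f (c.proj z) * density g z := by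
  have e : ∫⁻ z, f (c.proj z) ∂(volume.restrict c.dom).withDensity (density g) = _ :=
    lintegral_withDensity_eq_lintegral_mul₀ (aemeasurable_density hm)
      (hf.comp_aemeasurable aemeasurable_proj)
  rw [chartMeasure, lintegral_smul_measure, lintegral_map' hf.aemeasurable
    aemeasurable_proj_withDensity, e, smul_eq_mul]
  simp only [Pi.mul_apply, mul_comm]

/-- By `lintegral_saturation` and the normalization by the group order, both measures are integrals
of `f / orbitCount`, over `h.source` and over `h.target`. The lift `h` identifies densities and,
almost everywhere, orbit counts. -/
theorem chartMeasure_restrict_eq (hm : IsMetricOn g c.dom) (hm' : IsMetricOn g' c'.dom)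
    (hg : ∀ γ ∈ c.group, ∀ z ∈ c.dom,
      (Coord.jacobian (c.act γ) z)ᵀ * g (c.act γ z) * Coord.jacobian (c.act γ) z = g z)
    (hg' : ∀ γ ∈ c'.group, ∀ z ∈ c'.dom,
      (Coord.jacobian (c'.act γ) z)ᵀ * g' (c'.act γ z) * Coord.jacobian (c'.act γ) z = g' z)
    {h : OpenPartialHomeomorph (Fin m → ℝ) (Fin m → ℝ)} (hl : IsLocalLift id c c' h)
    (hgg : ∀ z ∈ h.source, (Coord.jacobian h z)ᵀ * g' (h z) * Coord.jacobian h z = g z) :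
    (c.chartMeasure g).restrict (c.proj '' h.source)
      = (c'.chartMeasure g').restrict (c.proj '' h.source) := by
  have hp := hl.proj_apply
  simp only [id] at hp
  have himg : c'.proj '' h.target = c.proj '' h.source := by
    ext q
    constructor
    · rintro ⟨w, hw, rfl⟩
      exact ⟨h.symm w, h.map_target hw, by rw [← hp _ (h.map_target hw), h.right_inv hw]⟩
    · rintro ⟨z, hz, rfl⟩
      exact ⟨h z, h.map_source hz, hp z hz⟩
  have hWo : MeasurableSet (c.proj '' h.source) :=
    (c.isOpen_image_proj _ hl.source_subset h.open_source).measurableSet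
  ext B hB
  have hf : Measurable (B.indicator fun _ => (1 : ℝ≥0∞)) := measurable_const.indicator hB
  have e : ∀ μ : Measure M, μ.restrict (c.proj '' h.source) B
      = ∫⁻ q, (c.proj '' h.source).indicator (B.indicator fun _ => (1 : ℝ≥0∞)) q ∂μ := fun μ => by
    rw [lintegral_indicator hWo, lintegral_indicator hB]
    simp
  rw [e, e, lintegral_chartMeasure hm (hf.indicator hWo), lintegral_chartMeasure hm'
    (hf.indicator hWo), lintegral_saturation hm hg h.open_source hl.source_subset hf]
  conv_rhs => rw [← himg]
  rw [lintegral_saturation hm' hg' h.open_target hl.target_subset hf, ← mul_assoc, ← mul_assoc,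
    ENNReal.inv_mul_cancel card_group_ne_zero card_group_ne_top,
    ENNReal.inv_mul_cancel card_group_ne_zero card_group_ne_top, one_mul, one_mul,
    lintegral_density_comp hl.contDiffOn hgg]
  have hae := ae_orbitCount_lift hl
  rw [ae_restrict_iff' h.open_source.measurableSet] at hae
  refine setLIntegral_congr_fun_ae h.open_source.measurableSet ?_
  filter_upwards [hae] with z hz hzs
  rw [hz hzs, hp z hzs]

theorem integral_chartMeasure (hm : IsMetricOn g c.dom) {u : M → ℝ} (hu : Continuous u) :
    ∫ q, u q ∂c.chartMeasure g
      = (ENat.card c.group : ℝ≥0∞)⁻¹.toReal * ∫ z in c.dom, √(g z).det * u (c.proj z) := by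
  have hd : AEMeasurable (fun z => Real.toNNReal √(g z).det) (volume.restrict c.dom) := by
    obtain ⟨s, hs, -⟩ := hm.exists_density
    exact ((smoothFn.contDiffOn_of_ev hs).continuousOn.aemeasurable
      hm.isOpen.measurableSet).real_toNNReal
  rw [chartMeasure, integral_smul_measure, integral_map aemeasurable_proj_withDensity
    hu.aestronglyMeasurable]
  change _ • ∫ z, u (c.proj z) ∂(volume.restrict c.dom).withDensity
    (fun z => (Real.toNNReal √(g z).det : ℝ≥0∞)) = _
  rw [integral_withDensity_eq_integral_smul₀ hd]
  simp only [NNReal.smul_def, Real.coe_toNNReal _ (Real.sqrt_nonneg _), smul_eq_mul]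

/-- The union of the translates of a compact set by the local group. -/
theorem exists_compact_saturation {K : Set (Fin m → ℝ)} (hK : IsCompact K) (hKd : K ⊆ c.dom) :
    ∃ K', IsCompact K' ∧ K' ⊆ c.dom ∧ ∀ z ∈ c.dom, c.proj z ∈ c.proj '' K → z ∈ K' := by
  have : Finite c.group := c.finite_group
  refine ⟨⋃ γ : c.group, c.act γ '' K, isCompact_iUnion fun γ =>
    hK.image_of_continuousOn ((contDiffOn_act γ.2).continuousOn.mono hKd),
    iUnion_subset fun γ => ?_, ?_⟩
  · rintro _ ⟨w, hw, rfl⟩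
    exact act_mem _ (hKd hw)
  · rintro z hz ⟨w, hw, e⟩
    obtain ⟨γ, hγ, e'⟩ := exists_act_eq (hKd hw) hz e
    exact mem_iUnion.2 ⟨⟨γ, hγ⟩, w, hw, e'⟩

theorem integrable_chartMeasure (hm : IsMetricOn g c.dom) {u : M → ℝ} (hu : Continuous u)
    {K : Set (Fin m → ℝ)} (hK : IsCompact K) (hKd : K ⊆ c.dom)
    (huK : ∀ q, u q ≠ 0 → q ∈ c.proj '' K) : Integrable u (c.chartMeasure g) := by
  obtain ⟨s, hs, -⟩ := hm.exists_density
  have hdc : ContinuousOn (fun z => √(g z).det) c.dom := (smoothFn.contDiffOn_of_ev hs).continuousOn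
  have hd : AEMeasurable (fun z => Real.toNNReal √(g z).det) (volume.restrict c.dom) :=
    (hdc.aemeasurable hm.isOpen.measurableSet).real_toNNReal
  obtain ⟨K', hK', hKd', hsat⟩ := exists_compact_saturation hK hKd
  refine Integrable.smul_measure ?_ (ENNReal.inv_ne_top.2 card_group_ne_zero)
  rw [integrable_map_measure hu.aestronglyMeasurable aemeasurable_proj_withDensity]
  change Integrable _ ((volume.restrict c.dom).withDensity
    (fun z => (Real.toNNReal √(g z).det : ℝ≥0∞)))
  rw [integrable_withDensity_iff_integrable_smul₀ hd]
  simp only [NNReal.smul_def, Real.coe_toNNReal _ (Real.sqrt_nonneg _), smul_eq_mul,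
    Function.comp_apply]
  refine integrableOn_of_support c.isOpen_dom hK' hKd'
    (hdc.mul (hu.comp_continuousOn c.continuousOn_proj)) fun z hz hne => hsat z hz (huK _ ?_)
  exact fun h0 => hne (by simp [h0])

end OrbifoldChart

namespace OrbifoldAtlas

open OrbifoldChart

variable {ι : Type*} (A : OrbifoldAtlas ι m M)

/-- Functions in the charts which agree on overlaps define a function on the orbifold. -/
theorem exists_function {β : Type*} (F : ι → (Fin m → ℝ) → β)
    (hF : ∀ i j h, IsLocalLift id (A.chart i) (A.chart j) h → ∀ z ∈ h.source, F j (h z) = F i z) :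
    ∃ f : M → β, ∀ i, ∀ z ∈ (A.chart i).dom, f ((A.chart i).proj z) = F i z := by
  choose i z hz hp using A.cover
  refine ⟨fun p => F (i p) (z p), fun j w hw => ?_⟩
  obtain ⟨h, hl, h1, h2⟩ := A.compatible j (i _) w hw _ (hz ((A.chart j).proj w)) (hp _).symm
  simp only
  rw [← h2, hF _ _ h hl w h1]

theorem continuous_of_charts {f : M → ℝ}
    (hf : ∀ i, ContinuousOn (fun z => f ((A.chart i).proj z)) (A.chart i).dom) : Continuous f := by
  refine continuous_def.2 fun s hs => ?_
  have : f ⁻¹' s = ⋃ i, (A.chart i).proj '' ((A.chart i).dom ∩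
      (fun z => f ((A.chart i).proj z)) ⁻¹' s) := by
    ext p
    constructor
    · intro hp
      obtain ⟨i, z, hz, rfl⟩ := A.cover p
      exact mem_iUnion.2 ⟨i, z, ⟨hz, hp⟩, rfl⟩
    · intro hp
      obtain ⟨i, z, ⟨-, hz⟩, rfl⟩ := mem_iUnion.1 hp
      exact hz
  rw [this]
  exact isOpen_iUnion fun i => (A.chart i).isOpen_image_proj _ inter_subset_left
    ((hf i).isOpen_inter_preimage (A.chart i).isOpen_dom hs)

variable {A}

theorem IsSmooth.continuous {f : M → ℝ} (hf : A.IsSmooth f) : Continuous f :=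
  A.continuous_of_charts fun i => (hf i).continuousOn

/-- A smooth vector field on an orbifold, given by its components in the charts. -/
structure IsVectorField (A : OrbifoldAtlas ι m M) (V : ι → (Fin m → ℝ) → (Fin m → ℝ)) : Prop where
  smooth : ∀ i k, ContDiffOn ℝ ∞ (fun z => V i z k) (A.chart i).dom
  natural : ∀ i j h, IsLocalLift id (A.chart i) (A.chart j) h → ∀ z ∈ h.source,
    V j (h z) = Coord.jacobian h z *ᵥ V i z

theorem IsSmooth.fderiv_lift {f : M → ℝ} (hf : A.IsSmooth f) {i j : ι}
    {h : OpenPartialHomeomorph (Fin m → ℝ) (Fin m → ℝ)}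
    (hl : IsLocalLift id (A.chart i) (A.chart j) h) {z : Fin m → ℝ} (hz : z ∈ h.source)
    (v : Fin m → ℝ) : fderiv ℝ (fun y => f ((A.chart j).proj y)) (h z) (Coord.jacobian h z *ᵥ v)
      = fderiv ℝ (fun y => f ((A.chart i).proj y)) z v := by
  have h1 : DifferentiableAt ℝ (fun y => f ((A.chart j).proj y)) (h z) := by
    have hd := hl.target_subset (h.map_source hz)
    exact ((hf j).differentiableOn (by simp) _ hd).differentiableAt
      ((A.chart j).isOpen_dom.mem_nhds hd)
  have h2 : DifferentiableAt ℝ h z :=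
    (hl.contDiffOn.differentiableOn (by simp) z hz).differentiableAt (h.open_source.mem_nhds hz)
  have e : (fun y => f ((A.chart i).proj y)) =ᶠ[𝓝 z] fun y => f ((A.chart j).proj (h y)) := by
    filter_upwards [h.open_source.mem_nhds hz] with y hy
    rw [hl.proj_apply y hy, id]
  rw [e.fderiv_eq, jacobian_mulVec hl.contDiffOn hz]
  have := (h1.hasFDerivAt.comp z h2.hasFDerivAt).fderiv
  exact (congrArg (fun L : (Fin m → ℝ) →L[ℝ] ℝ => L v) this).symm

/-- The derivative of `f` along `V` is the same in all charts, so it descends to `M`. It is used for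
cutoff functions and for components of the moment map along action fields. -/
theorem IsVectorField.exists_derivative {V : ι → (Fin m → ℝ) → (Fin m → ℝ)}
    (hV : A.IsVectorField V) {f : M → ℝ} (hf : A.IsSmooth f) :
    ∃ E : M → ℝ, Continuous E ∧ ∀ i, ∀ z ∈ (A.chart i).dom,
      E ((A.chart i).proj z) = fderiv ℝ (fun y => f ((A.chart i).proj y)) z (V i z) := by
  obtain ⟨E, hE⟩ := A.exists_function
    (fun i z => fderiv ℝ (fun y => f ((A.chart i).proj y)) z (V i z)) fun i j h hl z hz => by
      rw [hV.natural i j h hl z hz, hf.fderiv_lift hl hz]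
  refine ⟨E, A.continuous_of_charts fun i => ?_, hE⟩
  refine ContinuousOn.congr ?_ (hE i)
  exact (((hf i).fderiv_of_isOpen (A.chart i).isOpen_dom (m := ∞) (by simp)).clm_apply
    (contDiffOn_pi.2 (hV.smooth i))).continuousOn

variable {g : ι → (Fin m → ℝ) → Matrix (Fin m) (Fin m) ℝ}

theorem isMetricOn_of_isFormField (hg : A.IsFormField g)
    (hpos : ∀ i, ∀ z ∈ (A.chart i).dom, (g i z).PosDef) (i : ι) :
    IsMetricOn (g i) (A.chart i).dom :=
  ⟨(A.chart i).isOpen_dom, hg.1 i, hpos i⟩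

theorem divergence_lift (hg : A.IsFormField g)
    (hpos : ∀ i, ∀ z ∈ (A.chart i).dom, (g i z).PosDef) {V : ι → (Fin m → ℝ) → (Fin m → ℝ)}
    (hV : A.IsVectorField V) {i j : ι} {h : OpenPartialHomeomorph (Fin m → ℝ) (Fin m → ℝ)}
    (hl : IsLocalLift id (A.chart i) (A.chart j) h) {z : Fin m → ℝ} (hz : z ∈ h.source) :
    Coord.divergence (g j) (V j) (h z) = Coord.divergence (g i) (V i) z := by
  have hi := (isMetricOn_of_isFormField hg hpos i).mono h.open_source hl.source_subset
  have hj := (isMetricOn_of_isFormField hg hpos j).mono h.open_target hl.target_subset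
  have hgg := hg.2 i j h hl
  have hVi := fun k => (hV.smooth i k).mono hl.source_subset
  have hVj := fun k => (hV.smooth j k).mono hl.target_subset
  rw [hj.divergence_eq (X := V j) (Y := fun k => smoothFn.of _ (hVj k)) (fun _ _ => rfl)
      ⟨h z, h.map_source hz⟩, hi.divergence_eq (X := V i) (Y := fun k => smoothFn.of _ (hVi k))
      (fun _ _ => rfl) ⟨z, hz⟩]
  have he := hl.contDiffOn
  have := DiffAlg.trace_covVec_natural hi.isLeviCivita hj.isLeviCivita (pullback h he) (jac he)
    (isUnit_det_jac he hi hgg) (pd_pullback he) (pd_jac he) (jac_met he hi hj hgg)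
    (X := fun k => smoothFn.of _ (hVi k)) (X' := fun k => smoothFn.of _ (hVj k))
    (fun k => smoothFn.ev_injective fun y => by
      rw [ev_pullback, ev_mulVec]
      exact congrFun (hV.natural i j h hl y y.2) k)
  rw [← this, ev_pullback]

/-- The overlap is covered by images of sources of local lifts. Countably many of them suffice, as
`ℝ^m` is second countable, and on each one the measures agree. -/
theorem chartMeasure_restrict_inter [MeasurableSpace M] [BorelSpace M] (hg : A.IsFormField g)
    (hpos : ∀ i, ∀ z ∈ (A.chart i).dom, (g i z).PosDef) (i j : ι) :
    ((A.chart i).chartMeasure (g i)).restrict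
        ((A.chart i).proj '' (A.chart i).dom ∩ (A.chart j).proj '' (A.chart j).dom)
      = ((A.chart j).chartMeasure (g j)).restrict
        ((A.chart i).proj '' (A.chart i).dom ∩ (A.chart j).proj '' (A.chart j).dom) := by
  set S := {z : Fin m → ℝ | z ∈ (A.chart i).dom ∧
    ∃ w ∈ (A.chart j).dom, (A.chart j).proj w = (A.chart i).proj z} with hS
  have hex : ∀ z : S, ∃ h, IsLocalLift id (A.chart i) (A.chart j) h ∧ (z : Fin m → ℝ) ∈ h.source :=
    fun ⟨z, hz, w, hw, e⟩ => by
      obtain ⟨h, hl, h1, -⟩ := A.compatible i j z hz w hw e.symm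
      exact ⟨h, hl, h1⟩
  choose h hl hmem using hex
  obtain ⟨T, hT, hTu⟩ := TopologicalSpace.isOpen_iUnion_countable (fun z => (h z).source)
    fun z => (h z).open_source
  have : Countable T := hT.to_subtype
  have hW : (A.chart i).proj '' (A.chart i).dom ∩ (A.chart j).proj '' (A.chart j).dom
      = ⋃ t : T, (A.chart i).proj '' (h t).source := by
    ext q
    constructor
    · rintro ⟨⟨z, hz, rfl⟩, w, hw, e⟩
      have : z ∈ ⋃ t ∈ T, (h t).source := by
        rw [hTu]; exact mem_iUnion.2 ⟨⟨z, hz, w, hw, e⟩, hmem _⟩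
      obtain ⟨t, ht, hzt⟩ := mem_iUnion₂.1 this
      exact mem_iUnion.2 ⟨⟨t, ht⟩, z, hzt, rfl⟩
    · intro hq
      obtain ⟨t, z, hz, rfl⟩ := mem_iUnion.1 hq
      have hp := (hl t).proj_apply z hz
      exact ⟨⟨z, (hl t).source_subset hz, rfl⟩, h t z,
        (hl t).target_subset ((h t).map_source hz), hp⟩
  rw [hW, Measure.restrict_iUnion_congr]
  intro t
  exact chartMeasure_restrict_eq (isMetricOn_of_isFormField hg hpos i)
    (isMetricOn_of_isFormField hg hpos j)
    (fun γ hγ z hz => hg.2 i i _ (isLocalLift_actHomeo hγ) z hz)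
    (fun γ hγ z hz => hg.2 j j _ (isLocalLift_actHomeo hγ) z hz) (hl t)
    (hg.2 i j _ (hl t))

theorem integral_chartMeasure_eq [MeasurableSpace M] [BorelSpace M] (hg : A.IsFormField g)
    (hpos : ∀ i, ∀ z ∈ (A.chart i).dom, (g i z).PosDef) {i j : ι} {u : M → ℝ}
    (hu : ∀ q, u q ≠ 0 →
      q ∈ (A.chart i).proj '' (A.chart i).dom ∩ (A.chart j).proj '' (A.chart j).dom) :
    ∫ q, u q ∂(A.chart i).chartMeasure (g i) = ∫ q, u q ∂(A.chart j).chartMeasure (g j) := by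
  have hu' : ∀ q, q ∉ (A.chart i).proj '' (A.chart i).dom ∩ (A.chart j).proj '' (A.chart j).dom →
      u q = 0 := fun q hq => by
    by_contra h
    exact hq (hu q h)
  rw [← setIntegral_eq_integral_of_forall_compl_eq_zero (μ := (A.chart i).chartMeasure (g i)) hu',
    ← setIntegral_eq_integral_of_forall_compl_eq_zero (μ := (A.chart j).chartMeasure (g j)) hu',
    chartMeasure_restrict_inter hg hpos i j]

end OrbifoldAtlas

end

/-! ### The divergence theorem on a compact orbifold. -/

section

open Set MeasureTheory

open scoped ENNReal

variable {m : ℕ} {M : Type*} [TopologicalSpace M]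

namespace OrbifoldAtlas

open OrbifoldChart

variable {ι : Type*} {A : OrbifoldAtlas ι m M}
  {g : ι → (Fin m → ℝ) → Matrix (Fin m) (Fin m) ℝ}

/-- By the divergence theorem, a vector field on a compact orbifold whose divergence is nonnegative
is divergence free. -/
theorem divergence_eq_zero_of_nonneg [T2Space M] [CompactSpace M] (hg : A.IsFormField g)
    (hpos : ∀ i, ∀ z ∈ (A.chart i).dom, (g i z).PosDef) {V : ι → (Fin m → ℝ) → (Fin m → ℝ)}
    (hV : A.IsVectorField V)
    (h0 : ∀ i, ∀ z ∈ (A.chart i).dom, 0 ≤ Coord.divergence (g i) (V i) z) :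
    ∀ i, ∀ z ∈ (A.chart i).dom, Coord.divergence (g i) (V i) z = 0 := by
  let _ : MeasurableSpace M := borel M
  have : BorelSpace M := ⟨rfl⟩
  have hm := isMetricOn_of_isFormField hg hpos
  have hO : ∀ i, IsOpen (A.chart i).dom := fun i => (A.chart i).isOpen_dom
  obtain ⟨s, c, K, ρ, hK, hKd, hρ, hρ0, hρK, hρ1⟩ := A.exists_partition
  choose E hEc hE using fun p => hV.exists_derivative (hρ p)
  choose K' hK' hKd' hsat using fun p => exists_compact_saturation (hK p) (hKd p)
  have hKcl : ∀ p, IsClosed ((A.chart (c p)).proj '' K p) := fun p =>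
    ((hK p).image_of_continuousOn ((A.chart (c p)).continuousOn_proj.mono (hKd p))).isClosed
  have hEK : ∀ p q, E p q ≠ 0 → q ∈ (A.chart (c p)).proj '' K p := by
    intro p q hne
    obtain ⟨i, z, hz, rfl⟩ := A.cover q
    by_contra hq
    refine hne ?_
    have hct := (A.chart i).continuousOn_proj.continuousAt ((hO i).mem_nhds hz)
    have : (fun y => ρ p ((A.chart i).proj y)) =ᶠ[𝓝 z] fun _ => 0 := by
      filter_upwards [hct.eventually ((hKcl p).isOpen_compl.mem_nhds hq)] with y hy
      by_contra hne
      exact hy (hρK p _ hne)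
    rw [hE p i z hz, this.fderiv_eq]
    simp
  have hEsum : ∀ q, ∑ p ∈ s, E p q = 0 := by
    intro q
    obtain ⟨i, z, hz, rfl⟩ := A.cover q
    have h1 : ∀ p ∈ s, HasFDerivAt (fun y => ρ p ((A.chart i).proj y))
        (fderiv ℝ (fun y => ρ p ((A.chart i).proj y)) z) z := fun p _ =>
      (((hρ p i).differentiableOn (by simp) z hz).differentiableAt
        ((hO i).mem_nhds hz)).hasFDerivAt
    have h2 := (HasFDerivAt.fun_sum h1).fderiv
    simp only [hρ1] at h2
    rw [fderiv_fun_const] at h2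
    have h3 := congrArg (fun L : (Fin m → ℝ) →L[ℝ] ℝ => L (V i z)) h2
    simp only [Pi.zero_apply, zero_apply,
      sum_apply] at h3
    rw [h3]
    exact Finset.sum_congr rfl fun p _ => hE p i z hz
  let ν : M → Measure M := fun p => (A.chart (c p)).chartMeasure (g (c p))
  -- No global measure is constructed. Writing `1 = ∑ ρ l`, the part `ρ l * E p` lives on the
  -- overlap of two charts, where `ν p` may be replaced by `ν l`. The sum over `p` then vanishes
  -- because `∑ E p = 0`.
  have hsumE : ∑ p ∈ s, ∫ q, E p q ∂ν p = 0 := by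
    have h1 : ∀ p ∈ s, ∫ q, E p q ∂ν p = ∑ l ∈ s, ∫ q, ρ l q * E p q ∂ν l := by
      intro p _
      have e : ∀ q, E p q = ∑ l ∈ s, ρ l q * E p q := fun q => by
        rw [← Finset.sum_mul, hρ1, one_mul]
      rw [integral_congr_ae (Filter.Eventually.of_forall e), integral_finsetSum]
      · refine Finset.sum_congr rfl fun l _ => integral_chartMeasure_eq hg hpos fun q hq => ?_
        exact ⟨image_mono (hKd p) (hEK p q (right_ne_zero_of_mul hq)),
          image_mono (hKd l) (hρK l q (left_ne_zero_of_mul hq))⟩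
      · exact fun l _ => integrable_chartMeasure (hm _) ((hρ l).continuous.mul (hEc p)) (hK p)
          (hKd p) fun q hq => hEK p q (right_ne_zero_of_mul hq)
    rw [Finset.sum_congr rfl h1, Finset.sum_comm]
    refine Finset.sum_eq_zero fun l _ => ?_
    rw [← integral_finsetSum]
    · simp only [← Finset.mul_sum, hEsum, mul_zero, integral_zero]
    · exact fun p _ => integrable_chartMeasure (hm _) ((hρ l).continuous.mul (hEc p)) (hK l)
        (hKd l) fun q hq => hρK l q (left_ne_zero_of_mul hq)
  have hdens : ∀ i, ContinuousOn (fun z => √(g i z).det) (A.chart i).dom := fun i => by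
    obtain ⟨d, hd, -⟩ := (hm i).exists_density
    exact (smoothFn.contDiffOn_of_ev hd).continuousOn
  have hdiv : ∀ i, ContinuousOn (Coord.divergence (g i) (V i)) (A.chart i).dom := fun i =>
    (smoothFn.contDiffOn_of_ev ((hm i).divergence_eq (X := V i)
      (Y := fun k => smoothFn.of _ (hV.smooth i k)) fun _ _ => rfl)).continuousOn
  let κ : M → ℝ := fun p => (ENat.card (A.chart (c p)).group : ℝ≥0∞)⁻¹.toReal
  have hκ : ∀ p, 0 < κ p := fun p => ENNReal.toReal_pos
    (ENNReal.inv_ne_zero.2 card_group_ne_top) (ENNReal.inv_ne_top.2 card_group_ne_zero)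
  let a : M → (Fin m → ℝ) → ℝ := fun p z => √(g (c p) z).det *
    (ρ p ((A.chart (c p)).proj z) * Coord.divergence (g (c p)) (V (c p)) z)
  have ha0 : ∀ p, ∀ z ∈ (A.chart (c p)).dom, 0 ≤ a p z := fun p z hz =>
    mul_nonneg (Real.sqrt_nonneg _) (mul_nonneg (hρ0 p _) (h0 _ z hz))
  have hac : ∀ p, ContinuousOn (a p) (A.chart (c p)).dom := fun p =>
    (hdens _).mul ((hρ p (c p)).continuousOn.mul (hdiv _))
  have haint : ∀ p, IntegrableOn (a p) (A.chart (c p)).dom := fun p =>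
    integrableOn_of_support (hO _) (hK' p) (hKd' p) (hac p) fun z hz hne =>
      hsat p z hz (hρK p _ (left_ne_zero_of_mul (right_ne_zero_of_mul hne)))
  -- The chart divergence theorem with cutoff `ρ p`; the term containing its differential is `E p`.
  have hab : ∀ p, κ p * ∫ z in (A.chart (c p)).dom, a p z = - ∫ q, E p q ∂ν p := by
    intro p
    have hbint : IntegrableOn (fun z => √(g (c p) z).det * E p ((A.chart (c p)).proj z))
        (A.chart (c p)).dom := integrableOn_of_support (hO _) (hK' p) (hKd' p)
      ((hdens _).mul ((hEc p).comp_continuousOn (A.chart (c p)).continuousOn_proj))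
      fun z hz hne => hsat p z hz (hEK p _ (right_ne_zero_of_mul hne))
    rw [integral_chartMeasure (hm _) (hEc p), ← mul_neg]
    congr 1
    rw [eq_neg_iff_add_eq_zero, ← integral_add (haint p) hbint]
    rw [← (hm (c p)).integral_divergence (hO _) (hK' p) (hKd' p) (hV.smooth (c p)) (hρ p (c p))
      fun z hz hne => hsat p z hz (hρK p _ hne)]
    refine setIntegral_congr_fun (hO _).measurableSet fun z hz => ?_
    simp only [a]
    rw [hE p _ z hz, fderiv_apply_eq_sum]
    ring
  have hasum : ∑ p ∈ s, κ p * ∫ z in (A.chart (c p)).dom, a p z = 0 := by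
    rw [Finset.sum_congr rfl fun p _ => hab p, Finset.sum_neg_distrib, hsumE, neg_zero]
  -- A vanishing sum of nonnegative integrals has vanishing terms, so each integrand is zero almost
  -- everywhere, and by continuity everywhere.
  have ha : ∀ p ∈ s, ∀ z ∈ (A.chart (c p)).dom, a p z = 0 := by
    intro p hp
    have hnn : ∀ p ∈ s, 0 ≤ κ p * ∫ z in (A.chart (c p)).dom, a p z := fun p _ =>
      mul_nonneg (hκ p).le (setIntegral_nonneg (hO _).measurableSet (ha0 p))
    have h1 := (Finset.sum_eq_zero_iff_of_nonneg hnn).1 hasum p hp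
    have h2 := (mul_eq_zero.1 h1).resolve_left (hκ p).ne'
    rw [setIntegral_eq_zero_iff_of_nonneg_ae
      ((ae_restrict_iff' (hO _).measurableSet).2 (Filter.Eventually.of_forall (ha0 p)))
      (haint p)] at h2
    exact Measure.eqOn_open_of_ae_eq h2 (hO _) (hac p) continuousOn_const
  intro i z hz
  obtain ⟨p, hp, hne⟩ : ∃ p ∈ s, ρ p ((A.chart i).proj z) ≠ 0 := by
    by_contra! hcon
    have := hρ1 ((A.chart i).proj z)
    rw [Finset.sum_eq_zero hcon] at this
    exact zero_ne_one this
  obtain ⟨w, hw, e⟩ := hρK p _ hne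
  obtain ⟨h, hl, hzh, hzw⟩ := A.compatible i (c p) z hz w (hKd p hw) e.symm
  rw [← divergence_lift hg hpos hV hl hzh, hzw]
  have h1 := ha p hp w (hKd p hw)
  simp only [a, e] at h1
  have h2 : √(g (c p) w).det ≠ 0 :=
    (Real.sqrt_pos.2 (hpos (c p) w (hKd p hw)).det_pos).ne'
  exact (mul_eq_zero.1 ((mul_eq_zero.1 h1).resolve_left h2)).resolve_left hne

end OrbifoldAtlas

end

/-! ### Gradients, Hamiltonian fields, Kähler fields and Laplacians of functions on a Kähler
orbifold. -/

section

open Set DiffAlg smoothFn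

section Chart

variable {m : ℕ} {g J : (Fin m → ℝ) → Matrix (Fin m) (Fin m) ℝ} {O : Set (Fin m → ℝ)}

theorem IsMetricOn.divergence_smul (h : IsMetricOn g O) {φ : (Fin m → ℝ) → ℝ}
    (hφ : ContDiffOn ℝ ∞ φ O) {X : (Fin m → ℝ) → (Fin m → ℝ)}
    (hX : ∀ k, ContDiffOn ℝ ∞ (fun z => X z k) O) {z : Fin m → ℝ} (hz : z ∈ O) :
    Coord.divergence g (fun y => φ y • X y) z
      = fderiv ℝ φ z (X z) + φ z * Coord.divergence g X z := by
  rw [h.divergence_eq (X := X) (Y := fun k => of _ (hX k)) (fun _ _ => rfl) ⟨z, hz⟩,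
    h.divergence_eq (X := fun y => φ y • X y) (Y := of φ hφ • fun k => of _ (hX k))
    (fun _ _ => rfl) ⟨z, hz⟩, trace_covVec_smul, map_add, map_mul, map_sum, fderiv_apply_eq_sum]
  congr 1
  refine Finset.sum_congr rfl fun a _ => ?_
  rw [map_mul, mul_comm, pderiv_eq_ev h.isOpen (f := of φ hφ) (F := φ) (fun _ => rfl) a ⟨z, hz⟩]
  rfl

/-- The components of the Hessian of a function, as an endomorphism field. -/
def Coord.hessian (g : (Fin m → ℝ) → Matrix (Fin m) (Fin m) ℝ) (F : (Fin m → ℝ) → ℝ)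
    (z : Fin m → ℝ) : Matrix (Fin m) (Fin m) ℝ :=
  Matrix.of fun k a => pderiv a (fun y => grad g F y k) z
    + ∑ l, christoffel g k a l z * grad g F z l

/-- The vector field `∇_Y Y + J ∇_{J Y} Y` for `Y = grad F`. -/
def Coord.kahlerField (g J : (Fin m → ℝ) → Matrix (Fin m) (Fin m) ℝ) (F : (Fin m → ℝ) → ℝ)
    (z : Fin m → ℝ) : Fin m → ℝ :=
  hessian g F z *ᵥ grad g F z + (J z * hessian g F z * J z) *ᵥ grad g F z

theorem IsMetricOn.hessian_eq (h : IsMetricOn g O) {F : (Fin m → ℝ) → ℝ} {f : smoothFn O}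
    (hF : ∀ z : O, F z = ev z f) (z : O) :
    Coord.hessian g F z = (covVec (pd h.isOpen) h.conn (h.gr f)).map (ev z) := by
  ext k a
  have e : Coord.pderiv a (fun y => Coord.grad g F y k) z = _ :=
    pderiv_eq_ev h.isOpen (fun z => h.grad_eq hF k z) a z
  simp only [Coord.hessian, Matrix.of_apply, Matrix.map_apply, covVec, map_add, e,
    h.christoffel_eq, h.grad_eq hF, Matrix.mulVec, dotProduct, map_sum, map_mul]

theorem IsKahlerOn.kahlerField_eq (h : IsKahlerOn g J O) {F : (Fin m → ℝ) → ℝ} {f : smoothFn O}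
    (hF : ∀ z : O, F z = ev z f) (z : O) (k : Fin m) :
    Coord.kahlerField g J F z k = ev z (h.kfield f k) := by
  have e : Coord.grad g F z = fun l => ev z (h.gr f l) := funext fun l => h.grad_eq hF l z
  rw [IsKahlerOn.kfield, Pi.add_apply, map_add, ev_mulVec, ev_mulVec, Matrix.map_mul,
    Matrix.map_mul, Coord.kahlerField, Pi.add_apply, h.hessian_eq hF, e]
  rfl

end Chart

namespace OrbifoldAtlas

variable {m : ℕ} {M : Type*} [TopologicalSpace M] {ι : Type*} {A : OrbifoldAtlas ι m M}

/-- Chart domains are connected and their images open, so the function is locally constant on the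
connected space `M`. -/
theorem IsSmooth.exists_eq_const [ConnectedSpace M] {f : M → ℝ} (hf : A.IsSmooth f)
    (h : ∀ i, ∀ z ∈ (A.chart i).dom, fderiv ℝ (fun y => f ((A.chart i).proj y)) z = 0) :
    ∃ c, ∀ p, f p = c := by
  have hl : IsLocallyConstant f := by
    rw [IsLocallyConstant.iff_exists_open]
    intro p
    obtain ⟨i, z, hz, rfl⟩ := A.cover p
    refine ⟨_, OrbifoldChart.isOpen_range, ⟨z, hz, rfl⟩, ?_⟩
    rintro _ ⟨w, hw, rfl⟩
    exact (A.chart i).isOpen_dom.is_const_of_fderiv_eq_zero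
      (A.chart i).isConnected_dom.isPreconnected ((hf i).differentiableOn (by simp)) (h i) hw hz
  obtain ⟨p⟩ : Nonempty M := inferInstance
  exact ⟨f p, fun q => hl.apply_eq_of_preconnectedSpace q p⟩

theorem IsVectorField.smul {V : ι → (Fin m → ℝ) → (Fin m → ℝ)} (hV : A.IsVectorField V)
    {φ : M → ℝ} (hφ : A.IsSmooth φ) :
    A.IsVectorField fun i z => φ ((A.chart i).proj z) • V i z where
  smooth i k := (hφ i).mul (hV.smooth i k)
  natural i j h hl z hz := by
    rw [hV.natural i j h hl z hz, hl.proj_apply z hz, id, Matrix.mulVec_smul]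

/-- A Kähler structure on an orbifold. -/
structure IsKahler (A : OrbifoldAtlas ι m M) (g J : ι → (Fin m → ℝ) → Matrix (Fin m) (Fin m) ℝ) :
    Prop where
  form : A.IsFormField g
  endo : A.IsEndoField J
  chart : ∀ i, IsKahlerOn (g i) (J i) (A.chart i).dom

/-- The expression of a smooth function in a chart. -/
def IsSmooth.loc {f : M → ℝ} (hf : A.IsSmooth f) (i : ι) : smoothFn (A.chart i).dom := of _ (hf i)

variable {g J : ι → (Fin m → ℝ) → Matrix (Fin m) (Fin m) ℝ}

namespace IsKahler

variable (h : A.IsKahler g J) {f : M → ℝ} (hf : A.IsSmooth f)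
include h hf

theorem grad_eq (i : ι) (z : (A.chart i).dom) (k : Fin m) :
    Coord.grad (g i) (fun y => f ((A.chart i).proj y)) z k = ev z ((h.chart i).gr (hf.loc i) k) :=
  (h.chart i).grad_eq (f := hf.loc i) (fun _ => rfl) k z

theorem isVectorField_grad :
    A.IsVectorField fun i => Coord.grad (g i) (fun y => f ((A.chart i).proj y)) where
  smooth i k := contDiffOn_of_ev fun z => h.grad_eq hf i z k
  natural i j e hl z hz := by
    have hi := (h.chart i).toIsMetricOn.mono e.open_source hl.source_subset
    have hj := (h.chart j).toIsMetricOn.mono e.open_target hl.target_subset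
    have hfj : ContDiffOn ℝ ∞ (fun y => f ((A.chart j).proj y)) e.target :=
      (hf j).mono hl.target_subset
    ext k
    have e1 := hj.grad_eq (F := fun y => f ((A.chart j).proj y)) (f := of _ hfj) (fun _ => rfl) k
      ⟨e z, e.map_source hz⟩
    have e2 : ∀ l, Coord.grad (g i) (fun y => f ((A.chart i).proj y)) z l = _ := fun l =>
      hi.grad_eq (F := fun y => f ((A.chart i).proj y))
        (f := pullback e hl.contDiffOn (of _ hfj)) (fun y => by
          rw [ev_pullback, ev_of, hl.proj_apply y y.2, id]) l ⟨z, hz⟩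
    rw [e1, ev_gr_natural hl.contDiffOn hi hj (h.form.2 i j e hl) _ ⟨z, hz⟩ k, ← funext e2]

theorem isVectorField_ham :
    A.IsVectorField fun i z => J i z *ᵥ Coord.grad (g i) (fun y => f ((A.chart i).proj y)) z where
  smooth i k := contDiffOn_of_ev (f := (h.chart i).ham (hf.loc i) k) fun z => by
    rw [IsKahlerOn.ham, ev_mulVec, ← funext (h.grad_eq hf i z)]
    rfl
  natural i j e hl z hz := by
    rw [(h.isVectorField_grad hf).natural i j e hl z hz, Matrix.mulVec_mulVec,
      h.endo.2 i j e hl z hz, Matrix.mulVec_mulVec]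

theorem isVectorField_kahlerField :
    A.IsVectorField fun i => Coord.kahlerField (g i) (J i) (fun y => f ((A.chart i).proj y)) where
  smooth i k := contDiffOn_of_ev fun z =>
    (h.chart i).kahlerField_eq (F := fun y => f ((A.chart i).proj y)) (f := hf.loc i)
      (fun _ => rfl) z k
  natural i j e hl z hz := by
    have hi := (h.chart i).mono e.open_source hl.source_subset
    have hj := (h.chart j).mono e.open_target hl.target_subset
    have hfj : ContDiffOn ℝ ∞ (fun y => f ((A.chart j).proj y)) e.target :=
      (hf j).mono hl.target_subset
    ext k
    have e1 := hj.kahlerField_eq (F := fun y => f ((A.chart j).proj y)) (f := of _ hfj)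
      (fun _ => rfl) ⟨e z, e.map_source hz⟩ k
    have e2 : ∀ l, Coord.kahlerField (g i) (J i) (fun y => f ((A.chart i).proj y)) z l = _ :=
      fun l => hi.kahlerField_eq (F := fun y => f ((A.chart i).proj y))
        (f := pullback e hl.contDiffOn (of _ hfj)) (fun y => by
          rw [ev_pullback, ev_of, hl.proj_apply y y.2, id]) ⟨z, hz⟩ l
    rw [e1, ev_kfield_natural hl.contDiffOn (h.form.2 i j e hl) hi hj (h.endo.2 i j e hl) _
      ⟨z, hz⟩ k, ← funext e2]

theorem laplacian_eq (i : ι) (z : (A.chart i).dom) :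
    Coord.laplacian (g i) (fun y => f ((A.chart i).proj y)) z
      = - ev z ((h.chart i).hess (hf.loc i)).trace :=
  (h.chart i).laplacian_eq (f := hf.loc i) (fun _ => rfl) z

theorem exists_laplacian : ∃ L : M → ℝ, A.IsSmooth L ∧ ∀ i, ∀ z ∈ (A.chart i).dom,
    Coord.laplacian (g i) (fun y => f ((A.chart i).proj y)) z = L ((A.chart i).proj z) := by
  obtain ⟨L, hL⟩ := A.exists_function
    (fun i z => Coord.laplacian (g i) (fun y => f ((A.chart i).proj y)) z)
    fun i j e hl z hz => by
      simp only [Coord.laplacian]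
      rw [divergence_lift h.form (fun i => (h.chart i).posDef) (h.isVectorField_grad hf) hl hz]
  refine ⟨L, fun i => ?_, fun i z hz => (hL i z hz).symm⟩
  exact contDiffOn_of_ev (f := - ((h.chart i).hess (hf.loc i)).trace) fun z => by
    rw [hL i z z.2, h.laplacian_eq hf i z, map_neg]

theorem fderiv_grad (i : ι) {z : Fin m → ℝ} (hz : z ∈ (A.chart i).dom) (v : Fin m → ℝ) :
    fderiv ℝ (fun y => f ((A.chart i).proj y)) z v
      = Coord.grad (g i) (fun y => f ((A.chart i).proj y)) z ⬝ᵥ g i z *ᵥ v := by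
  have hsym : (g i z)ᵀ = g i z := by
    have := ((h.chart i).posDef z hz).isHermitian.eq
    rwa [Matrix.conjTranspose_eq_transpose_of_trivial] at this
  have e : g i z *ᵥ Coord.grad (g i) (fun y => f ((A.chart i).proj y)) z
      = fun k => Coord.pderiv k (fun y => f ((A.chart i).proj y)) z := by
    have : Coord.grad (g i) (fun y => f ((A.chart i).proj y)) z
        = (g i z)⁻¹ *ᵥ fun k => Coord.pderiv k (fun y => f ((A.chart i).proj y)) z := rfl
    rw [this, Matrix.mulVec_mulVec, Matrix.mul_nonsing_inv _ ((h.chart i).isUnit_det ⟨z, hz⟩),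
      Matrix.one_mulVec]
  rw [Matrix.dotProduct_mulVec, ← Matrix.mulVec_transpose, hsym, e, fderiv_apply_eq_sum]
  exact Finset.sum_congr rfl fun k _ => mul_comm _ _

theorem exists_eq_const_of_grad [ConnectedSpace M]
    (h0 : ∀ i, ∀ z ∈ (A.chart i).dom, Coord.grad (g i) (fun y => f ((A.chart i).proj y)) z = 0) :
    ∃ c, ∀ p, f p = c :=
  hf.exists_eq_const fun i z hz => by
    ext v
    rw [h.fderiv_grad hf i hz, h0 i z hz, zero_dotProduct]
    rfl

theorem divergence_eq_zero_of_nonneg [T2Space M] [CompactSpace M]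
    {V : ι → (Fin m → ℝ) → (Fin m → ℝ)} (hV : A.IsVectorField V)
    (h0 : ∀ i, ∀ z ∈ (A.chart i).dom, 0 ≤ Coord.divergence (g i) (V i) z) :
    ∀ i, ∀ z ∈ (A.chart i).dom, Coord.divergence (g i) (V i) z = 0 :=
  OrbifoldAtlas.divergence_eq_zero_of_nonneg h.form (fun i => (h.chart i).posDef) hV h0

end IsKahler

end OrbifoldAtlas

end

/-! ### Local diffeomorphisms and calculus along local flows. -/

section

open Set

/-- The inverse function theorem at `y`, restricted to the open set where the derivative is
invertible, so that the inverse is smooth on the whole target and not only near the image of `y`. -/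
theorem exists_local_diffeomorphism {m : ℕ} {f : (Fin m → ℝ) → (Fin m → ℝ)} {W : Set (Fin m → ℝ)}
    (hW : IsOpen W) (hf : ContDiffOn ℝ ∞ f W) {y : Fin m → ℝ} (hy : y ∈ W)
    (hd : (fderiv ℝ f y).det ≠ 0) : ∃ h : OpenPartialHomeomorph (Fin m → ℝ) (Fin m → ℝ),
      y ∈ h.source ∧ h.source ⊆ W ∧ (∀ z, h z = f z) ∧ ContDiffOn ℝ ∞ h h.source ∧
      ContDiffOn ℝ ∞ h.symm h.target := by
  have hdiff : ∀ z ∈ W, HasFDerivAt f (fderiv ℝ f z) z := fun z hz =>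
    ((hf.differentiableOn (by simp) z hz).differentiableAt (hW.mem_nhds hz)).hasFDerivAt
  have heq : ∀ z (h : (fderiv ℝ f z).det ≠ 0), z ∈ W →
      HasFDerivAt f ((fderiv ℝ f z).toContinuousLinearEquivOfDetNeZero h :
        (Fin m → ℝ) →L[ℝ] (Fin m → ℝ)) z := fun z h hz => by
    rw [ContinuousLinearMap.coe_toContinuousLinearEquivOfDetNeZero]
    exact hdiff z hz
  have hfa : ContDiffAt ℝ ∞ f y := hf.contDiffAt (hW.mem_nhds hy)
  let h0 := hfa.toOpenPartialHomeomorph f (heq y hd hy) (by simp)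
  have hV : IsOpen (W ∩ {z | (fderiv ℝ f z).det ≠ 0}) :=
    (ContinuousLinearMap.continuous_det.comp_continuousOn
      (hf.continuousOn_fderiv_of_isOpen hW (by simp))).isOpen_inter_preimage hW
      isOpen_compl_singleton
  refine ⟨h0.restrOpen _ hV, ⟨hfa.mem_toOpenPartialHomeomorph_source _ _, hy, hd⟩,
    fun z hz => hz.2.1, fun z => rfl, hf.mono fun z hz => hz.2.1, fun w hw => ?_⟩
  have hs := (h0.restrOpen _ hV).map_target hw
  refine ((h0.restrOpen _ hV).contDiffAt_symm hw (heq _ hs.2.2 hs.2.1) ?_).contDiffWithinAt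
  exact hf.contDiffAt (hW.mem_nhds hs.2.1)

section Flow

variable {n m : ℕ} {F : (Fin n → ℝ) × (Fin m → ℝ) → (Fin m → ℝ)}
  {O : Set ((Fin n → ℝ) × (Fin m → ℝ))} {X : (Fin n → ℝ) → (Fin m → ℝ) → (Fin m → ℝ)}
  {D : Set (Fin m → ℝ)}

/-- `F` is a smooth local flow of the vector fields `X b` on `D`, with `n` times. -/
structure IsLocalFlow (X : (Fin n → ℝ) → (Fin m → ℝ) → (Fin m → ℝ)) (D : Set (Fin m → ℝ))
    (F : (Fin n → ℝ) × (Fin m → ℝ) → (Fin m → ℝ)) (O : Set ((Fin n → ℝ) × (Fin m → ℝ))) :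
    Prop where
  isOpen_dom : IsOpen D
  smooth_field : ∀ b, ContDiffOn ℝ ∞ (X b) D
  isOpen : IsOpen O
  smooth : ContDiffOn ℝ ∞ F O
  map : ∀ q ∈ O, F q ∈ D
  deriv : ∀ q ∈ O, ∀ b, fderiv ℝ F q (b, 0) = X b (F q)

namespace IsLocalFlow

variable (h : IsLocalFlow X D F O) {q : (Fin n → ℝ) × (Fin m → ℝ)} (hq : q ∈ O)
include h hq

theorem hasFDerivAt : HasFDerivAt F (fderiv ℝ F q) q :=
  ((h.smooth.differentiableOn (by simp) q hq).differentiableAt (h.isOpen.mem_nhds hq)).hasFDerivAt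

theorem differentiableAt_fderiv : DifferentiableAt ℝ (fderiv ℝ F) q :=
  ((h.smooth.fderiv_of_isOpen h.isOpen (m := ∞) (by simp)).differentiableOn (by simp) q
    hq).differentiableAt (h.isOpen.mem_nhds hq)

theorem hasFDerivAt_field (b : Fin n → ℝ) : HasFDerivAt (X b) (fderiv ℝ (X b) (F q)) (F q) :=
  (((h.smooth_field b).differentiableOn (by simp) _ (h.map q hq)).differentiableAt
    (h.isOpen_dom.mem_nhds (h.map q hq))).hasFDerivAt

theorem second_deriv (b : Fin n → ℝ) (u : (Fin n → ℝ) × (Fin m → ℝ)) :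
    fderiv ℝ (fderiv ℝ F) q u (b, 0) = fderiv ℝ (X b) (F q) (fderiv ℝ F q u) := by
  have h1 : HasFDerivAt (fun q => fderiv ℝ F q (b, 0))
      ((fderiv ℝ (X b) (F q)).comp (fderiv ℝ F q)) q := by
    refine ((h.hasFDerivAt_field hq b).comp q (h.hasFDerivAt hq)).congr_of_eventuallyEq ?_
    filter_upwards [h.isOpen.mem_nhds hq] with q' hq'
    exact h.deriv q' hq' b
  have h2 := (h.differentiableAt_fderiv hq).hasFDerivAt.clm_apply
    (hasFDerivAt_const (b, (0 : Fin m → ℝ)) q)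
  have := congrArg (fun L => L u) (h2.unique h1)
  simpa using this

theorem second_deriv_symm (u v : (Fin n → ℝ) × (Fin m → ℝ)) :
    fderiv ℝ (fderiv ℝ F) q u v = fderiv ℝ (fderiv ℝ F) q v u :=
  (h.smooth.contDiffAt (h.isOpen.mem_nhds hq)).isSymmSndFDerivAt (by simp; exact WithTop.coe_le_coe.2 le_top) u v

/-- The second derivative of the flow in two time directions is symmetric, and each order computes
the derivative of one field along the other. -/
theorem commute (a b : Fin n → ℝ) :
    fderiv ℝ (X b) (F q) (X a (F q)) = fderiv ℝ (X a) (F q) (X b (F q)) := by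
  rw [← h.deriv q hq, ← h.deriv q hq, ← h.second_deriv hq, ← h.second_deriv hq,
    h.second_deriv_symm hq]

-- Invariance of the metric differentiated at time 0. The map `F (0, ·)` is not assumed to be the
-- identity, hence the evaluation at `F (0, z)` and the condition `hd`, which makes every `ξ` and
-- `η` an image of its derivative.
omit hq in
theorem lie_metric_eq_zero {g : (Fin m → ℝ) → Matrix (Fin m) (Fin m) ℝ} (hg : IsMetricOn g D)
    {z : Fin m → ℝ} (hz : (0, z) ∈ O) (b : Fin n → ℝ)
    (hd : (fderiv ℝ (fun y => F (0, y)) z).det ≠ 0)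
    (hinv : ∀ᶠ s in 𝓝 (0 : ℝ), ∀ u v, fderiv ℝ F (s • b, z) (0, u) ⬝ᵥ
      g (F (s • b, z)) *ᵥ fderiv ℝ F (s • b, z) (0, v) = u ⬝ᵥ g z *ᵥ v) (ξ η : Fin m → ℝ) :
    fderiv ℝ (X b) (F (0, z)) ξ ⬝ᵥ g (F (0, z)) *ᵥ η
      + ξ ⬝ᵥ (Matrix.of fun k l => fderiv ℝ (fun y => g y k l) (F (0, z)) (X b (F (0, z)))) *ᵥ η
      + ξ ⬝ᵥ g (F (0, z)) *ᵥ fderiv ℝ (X b) (F (0, z)) η = 0 := by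
  have hpart : HasFDerivAt (fun y => F (0, y))
      ((fderiv ℝ F (0, z)).comp (ContinuousLinearMap.inr ℝ (Fin n → ℝ) (Fin m → ℝ))) z :=
    (h.hasFDerivAt hz).comp z (hasFDerivAt_prodMk_right 0 z)
  have hsurj : ∀ ξ, ∃ u, fderiv ℝ F (0, z) (0, u) = ξ := fun ξ => by
    refine ⟨((fderiv ℝ (fun y => F (0, y)) z).toContinuousLinearEquivOfDetNeZero hd).symm ξ, ?_⟩
    have := ((fderiv ℝ (fun y => F (0, y)) z).toContinuousLinearEquivOfDetNeZero
      hd).apply_symm_apply ξ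
    rw [ContinuousLinearMap.toContinuousLinearEquivOfDetNeZero_apply] at this
    exact (congrArg (fun L : (Fin m → ℝ) →L[ℝ] (Fin m → ℝ) => L _) hpart.fderiv).symm.trans this
  obtain ⟨u, rfl⟩ := hsurj ξ
  obtain ⟨v, rfl⟩ := hsurj η
  have hpath : HasDerivAt (fun s : ℝ => (s • b, z)) (b, (0 : Fin m → ℝ)) 0 := by
    have h1 : HasDerivAt (fun s : ℝ => s • b) b 0 := by
      simpa using (hasDerivAt_id (0 : ℝ)).smul_const b
    exact h1.prodMk (hasDerivAt_const _ _)
  have hz' : ((0 : ℝ) • b, z) ∈ O := by rwa [zero_smul]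
  have hF : HasDerivAt (fun s : ℝ => F (s • b, z)) (X b (F (0, z))) 0 := by
    have := (h.hasFDerivAt hz').comp_hasDerivAt (0 : ℝ) hpath
    rwa [h.deriv _ hz', zero_smul] at this
  have hξ : ∀ u : Fin m → ℝ, HasDerivAt (fun s : ℝ => fderiv ℝ F (s • b, z) (0, u))
      (fderiv ℝ (X b) (F (0, z)) (fderiv ℝ F (0, z) (0, u))) 0 := fun u => by
    have h1 : HasFDerivAt (fun q => fderiv ℝ F q ((0 : Fin n → ℝ), u)) _ ((0 : ℝ) • b, z) :=
      (h.differentiableAt_fderiv hz').hasFDerivAt.clm_apply (hasFDerivAt_const _ _)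
    have h2 := h1.comp_hasDerivAt (0 : ℝ) hpath
    refine h2.congr_deriv ?_
    have h3 := h.second_deriv hz b (0, u)
    rw [h.second_deriv_symm hz] at h3
    rw [← h3]
    simp
  have hg' : ∀ k l, HasDerivAt (fun s : ℝ => g (F (s • b, z)) k l)
      (fderiv ℝ (fun y => g y k l) (F (0, z)) (X b (F (0, z)))) 0 := fun k l => by
    have h1 : HasFDerivAt (fun y => g y k l) (fderiv ℝ (fun y => g y k l) (F (0, z)))
        (F ((0 : ℝ) • b, z)) := by
      rw [zero_smul]
      exact (((hg.smooth k l).differentiableOn (by simp) _ (h.map _ hz)).differentiableAt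
        (h.isOpen_dom.mem_nhds (h.map _ hz))).hasFDerivAt
    exact h1.comp_hasDerivAt (0 : ℝ) hF
  have htot := HasDerivAt.fun_sum (u := Finset.univ) fun k _ =>
    ((hasDerivAt_pi.1 (hξ u)) k).mul (HasDerivAt.fun_sum (u := Finset.univ) fun l _ =>
      (hg' k l).mul ((hasDerivAt_pi.1 (hξ v)) l))
  have hzero := htot.unique ((hasDerivAt_const (0 : ℝ) (u ⬝ᵥ g z *ᵥ v)).congr_of_eventuallyEq
    (by filter_upwards [hinv] with s hs using hs u v))
  rw [← hzero]
  simp only [Pi.mul_apply, zero_smul, dotProduct, Matrix.mulVec, Matrix.of_apply, ← Finset.sum_add_distrib,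
    Finset.mul_sum]
  exact Finset.sum_congr rfl fun k _ => Finset.sum_congr rfl fun l _ => by ring

end IsLocalFlow

end Flow

end

/-! ### Action fields of the torus and their local flows in charts. -/

section

open Set DiffAlg smoothFn

theorem Torus.exp_add {n : ℕ} (a b : Fin n → ℝ) :
    Torus.exp (a + b) = Torus.exp a + Torus.exp b := by
  ext k
  simp [Torus.exp]

theorem Torus.exp_zero {n : ℕ} : Torus.exp (0 : Fin n → ℝ) = 0 := by
  ext k
  simp [Torus.exp]

theorem OrbifoldChart.det_fderiv_act_ne_zero {m : ℕ} {M : Type*} [TopologicalSpace M]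
    {c : OrbifoldChart m M} {γ : Equiv.Perm c.dom} (hγ : γ ∈ c.group) {z : Fin m → ℝ}
    (hz : z ∈ c.dom) : (fderiv ℝ (c.act γ) z).det ≠ 0 := by
  have h1 := (differentiableAt_act (inv_mem hγ) (act_mem γ hz)).hasFDerivAt.comp z
    (differentiableAt_act hγ hz).hasFDerivAt
  have h2 : c.act γ⁻¹ ∘ c.act γ =ᶠ[𝓝 z] id := by
    filter_upwards [c.isOpen_dom.mem_nhds hz] with y hy using act_inv_act γ hy
  have h3 := h1.unique ((hasFDerivAt_id z).congr_of_eventuallyEq h2)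
  intro h0
  have h4 : ((fderiv ℝ (c.act γ⁻¹) (c.act γ z)).comp (fderiv ℝ (c.act γ) z)).det = 1 := by
    rw [h3]; exact LinearMap.det_id
  have h5 : ((fderiv ℝ (c.act γ⁻¹) (c.act γ z)).comp (fderiv ℝ (c.act γ) z)).det
      = (fderiv ℝ (c.act γ⁻¹) (c.act γ z)).det * (fderiv ℝ (c.act γ) z).det :=
    LinearMap.det_comp _ _
  rw [h5, h0, mul_zero] at h4
  exact zero_ne_one h4

namespace SymplecticTorusOrbifold

open OrbifoldChart OrbifoldAtlas

variable {ι : Type*} {n : ℕ} {M : Type*} [TopologicalSpace M] [AddAction (Torus n) M]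
  {S : SymplecticTorusOrbifold ι n M} {x : M → Module.Dual ℝ (Fin n → ℝ)}

namespace ToricKahler

variable (K : S.ToricKahler)

theorem isKahler : S.atlas.IsKahler K.g K.J where
  form := K.form_g
  endo := K.endo_J
  chart i :=
    { isOpen := (S.atlas.chart i).isOpen_dom
      smooth := K.form_g.1 i
      posDef := K.posDef_g i
      smoothJ := K.endo_J.1 i
      J_mul_J := K.J_mul_J i
      skew := fun z hz => by
        rw [← K.compatible i z hz, S.alternating_omega i z hz]
      nij := K.integrable_J i
      closed := fun z hz a b c => by
        have e : ∀ a b c, Coord.pderiv a (fun y => ((K.J i y)ᵀ * K.g i y) b c) z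
            = Coord.pderiv a (fun y => S.omega i y b c) z := fun a b c =>
          Coord.pderiv_congr (S.atlas.chart i).isOpen_dom
            (fun y hy => by rw [K.compatible i y hy]) hz a
        rw [← S.closed_omega i z hz a b c]
        simp only [Coord.extDeriv₂, e] }

/-- The vector field `J grad ⟨x, b⟩` in a chart. -/
def actionField (x : M → Module.Dual ℝ (Fin n → ℝ)) (i : ι) (b : Fin n → ℝ)
    (z : Fin (2 * n) → ℝ) : Fin (2 * n) → ℝ :=
  K.J i z *ᵥ Coord.grad (K.g i) (fun y => x ((S.atlas.chart i).proj y) b) z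

variable (hx : S.IsMomentMap x)
include hx

/-- With `ω = g(J ·, ·)` the moment map equation says that `grad ⟨x, b⟩ + J v` is orthogonal to
every vector, so it is zero; applying `J` gives `v`. -/
theorem eq_actionField {i : ι} {z : Fin (2 * n) → ℝ} (hz : z ∈ (S.atlas.chart i).dom)
    {b : Fin n → ℝ} {v : Fin (2 * n) → ℝ} (hv : S.atlas.IsActionVector b i z v) :
    v = K.actionField x i b z := by
  have e : ∀ w, (Coord.grad (K.g i) (fun y => x ((S.atlas.chart i).proj y) b) z + K.J i z *ᵥ v)
      ⬝ᵥ K.g i z *ᵥ w = 0 := fun w => by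
    have h1 := hx.hamiltonian b i z hz v hv w
    rw [K.isKahler.fderiv_grad (hx.smooth b) i hz, K.compatible i z hz, ← Matrix.mulVec_mulVec,
      Matrix.dotProduct_mulVec v, Matrix.vecMul_transpose] at h1
    rw [add_dotProduct, ← h1]
    ring
  have hG := K.posDef_g i z hz
  have h0 : Coord.grad (K.g i) (fun y => x ((S.atlas.chart i).proj y) b) z + K.J i z *ᵥ v = 0 := by
    by_contra hne
    have := hG.dotProduct_mulVec_pos hne
    rw [star_trivial, e] at this
    exact lt_irrefl _ this
  rw [actionField, eq_neg_of_add_eq_zero_left h0, Matrix.mulVec_neg, Matrix.mulVec_mulVec,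
    K.J_mul_J i z hz, Matrix.neg_mulVec, neg_neg, Matrix.one_mulVec]

theorem isVectorField_actionField (b : Fin n → ℝ) :
    S.atlas.IsVectorField fun i => K.actionField x i b := by
  have h := K.isKahler.isVectorField_ham (hx.smooth b)
  exact ⟨h.smooth, h.natural⟩

/-- A smooth lift of the action near the identity of the torus. Its time derivatives are velocities
of lifted orbits, hence values of the action fields. -/
theorem exists_flow {i : ι} {z : Fin (2 * n) → ℝ} (hz : z ∈ (S.atlas.chart i).dom) :
    ∃ F O, IsLocalFlow (K.actionField x i) (S.atlas.chart i).dom F O ∧ (0, z) ∈ O ∧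
      F (0, z) = z ∧ ∀ q ∈ O, q.2 ∈ (S.atlas.chart i).dom ∧
        (S.atlas.chart i).proj (F q) = Torus.exp q.1 +ᵥ (S.atlas.chart i).proj q.2 := by
  obtain ⟨F, O, hO, hzO, hF, hFz, h⟩ := S.smooth_action 0 i i z hz z hz (by
    rw [Torus.exp_zero, zero_vadd])
  refine ⟨F, O, ⟨(S.atlas.chart i).isOpen_dom,
    fun b => contDiffOn_pi.2 ((K.isVectorField_actionField hx b).smooth i), hO, hF,
    fun q hq => (h q hq).2.1, fun q hq b => K.eq_actionField hx (h q hq).2.1 ?_⟩, hzO, hFz,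
    fun q hq => ⟨(h q hq).1, (h q hq).2.2⟩⟩
  have hpath : HasDerivAt (fun s : ℝ => (q.1 + s • b, q.2)) (b, (0 : Fin (2 * n) → ℝ)) 0 := by
    have h1 : HasDerivAt (fun s : ℝ => q.1 + s • b) b 0 := by
      simpa using ((hasDerivAt_id (0 : ℝ)).smul_const b).const_add q.1
    exact h1.prodMk (hasDerivAt_const _ _)
  have h0 : (q.1 + (0 : ℝ) • b, q.2) = q := by simp
  have hFq : HasFDerivAt F (fderiv ℝ F q) (q.1 + (0 : ℝ) • b, q.2) := by
    rw [h0]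
    exact ((hF.differentiableOn (by simp) q hq).differentiableAt (hO.mem_nhds hq)).hasFDerivAt
  refine ⟨fun s => F (q.1 + s • b, q.2), by simp only [h0], hFq.comp_hasDerivAt (0 : ℝ) hpath, ?_⟩
  have hmem : ∀ᶠ s in 𝓝 (0 : ℝ), (q.1 + s • b, q.2) ∈ O := by
    refine hpath.continuousAt.eventually (hO.mem_nhds ?_)
    simpa only [h0] using hq
  filter_upwards [hmem] with s hs
  refine ⟨(h _ hs).2.1, ?_⟩
  rw [(h _ hs).2.2, (h q hq).2.2, add_comm, Torus.exp_add, add_vadd]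

-- The lift `F (0, ·)` covers the identity of `M`, so pointwise it agrees with elements of the
-- finite local group, possibly different ones at different points. By Baire's theorem it coincides
-- with a single element near points arbitrarily close to `z`, and there its derivative is
-- invertible.
omit hx in
theorem exists_regular {i : ι} {z : Fin (2 * n) → ℝ}
    {F : (Fin n → ℝ) × (Fin (2 * n) → ℝ) → (Fin (2 * n) → ℝ)}
    {O : Set ((Fin n → ℝ) × (Fin (2 * n) → ℝ))}
    (hfl : IsLocalFlow (K.actionField x i) (S.atlas.chart i).dom F O) (hzO : (0, z) ∈ O)
    (hp : ∀ q ∈ O, q.2 ∈ (S.atlas.chart i).dom ∧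
        (S.atlas.chart i).proj (F q) = Torus.exp q.1 +ᵥ (S.atlas.chart i).proj q.2)
    {N : Set (Fin (2 * n) → ℝ)} (hN : N ∈ 𝓝 (F (0, z))) :
    ∃ z', (0, z') ∈ O ∧ (fderiv ℝ (fun y => F (0, y)) z').det ≠ 0 ∧ F (0, z') ∈ N := by
  have hc : Continuous fun y : Fin (2 * n) → ℝ => ((0 : Fin n → ℝ), y) := by fun_prop
  have hnhds : {y | (0, y) ∈ O ∧ F (0, y) ∈ N} ∈ 𝓝 z := by
    refine Filter.inter_mem (hc.continuousAt.preimage_mem_nhds (hfl.isOpen.mem_nhds hzO)) ?_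
    have : ContinuousAt (fun y => F (0, y)) z :=
      ContinuousAt.comp (f := fun y => ((0 : Fin n → ℝ), y)) (x := z)
        (hfl.hasFDerivAt hzO).continuousAt hc.continuousAt
    exact this.preimage_mem_nhds hN
  obtain ⟨r, hr, hball⟩ := Metric.nhds_basis_closedBall.mem_iff.1 hnhds
  have : Finite (S.atlas.chart i).group := (S.atlas.chart i).finite_group
  have : Countable (S.atlas.chart i).group := Finite.to_countable
  -- The index `none` adds the complement of the ball, so that the closed sets cover the whole
  -- space.
  let f : Option (S.atlas.chart i).group → Set (Fin (2 * n) → ℝ)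
    | none => (Metric.ball z r)ᶜ
    | some γ => Metric.closedBall z r ∩
        (fun y => F (0, y) - (S.atlas.chart i).act γ y) ⁻¹' {0}
  have hf : ∀ o, IsClosed (f o) := by
    rintro (_ | γ)
    · exact Metric.isOpen_ball.isClosed_compl
    · refine ContinuousOn.preimage_isClosed_of_isClosed ?_ Metric.isClosed_closedBall
        isClosed_singleton
      refine ContinuousOn.sub ?_ ((contDiffOn_act γ.2).continuousOn.mono fun y hy =>
        (hp _ (hball hy).1).1)
      exact hfl.smooth.continuousOn.comp hc.continuousOn fun y hy => (hball hy).1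
  have hU : ⋃ o, f o = univ := by
    refine eq_univ_of_forall fun y => ?_
    by_cases hy : y ∈ Metric.ball z r
    · have hy' := Metric.ball_subset_closedBall hy
      obtain ⟨h1, h2⟩ := hp _ (hball hy').1
      rw [Torus.exp_zero, zero_vadd] at h2
      obtain ⟨γ, hγ, e⟩ := exists_act_eq h1 (hfl.map _ (hball hy').1) h2.symm
      exact mem_iUnion.2 ⟨some ⟨γ, hγ⟩, hy', by simp [e]⟩
    · exact mem_iUnion.2 ⟨none, hy⟩
  obtain ⟨y, hyb, hy⟩ := (dense_iUnion_interior_of_closed hf hU).inter_open_nonempty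
    (Metric.ball z r) Metric.isOpen_ball ⟨z, Metric.mem_ball_self hr⟩
  obtain ⟨o, ho⟩ := mem_iUnion.1 hy
  rcases o with _ | γ
  · exact absurd hyb (interior_subset ho)
  · have hyc := hball (Metric.ball_subset_closedBall hyb)
    refine ⟨y, hyc.1, ?_, hyc.2⟩
    have he : (fun y => F (0, y)) =ᶠ[𝓝 y] (S.atlas.chart i).act γ := by
      filter_upwards [mem_interior_iff_mem_nhds.1 ho] with y' hy'
      exact sub_eq_zero.1 hy'.2
    rw [he.fderiv_eq]
    exact det_fderiv_act_ne_zero γ.2 (hp _ hyc.1).1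

-- For small `s` the map `F (s • b, ·)` still has invertible derivative at `z`, so it restricts to a
-- local lift of a torus element, to which the invariance of `g` applies.
omit hx in
theorem flow_preserves_metric {i : ι} {z : Fin (2 * n) → ℝ}
    {F : (Fin n → ℝ) × (Fin (2 * n) → ℝ) → (Fin (2 * n) → ℝ)}
    {O : Set ((Fin n → ℝ) × (Fin (2 * n) → ℝ))}
    (hfl : IsLocalFlow (K.actionField x i) (S.atlas.chart i).dom F O) (hzO : (0, z) ∈ O)
    (hp : ∀ q ∈ O, q.2 ∈ (S.atlas.chart i).dom ∧
        (S.atlas.chart i).proj (F q) = Torus.exp q.1 +ᵥ (S.atlas.chart i).proj q.2)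
    (hd : (fderiv ℝ (fun y => F (0, y)) z).det ≠ 0) (b : Fin n → ℝ) :
    ∀ᶠ s in 𝓝 (0 : ℝ), ∀ u v, fderiv ℝ F (s • b, z) (0, u) ⬝ᵥ
      K.g i (F (s • b, z)) *ᵥ fderiv ℝ F (s • b, z) (0, v) = u ⬝ᵥ K.g i z *ᵥ v := by
  have hpath : Continuous fun s : ℝ => (s • b, z) := by fun_prop
  have hmem : ∀ᶠ s in 𝓝 (0 : ℝ), (s • b, z) ∈ O := by
    refine hpath.continuousAt.eventually (hfl.isOpen.mem_nhds ?_)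
    simpa only [zero_smul] using hzO
  have hpart : ∀ a, (a, z) ∈ O → HasFDerivAt (fun y => F (a, y))
      ((fderiv ℝ F (a, z)).comp (ContinuousLinearMap.inr ℝ (Fin n → ℝ) (Fin (2 * n) → ℝ))) z :=
    fun a ha => (hfl.hasFDerivAt ha).comp z (hasFDerivAt_prodMk_right a z)
  have hdet : ∀ᶠ s in 𝓝 (0 : ℝ), ((fderiv ℝ F (s • b, z)).comp
      (ContinuousLinearMap.inr ℝ (Fin n → ℝ) (Fin (2 * n) → ℝ))).det ≠ 0 := by
    have h1 : ContinuousAt (fderiv ℝ F) ((0 : ℝ) • b, z) := by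
      rw [zero_smul]; exact (hfl.differentiableAt_fderiv hzO).continuousAt
    have h2 : ContinuousAt (fun s : ℝ => fderiv ℝ F (s • b, z)) 0 :=
      ContinuousAt.comp (f := fun s : ℝ => (s • b, z)) (x := 0) h1 hpath.continuousAt
    have h3 : ContinuousAt (fun s : ℝ => ((fderiv ℝ F (s • b, z)).comp
      (ContinuousLinearMap.inr ℝ (Fin n → ℝ) (Fin (2 * n) → ℝ))).det) 0 :=
      ContinuousLinearMap.continuous_det.continuousAt.comp (h2.clm_comp continuousAt_const)
    refine h3.eventually_ne ?_
    rw [zero_smul, ← (hpart 0 hzO).fderiv]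
    exact hd
  filter_upwards [hmem, hdet] with s hs hds u v
  have hc : Continuous fun y : Fin (2 * n) → ℝ => (s • b, y) := by fun_prop
  rw [← (hpart _ hs).fderiv] at hds
  obtain ⟨h, hzh, hW, he, hh, hhs⟩ := exists_local_diffeomorphism
    (f := fun y => F (s • b, y)) (hfl.isOpen.preimage hc)
    (hfl.smooth.comp (contDiff_prodMk_right _).contDiffOn fun y hy => hy) hs hds
  have hl : IsLocalLift (fun p => Torus.exp (s • b) +ᵥ p) (S.atlas.chart i) (S.atlas.chart i) h :=
    { source_subset := fun y hy => (hp _ (hW hy)).1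
      target_subset := fun w hw => by
        have := h.map_target hw
        rw [← h.right_inv hw, he]
        exact hfl.map _ (hW this)
      contDiffOn := hh
      contDiffOn_symm := hhs
      proj_apply := fun y hy => by rw [he]; exact (hp _ (hW hy)).2 }
  have key := K.invariant_g _ i i h hl z hzh
  have hj : ∀ u, fderiv ℝ F (s • b, z) (0, u) = Coord.jacobian h z *ᵥ u := fun u => by
    rw [jacobian_mulVec hh hzh, show (h : (Fin (2 * n) → ℝ) → _) = fun y => F (s • b, y) from
      funext he, (hpart _ hs).fderiv]
    rfl
  rw [hj, hj, ← key, he, Matrix.mulVec_mulVec, ← Matrix.vecMul_transpose,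
    ← Matrix.dotProduct_mulVec, Matrix.mulVec_mulVec, ← Matrix.mul_assoc]

end ToricKahler

end SymplecticTorusOrbifold

end

/-! ### Action fields are commuting Killing fields, and torus orbits are isotropic. -/

section

open Set DiffAlg smoothFn

section Chart

variable {m : ℕ}

theorem fderiv_apply_component {X : (Fin m → ℝ) → (Fin m → ℝ)} {z : Fin m → ℝ}
    (hd : DifferentiableAt ℝ X z) (v : Fin m → ℝ) (k : Fin m) :
    fderiv ℝ X z v k = fderiv ℝ (fun y => X y k) z v := by
  have : fderiv ℝ (fun y => X y k) z = (ContinuousLinearMap.proj k).comp (fderiv ℝ X z) :=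
    ((ContinuousLinearMap.proj (R := ℝ) (φ := fun _ : Fin m => ℝ) k).hasFDerivAt.comp z
      hd.hasFDerivAt).fderiv
  rw [this]
  rfl

theorem IsMetricOn.ev_lieMetric {g : (Fin m → ℝ) → Matrix (Fin m) (Fin m) ℝ} {O : Set (Fin m → ℝ)}
    (h : IsMetricOn g O) {X : (Fin m → ℝ) → (Fin m → ℝ)} {Y : Fin m → smoothFn O}
    (hX : ∀ (z : O) k, X z k = ev z (Y k)) (z : O) (a c : Fin m) :
    ev z (lieMetric (pd h.isOpen) h.met Y a c)
      = fderiv ℝ X z (Pi.single a 1) ⬝ᵥ g z *ᵥ Pi.single c 1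
        + Pi.single a 1 ⬝ᵥ (Matrix.of fun k l => fderiv ℝ (fun y => g y k l) z (X z))
          *ᵥ Pi.single c 1
        + Pi.single a 1 ⬝ᵥ g z *ᵥ fderiv ℝ X z (Pi.single c 1) := by
  have hd : DifferentiableAt ℝ X z := by
    refine differentiableAt_pi.2 fun k => ?_
    exact ((contDiffOn_of_ev fun z => hX z k).differentiableOn (by simp) z
      z.2).differentiableAt (h.isOpen.mem_nhds z.2)
  have e1 : ∀ a k, fderiv ℝ X z (Pi.single a 1) k = ev z (pd h.isOpen a (Y k)) := fun a k => by
    rw [fderiv_apply_component hd]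
    exact pderiv_eq_ev h.isOpen (fun z => hX z k) a z
  have e2 : fderiv ℝ (fun y => g y a c) z (X z)
      = ∑ e, ev z (Y e) * ev z (pd h.isOpen e (h.met a c)) := by
    rw [fderiv_apply_eq_sum]
    refine Finset.sum_congr rfl fun e _ => ?_
    rw [hX, pderiv_eq_ev h.isOpen (F := fun y => g y a c) (f := h.met a c) (fun _ => rfl) e z]
  rw [Matrix.mulVec_single_one, Matrix.mulVec_single_one, single_one_dotProduct,
    single_one_dotProduct, Matrix.col_apply, Matrix.of_apply, e2]
  simp only [lieMetric, Matrix.add_apply, Matrix.sum_apply, Matrix.smul_apply, Matrix.map_apply,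
    Matrix.mul_apply, Matrix.transpose_apply, Matrix.of_apply, map_add, map_sum, map_mul,
    smul_eq_mul, dotProduct, Matrix.mulVec, e1, Matrix.col_apply]
  have e3 : ∀ a c, ev z (h.met a c) = g z a c := fun _ _ => rfl
  simp only [e3]
  ring

end Chart

namespace SymplecticTorusOrbifold

open OrbifoldChart OrbifoldAtlas

variable {ι : Type*} {n : ℕ} {M : Type*} [TopologicalSpace M] [AddAction (Torus n) M]
  {S : SymplecticTorusOrbifold ι n M} {x : M → Module.Dual ℝ (Fin n → ℝ)}

namespace ToricKahler

variable (K : S.ToricKahler) (hx : S.IsMomentMap x)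
include hx

theorem actionField_eq (i : ι) (b : Fin n → ℝ) (z : (S.atlas.chart i).dom) (k : Fin (2 * n)) :
    K.actionField x i b z k = ev z ((K.isKahler.chart i).ham ((hx.smooth b).loc i) k) := by
  rw [IsKahlerOn.ham, ev_mulVec, ← funext (K.isKahler.grad_eq (hx.smooth b) i z)]
  rfl

/-- Differentiating the flow yields the Killing equation only at images of regular points. By
`exists_regular` these come arbitrarily close to any given point, and continuity does the rest. -/
theorem isKillingPotential (i : ι) (b : Fin n → ℝ) :
    (K.isKahler.chart i).IsKillingPotential ((hx.smooth b).loc i) := by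
  refine Matrix.ext fun a c => ev_injective fun z => ?_
  rw [Matrix.zero_apply, map_zero]
  set f := lieMetric (pd (K.isKahler.chart i).isOpen) (K.isKahler.chart i).met
    ((K.isKahler.chart i).ham ((hx.smooth b).loc i)) a c with hf
  by_contra hne
  obtain ⟨F, O, hfl, hzO, hFz, hp⟩ := K.exists_flow hx z.2
  have hN : {w | rep f w ≠ 0} ∈ 𝓝 (F (0, (z : Fin (2 * n) → ℝ))) := by
    rw [hFz]
    refine (differentiableAt_rep (K.isKahler.chart i).isOpen f z).continuousAt.eventually_ne ?_
    rwa [rep_apply]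
  obtain ⟨z', hz'O, hd, hw⟩ := K.exists_regular hfl hzO hp hN
  have hwd := hfl.map _ hz'O
  refine hw ?_
  have e1 : rep f (F (0, z')) = ev ⟨F (0, z'), hwd⟩ f := rep_apply f ⟨_, hwd⟩
  rw [e1, hf, (K.isKahler.chart i).ev_lieMetric (X := K.actionField x i b)
    (fun z k => K.actionField_eq hx i b z k)]
  exact hfl.lie_metric_eq_zero (K.isKahler.chart i).toIsMetricOn hz'O b hd
    (K.flow_preserves_metric hfl hz'O hp hd b) _ _

theorem bracket_eq_zero (i : ι) (a b : Fin n → ℝ) (k : Fin (2 * n)) :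
    ∑ c, ((K.isKahler.chart i).ham ((hx.smooth a).loc i) c
        * pd (K.isKahler.chart i).isOpen c ((K.isKahler.chart i).ham ((hx.smooth b).loc i) k)
      - (K.isKahler.chart i).ham ((hx.smooth b).loc i) c
        * pd (K.isKahler.chart i).isOpen c ((K.isKahler.chart i).ham ((hx.smooth a).loc i) k))
      = 0 := by
  refine ev_injective fun z => ?_
  obtain ⟨F, O, hfl, hzO, hFz, hp⟩ := K.exists_flow hx z.2
  have e := congrFun (hfl.commute hzO a b) k
  have e1 : ∀ a b, fderiv ℝ (K.actionField x i b) z (K.actionField x i a z) k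
      = ∑ c, ev z ((K.isKahler.chart i).ham ((hx.smooth a).loc i) c) * ev z (pd
        (K.isKahler.chart i).isOpen c ((K.isKahler.chart i).ham ((hx.smooth b).loc i) k)) := by
    intro a b
    have hd : DifferentiableAt ℝ (K.actionField x i b) z := by
      have := (hfl.hasFDerivAt_field hzO b).differentiableAt
      rwa [hFz] at this
    rw [fderiv_apply_component hd, fderiv_apply_eq_sum]
    refine Finset.sum_congr rfl fun c _ => ?_
    rw [K.actionField_eq hx i a z c, pderiv_eq_ev (K.isKahler.chart i).isOpen
      (fun z => K.actionField_eq hx i b z k) c z]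
  rw [hFz, e1, e1] at e
  simp only [map_sum, map_sub, map_mul, Finset.sum_sub_distrib, map_zero, e, sub_self]

/-- The orbits of the torus are isotropic. -/
theorem fderiv_actionField [CompactSpace M] [ConnectedSpace M] (a b : Fin n → ℝ) (i : ι)
    {z : Fin (2 * n) → ℝ} (hz : z ∈ (S.atlas.chart i).dom) :
    fderiv ℝ (fun y => x ((S.atlas.chart i).proj y) b) z (K.actionField x i a z) = 0 := by
  -- `E` is the derivative of `⟨x, b⟩` along `X_a`, a Poisson bracket up to sign; it is constant by
  -- `pd_pairing` and connectedness.
  obtain ⟨E, -, hE⟩ := (K.isVectorField_actionField hx a).exists_derivative (hx.smooth b)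
  have hEev : ∀ i, ∀ z : (S.atlas.chart i).dom, E ((S.atlas.chart i).proj z)
      = ev z ((K.isKahler.chart i).gr ((hx.smooth b).loc i) ⬝ᵥ (K.isKahler.chart i).met *ᵥ
        (K.isKahler.chart i).ham ((hx.smooth a).loc i)) := fun i z => by
    rw [hE i z z.2, K.isKahler.fderiv_grad (hx.smooth b) i z.2, IsMetricOn.ev_metric,
      funext (K.isKahler.grad_eq (hx.smooth b) i z), funext (K.actionField_eq hx i a z)]
  obtain ⟨c, hc⟩ := IsSmooth.exists_eq_const (A := S.atlas) (f := E)
    (fun i => contDiffOn_of_ev (hEev i)) fun i z hz => by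
      ext v
      rw [fderiv_apply_eq_sum]
      refine Finset.sum_eq_zero fun k _ => ?_
      rw [pderiv_eq_ev (K.isKahler.chart i).isOpen (hEev i) k ⟨z, hz⟩,
        (K.isKahler.chart i).pd_pairing (K.isKillingPotential hx i a)
          (K.bracket_eq_zero hx i b a), map_zero, mul_zero]
  -- The constant is evaluated at a maximum of `⟨x, b⟩`, where the differential vanishes.
  obtain ⟨p, -, hp⟩ := isCompact_univ.exists_isMaxOn univ_nonempty
    (IsSmooth.continuous (hx.smooth b)).continuousOn
  obtain ⟨j, w, hw, rfl⟩ := S.atlas.cover p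
  have hloc : IsLocalMax (fun y => x ((S.atlas.chart j).proj y) b) w :=
    Filter.Eventually.of_forall fun y => hp (mem_univ _)
  have h0 : c = 0 := by
    rw [← hc ((S.atlas.chart j).proj w), hE j w hw, hloc.fderiv_eq_zero]
    rfl
  rw [← hE i z hz, hc, h0]

end ToricKahler

end SymplecticTorusOrbifold

end

/-! ### Unique continuation for Killing fields. -/

section

open Set DiffAlg smoothFn

theorem mulVec_mem_ideal {R ι κ : Type*} [CommRing R] [Fintype κ] (I : Ideal R) (C : Matrix ι κ R)
    {v : κ → R} (hv : ∀ k, v k ∈ I) (k : ι) : (C *ᵥ v) k ∈ I := by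
  rw [Matrix.mulVec, dotProduct]
  exact Ideal.sum_mem _ fun l _ => I.mul_mem_left _ (hv l)

/-- The components of a Killing field and of its covariant derivative form a closed linear
system. -/
theorem DiffAlg.IsLeviCivita.deriv_mem_of_killing {R : Type*} [CommRing R] [Algebra ℝ R] {ι : Type*}
    [Fintype ι] [DecidableEq ι] {d : ι → Derivation ℝ R R} {g : Matrix ι ι R} {Γ : ι → Matrix ι ι R}
    (h : IsLeviCivita d g Γ) (X : ι → R) (hX : (g * covVec d Γ X)ᵀ = - (g * covVec d Γ X))
    (I : Ideal R) (hXI : ∀ k, X k ∈ I) (hBI : ∀ k a, covVec d Γ X k a ∈ I) :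
    (∀ a k, d a (X k) ∈ I) ∧ ∀ a k b, d a (covVec d Γ X k b) ∈ I := by
  constructor
  · intro a k
    have : d a (X k) = covVec d Γ X k a - (Γ a *ᵥ X) k := by
      rw [covVec, Matrix.of_apply, add_sub_cancel_right]
    rw [this]
    exact I.sub_mem (hBI k a) (mulVec_mem_ideal I _ hXI k)
  · intro a k b
    have hE : covEndo d Γ a (covVec d Γ X) k b ∈ I := by
      have e : covEndo d Γ a (covVec d Γ X) = g⁻¹ * (g * covEndo d Γ a (covVec d Γ X)) := by
        rw [← Matrix.mul_assoc, Matrix.nonsing_inv_mul _ h.isUnit, Matrix.one_mul]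
      rw [e, Matrix.mul_apply]
      refine Ideal.sum_mem _ fun c _ => I.mul_mem_left _ ?_
      rw [h.covEndo_covVec_of_killing X hX]
      exact mulVec_mem_ideal I _ (mulVec_mem_ideal I _ hXI) a
    have : d a (covVec d Γ X k b) = covEndo d Γ a (covVec d Γ X) k b
        - ((Γ a * covVec d Γ X) k b - (covVec d Γ X * Γ a) k b) := by
      simp [covEndo]
    rw [this, Matrix.mul_apply, Matrix.mul_apply]
    exact I.sub_mem hE (I.sub_mem (Ideal.sum_mem _ fun l _ => I.mul_mem_left _ (hBI l b))
      (Ideal.sum_mem _ fun l _ => I.mul_mem_right _ (hBI k l)))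

section Chart

variable {m : ℕ} {O : Set (Fin m → ℝ)}

/-- A family of smooth functions whose differentials are linear combinations of the family vanishes
on a connected open set as soon as it vanishes at a point. -/
theorem eq_zero_of_pd_mem_span (hO : IsOpen O) (hc : IsPreconnected O) {κ : Type*} [Fintype κ]
    (u : κ → smoothFn O) (hu : ∀ a j, pd hO a (u j) ∈ Ideal.span (range u)) (z₀ : O)
    (h0 : ∀ j, ev z₀ (u j) = 0) (j : κ) : u j = 0 := by
  have hex : ∀ a j, ∃ L : κ → smoothFn O, ∑ k, L k * u k = pd hO a (u j) := fun a j =>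
    Ideal.mem_span_range_iff_exists_fun.1 (hu a j)
  choose L hL using hex
  have hcont : ∀ f : smoothFn O, ContinuousOn (rep f) O := fun f => (contDiffOn_rep f).continuousOn
  -- Along the segment from `z` to a nearby `w` the family solves a linear differential equation
  -- with bounded coefficients and zero initial value, so Grönwall's inequality makes it zero.
  have hopen : ∀ z : O, (∀ j, ev z (u j) = 0) → ∀ᶠ w in 𝓝 (z : Fin m → ℝ), ∀ j, rep (u j) w = 0 := by
    intro z hz
    obtain ⟨r, hr, hball⟩ := Metric.nhds_basis_closedBall.mem_iff.1 (hO.mem_nhds z.2)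
    filter_upwards [Metric.ball_mem_nhds (z : Fin m → ℝ) hr] with w hw
    set v : Fin m → ℝ := w - z with hv
    have hγ : ∀ t ∈ Icc (0 : ℝ) 1, (z : Fin m → ℝ) + t • v ∈ Metric.closedBall (z : Fin m → ℝ) r := by
      intro t ht
      rw [Metric.mem_closedBall, dist_eq_norm, add_sub_cancel_left, norm_smul, Real.norm_eq_abs,
        abs_of_nonneg ht.1]
      have : ‖v‖ ≤ r := by
        rw [hv, ← dist_eq_norm]; exact (Metric.mem_ball.1 hw).le
      nlinarith [norm_nonneg v, ht.2]
    have hG : ContinuousOn (fun y => ∑ a, ∑ j, ∑ k, |v a| * |rep (L a j k) y|)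
        (Metric.closedBall (z : Fin m → ℝ) r) :=
      continuousOn_finsetSum _ fun a _ => continuousOn_finsetSum _ fun j _ =>
        continuousOn_finsetSum _ fun k _ =>
          continuousOn_const.mul (((hcont _).mono hball).abs)
    obtain ⟨C, hC⟩ := (isCompact_closedBall (z : Fin m → ℝ) r).bddAbove_image hG
    have hCb : ∀ y ∈ Metric.closedBall (z : Fin m → ℝ) r,
        ∑ a, ∑ j, ∑ k, |v a| * |rep (L a j k) y| ≤ C := fun y hy => hC (mem_image_of_mem _ hy)
    let U : ℝ → κ → ℝ := fun t j => rep (u j) (z + t • v)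
    let U' : ℝ → κ → ℝ := fun t j => ∑ a, v a * ∑ k, rep (L a j k) (z + t • v) * U t k
    have hU : ∀ t ∈ Icc (0 : ℝ) 1, HasDerivAt U (U' t) t := by
      intro t ht
      refine hasDerivAt_pi.2 fun j => ?_
      have hy := hball (hγ t ht)
      have h1 : HasFDerivAt (rep (u j)) (fderiv ℝ (rep (u j)) (z + t • v)) (z + t • v) :=
        (differentiableAt_rep hO (u j) ⟨_, hy⟩).hasFDerivAt
      have h2 : HasDerivAt (fun s : ℝ => (z : Fin m → ℝ) + s • v) v t := by
        simpa using ((hasDerivAt_id t).smul_const v).const_add (z : Fin m → ℝ)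
      refine (h1.comp_hasDerivAt t h2).congr_deriv ?_
      rw [fderiv_apply_eq_sum]
      refine Finset.sum_congr rfl fun a _ => ?_
      rw [pderiv_eq_ev hO (fun z => rep_apply (u j) z) a ⟨_, hy⟩, ← hL a j, map_sum]
      refine congrArg _ (Finset.sum_congr rfl fun k _ => ?_)
      rw [map_mul]
      exact congrArg₂ _ (rep_apply (L a j k) ⟨_, hy⟩).symm (rep_apply (u k) ⟨_, hy⟩).symm
    have hbound : ∀ t ∈ Ico (0 : ℝ) 1, ‖U' t‖ ≤ C * ‖U t‖ + 0 := by
      intro t ht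
      have hy := hγ t ⟨ht.1, ht.2.le⟩
      have hC0 : 0 ≤ C := le_trans (Finset.sum_nonneg fun a _ => Finset.sum_nonneg fun j _ =>
        Finset.sum_nonneg fun k _ => by positivity) (hCb _ hy)
      rw [add_zero]
      refine (pi_norm_le_iff_of_nonneg (by positivity)).2 fun j => ?_
      rw [Real.norm_eq_abs]
      calc |U' t j| ≤ ∑ a, ∑ k, |v a| * |rep (L a j k) (z + t • v)| * ‖U t‖ := by
            refine (Finset.abs_sum_le_sum_abs _ _).trans (Finset.sum_le_sum fun a _ => ?_)
            rw [abs_mul]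
            simp only [mul_assoc, ← Finset.mul_sum]
            refine mul_le_mul_of_nonneg_left ?_ (abs_nonneg _)
            refine (Finset.abs_sum_le_sum_abs _ _).trans (Finset.sum_le_sum fun k _ => ?_)
            rw [abs_mul]
            exact mul_le_mul_of_nonneg_left (norm_le_pi_norm (U t) k) (abs_nonneg _)
        _ = (∑ a, ∑ k, |v a| * |rep (L a j k) (z + t • v)|) * ‖U t‖ := by
            simp only [Finset.sum_mul]
        _ ≤ C * ‖U t‖ := by
            refine mul_le_mul_of_nonneg_right (le_trans ?_ (hCb _ hy)) (norm_nonneg _)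
            refine Finset.sum_le_sum fun a _ => ?_
            exact Finset.single_le_sum
              (f := fun j => ∑ k, |v a| * |rep (L a j k) ((z : Fin m → ℝ) + t • v)|)
              (fun j _ => Finset.sum_nonneg fun k _ => by positivity) (Finset.mem_univ j)
    have hU0 : ‖U 0‖ ≤ 0 := by
      have : U 0 = 0 := by
        ext j
        simp only [U, zero_smul, add_zero, Pi.zero_apply]
        rw [rep_apply]
        exact hz j
      rw [this, norm_zero]
    have := norm_le_gronwallBound_of_norm_deriv_right_le (f := U) (f' := U') (a := 0) (b := 1)
      (fun t ht => (hU t ht).continuousAt.continuousWithinAt)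
      (fun t ht => (hU t ⟨ht.1, ht.2.le⟩).hasDerivWithinAt) hU0 hbound 1 ⟨zero_le_one, le_rfl⟩
    rw [gronwallBound_ε0_δ0, norm_le_zero_iff] at this
    intro j
    have h1 := congrFun this j
    simpa [U, hv] using h1
  have hcl : IsClopen {z : O | ∀ j, ev z (u j) = 0} := by
    constructor
    · rw [show {z : O | ∀ j, ev z (u j) = 0} = ⋂ j, {z : O | rep (u j) z = 0} by
        ext z
        simp only [mem_iInter, Set.mem_ofPred_eq]
        exact forall_congr' fun j => by rw [rep_apply]; rfl]
      exact isClosed_iInter fun j => isClosed_eq (hcont (u j)).domRestrict continuous_const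
    · rw [isOpen_iff_mem_nhds]
      intro z hz
      filter_upwards [(continuous_subtype_val.tendsto z).eventually (hopen z hz)] with w hw j
      rw [← hw j, rep_apply]
      rfl
  have : PreconnectedSpace O := Subtype.preconnectedSpace hc
  refine ev_injective fun z => ?_
  rcases isClopen_iff.1 hcl with h | h
  · have h1 : z₀ ∈ {z : O | ∀ j, ev z (u j) = 0} := h0
    rw [h] at h1
    exact absurd h1 (notMem_empty _)
  · have h1 : z ∈ {z : O | ∀ j, ev z (u j) = 0} := by rw [h]; exact mem_univ z
    rw [map_zero]
    exact h1 j

/-- A Killing field which vanishes near a point vanishes. -/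
theorem IsMetricOn.killing_eq_zero {g : (Fin m → ℝ) → Matrix (Fin m) (Fin m) ℝ}
    (h : IsMetricOn g O) (hc : IsPreconnected O) {X : Fin m → smoothFn O}
    (hX : lieMetric (pd h.isOpen) h.met X = 0) (z₀ : O) (h0 : ∀ᶠ z in 𝓝 (z₀ : Fin m → ℝ),
      ∀ k, rep (X k) z = 0) : X = 0 := by
  -- The components of `X` together with those of `∇X`. The latter vanish at `z₀` because `X`
  -- vanishes in a neighbourhood.
  let u : Fin m ⊕ (Fin m × Fin m) → smoothFn O :=
    Sum.elim X fun p => covVec (pd h.isOpen) h.conn X p.1 p.2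
  obtain ⟨hdX, hdB⟩ := h.isLeviCivita.deriv_mem_of_killing X (h.killing_skew hX)
    (Ideal.span (range u)) (fun k => Ideal.subset_span ⟨.inl k, rfl⟩)
    (fun k a => Ideal.subset_span ⟨.inr (k, a), rfl⟩)
  have hX0 : ∀ k, ev z₀ (X k) = 0 := fun k => by
    have := h0.self_of_nhds k
    rwa [rep_apply] at this
  have hall := eq_zero_of_pd_mem_span h.isOpen hc u
    (fun a j => by
      rcases j with k | ⟨k, b⟩
      · exact hdX a k
      · exact hdB a k b) z₀ (fun j => by
      rcases j with k | ⟨k, b⟩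
      · exact hX0 k
      · have e1 : ev z₀ (pd h.isOpen b (X k)) = 0 := by
          rw [← pderiv_eq_ev h.isOpen (fun z => rep_apply (X k) z) b z₀, Coord.pderiv]
          have : rep (X k) =ᶠ[𝓝 (z₀ : Fin m → ℝ)] fun _ => 0 := by
            filter_upwards [h0] with z hz using hz k
          rw [this.fderiv_eq]
          simp
        have e2 : ev z₀ (u (.inr (k, b)))
            = ev z₀ (pd h.isOpen b (X k)) + ev z₀ ((h.conn b *ᵥ X) k) := by
          rw [← map_add]; rfl
        rw [e2, e1, ev_mulVec, funext hX0]
        simp [Matrix.mulVec, dotProduct])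
  exact funext fun k => hall (.inl k)

end Chart

end

/-! ### Effectiveness: a nonzero Lie algebra element has no action field vanishing on an open set.
-/

section

open Set DiffAlg smoothFn

namespace SymplecticTorusOrbifold

open OrbifoldChart OrbifoldAtlas

variable {ι : Type*} {n : ℕ} {M : Type*} [TopologicalSpace M] [AddAction (Torus n) M]
  {S : SymplecticTorusOrbifold ι n M} {x : M → Module.Dual ℝ (Fin n → ℝ)}

namespace ToricKahler

variable (K : S.ToricKahler) (hx : S.IsMomentMap x)
include hx

theorem actionField_eq_zero_of_chart (b : Fin n → ℝ) {i : ι} {z₀ : Fin (2 * n) → ℝ}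
    (hz₀ : z₀ ∈ (S.atlas.chart i).dom) (h0 : ∀ᶠ z in 𝓝 z₀, K.actionField x i b z = 0) :
    ∀ z ∈ (S.atlas.chart i).dom, K.actionField x i b z = 0 := by
  have := (K.isKahler.chart i).toIsMetricOn.killing_eq_zero
    (S.atlas.chart i).isConnected_dom.isPreconnected (K.isKillingPotential hx i b) ⟨z₀, hz₀⟩ (by
      filter_upwards [h0, (S.atlas.chart i).isOpen_dom.mem_nhds hz₀] with z hz hzd k
      rw [rep_apply _ ⟨z, hzd⟩]
      exact (K.actionField_eq hx i b ⟨z, hzd⟩ k).symm.trans (congrFun hz k))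
  intro z hz
  ext k
  rw [K.actionField_eq hx i b ⟨z, hz⟩ k, this, Pi.zero_apply, map_zero, Pi.zero_apply]

/-- An action field which vanishes near a point vanishes. -/
theorem actionField_eq_zero [ConnectedSpace M] (b : Fin n → ℝ) {i : ι} {z₀ : Fin (2 * n) → ℝ}
    (hz₀ : z₀ ∈ (S.atlas.chart i).dom) (h0 : ∀ᶠ z in 𝓝 z₀, K.actionField x i b z = 0) (j : ι) :
    ∀ z ∈ (S.atlas.chart j).dom, K.actionField x j b z = 0 := by
  -- Vanishing on one chart passes to each chart whose image meets it. Images of good and of bad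
  -- charts are therefore disjoint open sets covering the connected space.
  let good : Set ι := {i | ∀ z ∈ (S.atlas.chart i).dom, K.actionField x i b z = 0}
  let img : ι → Set M := fun i => (S.atlas.chart i).proj '' (S.atlas.chart i).dom
  have hmeet : ∀ i ∈ good, ∀ j p, p ∈ img i → p ∈ img j → j ∈ good := by
    rintro i hi j _ ⟨z, hz, rfl⟩ ⟨w, hw, e⟩
    obtain ⟨h, hl, hzh, hzw⟩ := S.atlas.compatible i j z hz w hw e.symm
    refine K.actionField_eq_zero_of_chart hx b hw ?_
    have hwt : w ∈ h.target := hzw ▸ h.map_source hzh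
    filter_upwards [h.open_target.mem_nhds hwt] with w' hw'
    have h1 := h.map_target hw'
    have h2 := (K.isVectorField_actionField hx b).natural i j h hl _ h1
    rw [h.right_inv hw', hi _ (hl.source_subset h1), Matrix.mulVec_zero] at h2
    exact h2
  have hcl : IsClopen (⋃ i ∈ good, img i) := by
    refine ⟨?_, isOpen_biUnion fun i _ => isOpen_range⟩
    have : (⋃ i ∈ good, img i)ᶜ = ⋃ j ∈ goodᶜ, img j := by
      ext p
      constructor
      · intro hp
        obtain ⟨j, w, hw, rfl⟩ := S.atlas.cover p
        refine mem_iUnion₂.2 ⟨j, fun hj => hp (mem_iUnion₂.2 ⟨j, hj, w, hw, rfl⟩), w, hw, rfl⟩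
      · intro hp hp'
        obtain ⟨j, hj, hpj⟩ := mem_iUnion₂.1 hp
        obtain ⟨i, hi, hpi⟩ := mem_iUnion₂.1 hp'
        exact hj (hmeet i hi j p hpi hpj)
    rw [← isOpen_compl_iff, this]
    exact isOpen_biUnion fun i _ => isOpen_range
  have huniv : (⋃ i ∈ good, img i) = univ := hcl.eq_univ
    ⟨_, mem_iUnion₂.2 ⟨i, K.actionField_eq_zero_of_chart hx b hz₀ h0, z₀, hz₀, rfl⟩⟩
  obtain ⟨w, hw⟩ := (S.atlas.chart j).isConnected_dom.nonempty
  have hp : (S.atlas.chart j).proj w ∈ ⋃ i ∈ good, img i := by rw [huniv]; exact mem_univ _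
  obtain ⟨i, hi, hpi⟩ := mem_iUnion₂.1 hp
  exact hmeet i hi j _ hpi ⟨w, hw, rfl⟩

/-- By effectiveness of the action, an action field which vanishes near a point is induced by
`b = 0`. -/
theorem eq_zero_of_actionField_eq_zero [ConnectedSpace M] (b : Fin n → ℝ) {i : ι}
    {z₀ : Fin (2 * n) → ℝ} (hz₀ : z₀ ∈ (S.atlas.chart i).dom)
    (h0 : ∀ᶠ z in 𝓝 z₀, K.actionField x i b z = 0) : b = 0 := by
  have hX := K.actionField_eq_zero hx b hz₀ h0
  -- With zero velocity the lifted flow lines are constant, so `s ↦ exp (s b) · p` is locally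
  -- constant on the line.
  have hfix : ∀ (s : ℝ) (p : M), Torus.exp (s • b) +ᵥ p = p := by
    intro s p
    have hlc : IsLocallyConstant fun s : ℝ => Torus.exp (s • b) +ᵥ p := by
      rw [IsLocallyConstant.iff_eventually_eq]
      intro s₀
      obtain ⟨j, w, hw, e⟩ := S.atlas.cover (Torus.exp (s₀ • b) +ᵥ p)
      obtain ⟨F, O, hfl, hwO, hFw, hp⟩ := K.exists_flow hx hw
      have hpath : Continuous fun t : ℝ => (t • b, w) := by fun_prop
      have hmem : {t : ℝ | (t • b, w) ∈ O} ∈ 𝓝 (0 : ℝ) := by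
        refine hpath.continuousAt.preimage_mem_nhds (hfl.isOpen.mem_nhds ?_)
        simpa only [zero_smul] using hwO
      obtain ⟨ε, hε, hball⟩ := Metric.mem_nhds_iff.1 hmem
      have hder : ∀ t ∈ Metric.ball (0 : ℝ) ε, HasDerivAt (fun t : ℝ => F (t • b, w)) 0 t := by
        intro t ht
        have h1 : HasDerivAt (fun t : ℝ => (t • b, w)) (b, (0 : Fin (2 * n) → ℝ)) t := by
          have : HasDerivAt (fun t : ℝ => t • b) b t := by
            simpa using (hasDerivAt_id t).smul_const b
          exact this.prodMk (hasDerivAt_const _ _)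
        have h2 := (hfl.hasFDerivAt (hball ht)).comp_hasDerivAt t h1
        rwa [hfl.deriv _ (hball ht), hX j _ (hfl.map _ (hball ht))] at h2
      have hconst : ∀ t ∈ Metric.ball (0 : ℝ) ε, F (t • b, w) = w := by
        intro t ht
        have := Metric.isOpen_ball.is_const_of_deriv_eq_zero (convex_ball (0 : ℝ) ε).isPreconnected
          (fun t ht => (hder t ht).differentiableAt.differentiableWithinAt)
          (fun t ht => (hder t ht).deriv) ht (Metric.mem_ball_self hε)
        rw [this, zero_smul, hFw]
      have hsub : Filter.Tendsto (fun s : ℝ => s - s₀) (𝓝 s₀) (𝓝 0) := by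
        have : Continuous fun s : ℝ => s - s₀ := by fun_prop
        simpa using this.tendsto s₀
      filter_upwards [hsub (Metric.ball_mem_nhds 0 hε)] with s hs
      have h1 := (hp _ (hball hs)).2
      rw [hconst _ hs, e] at h1
      rw [h1, ← add_vadd, ← Torus.exp_add, ← add_smul, sub_add_cancel]
    have := hlc.apply_eq_of_preconnectedSpace s 0
    simpa [Torus.exp_zero] using this
  have hexp : ∀ s : ℝ, Torus.exp (s • b) = 0 := fun s => S.effective _ (hfix s)
  ext k
  by_contra hne
  rw [Pi.zero_apply] at hne
  -- This time sends the `k`-th coordinate to `1 / 2`, which is not an integer.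
  have h1 := congrFun (hexp (1 / (2 * b k))) k
  have h2 : ((1 / (2 * b k) * b k : ℝ) : UnitAddCircle) = 0 := h1
  rw [AddCircle.coe_eq_zero_iff] at h2
  obtain ⟨N, hN⟩ := h2
  have h3 : (N : ℝ) * 2 = 1 := by
    rw [zsmul_eq_mul, mul_one] at hN
    rw [hN]
    field_simp
  have h4 : N * 2 = 1 := by exact_mod_cast h3
  omega

theorem actionField_eq_sum (i : ι) (b : Fin n → ℝ) {z : Fin (2 * n) → ℝ}
    (hz : z ∈ (S.atlas.chart i).dom) : K.actionField x i b z
      = Fintype.linearCombination ℝ (fun k => K.actionField x i (Pi.single k 1) z) b := by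
  have e1 : ∀ l, Coord.pderiv l (fun y => x ((S.atlas.chart i).proj y) b) z = ∑ k, b k *
      Coord.pderiv l (fun y => x ((S.atlas.chart i).proj y) (Pi.single k 1)) z := by
    intro l
    have e : (fun y => x ((S.atlas.chart i).proj y) b)
        = fun y => ∑ k, b k * x ((S.atlas.chart i).proj y) (Pi.single k 1) := by
      ext y
      conv_lhs => rw [pi_eq_sum_univ' b, map_sum]
      exact Finset.sum_congr rfl fun k _ => by rw [map_smul, smul_eq_mul]
    have hd : ∀ k ∈ Finset.univ, HasFDerivAt
        (fun y => b k * x ((S.atlas.chart i).proj y) (Pi.single k 1)) _ z := fun k _ =>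
      ((((hx.smooth (Pi.single k 1) i).differentiableOn (by simp) z hz).differentiableAt
        ((S.atlas.chart i).isOpen_dom.mem_nhds hz)).hasFDerivAt).const_mul (b k)
    rw [e, Coord.pderiv, (HasFDerivAt.fun_sum hd).fderiv]
    simp [Coord.pderiv]
  have e2 : Coord.grad (K.g i) (fun y => x ((S.atlas.chart i).proj y) b) z
      = ∑ k, b k • Coord.grad (K.g i)
        (fun y => x ((S.atlas.chart i).proj y) (Pi.single k 1)) z := by
    ext l
    simp only [Coord.grad, e1, Finset.sum_apply, Pi.smul_apply, smul_eq_mul, Finset.mul_sum]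
    rw [Finset.sum_comm]
    exact Finset.sum_congr rfl fun _ _ => Finset.sum_congr rfl fun _ _ => by ring
  rw [Fintype.linearCombination_apply, actionField, e2, Matrix.mulVec_sum]
  exact Finset.sum_congr rfl fun k _ => by rw [Matrix.mulVec_smul]; rfl

end ToricKahler

end SymplecticTorusOrbifold

end

/-! ### Linear independence of the action fields on a dense set. -/

section

open Set DiffAlg smoothFn

theorem Matrix.PosDef.eq_zero_of_dotProduct {m : ℕ} {G : Matrix (Fin m) (Fin m) ℝ} (hG : G.PosDef)
    {v : Fin m → ℝ} (h : v ⬝ᵥ G *ᵥ v = 0) : v = 0 := by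
  by_contra hne
  have := hG.dotProduct_mulVec_pos hne
  rw [star_trivial, h] at this
  exact lt_irrefl _ this

theorem Matrix.PosDef.isUnit_det_gram {m : ℕ} {κ : Type*} [Fintype κ] [DecidableEq κ]
    {G : Matrix (Fin m) (Fin m) ℝ} (hG : G.PosDef) {w : κ → Fin m → ℝ}
    (hw : LinearIndependent ℝ w) : IsUnit (Matrix.of fun a j => w a ⬝ᵥ G *ᵥ w j).det := by
  rw [isUnit_iff_ne_zero]
  intro h0
  obtain ⟨y, hy, e⟩ := Matrix.exists_mulVec_eq_zero_iff.2 h0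
  refine hy ?_
  have h1 : (∑ a, y a • w a) ⬝ᵥ G *ᵥ (∑ a, y a • w a) = 0 := by
    rw [sum_dotProduct]
    refine Finset.sum_eq_zero fun a _ => ?_
    have := congrFun e a
    simp only [Matrix.mulVec, dotProduct, Matrix.of_apply, Pi.zero_apply] at this
    rw [smul_dotProduct, Matrix.mulVec_sum, dotProduct_sum]
    have e2 : ∑ j, w a ⬝ᵥ G *ᵥ (y j • w j) = 0 := by
      rw [← this]
      refine Finset.sum_congr rfl fun j _ => ?_
      rw [Matrix.mulVec_smul, dotProduct_smul, smul_eq_mul, mul_comm]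
      rfl
    rw [e2, smul_zero]
  exact funext (Fintype.linearIndependent_iff.1 hw y (hG.eq_zero_of_dotProduct h1))

theorem fderiv_field_eq_sum {m : ℕ} {O : Set (Fin m → ℝ)} (hO : IsOpen O)
    {X X' : (Fin m → ℝ) → (Fin m → ℝ)} {Y Y' : Fin m → smoothFn O}
    (hX : ∀ (z : O) k, X z k = ev z (Y k)) (hX' : ∀ (z : O) k, X' z k = ev z (Y' k)) (z : O)
    (k : Fin m) : fderiv ℝ X' z (X z) k = ev z (∑ c, Y c * pd hO c (Y' k)) := by
  have hd : DifferentiableAt ℝ X' z := by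
    refine differentiableAt_pi.2 fun k => ?_
    exact ((contDiffOn_of_ev fun z => hX' z k).differentiableOn (by simp) z
      z.2).differentiableAt (hO.mem_nhds z.2)
  rw [fderiv_apply_component hd, fderiv_apply_eq_sum, map_sum]
  refine Finset.sum_congr rfl fun c _ => ?_
  rw [hX, pderiv_eq_ev hO (fun z => hX' z k) c z, map_mul]

namespace SymplecticTorusOrbifold

open OrbifoldChart OrbifoldAtlas

variable {ι : Type*} {n : ℕ} {M : Type*} [TopologicalSpace M] [AddAction (Torus n) M]
  {S : SymplecticTorusOrbifold ι n M} {x : M → Module.Dual ℝ (Fin n → ℝ)}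

namespace ToricKahler

variable (K : S.ToricKahler) (hx : S.IsMomentMap x)
include hx

theorem contDiffOn_actionField (i : ι) (b : Fin n → ℝ) (k : Fin (2 * n)) :
    ContDiffOn ℝ ∞ (fun z => K.actionField x i b z k) (S.atlas.chart i).dom :=
  (K.isVectorField_actionField hx b).smooth i k

theorem fderiv_actionField_comm {i : ι} {z : Fin (2 * n) → ℝ} (hz : z ∈ (S.atlas.chart i).dom)
    (a b : Fin n → ℝ) : fderiv ℝ (K.actionField x i b) z (K.actionField x i a z)
      = fderiv ℝ (K.actionField x i a) z (K.actionField x i b z) := by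
  obtain ⟨F, O, hfl, hzO, hFz, hp⟩ := K.exists_flow hx hz
  have := hfl.commute hzO a b
  rwa [hFz] at this

/-- The action fields of a basis are linearly independent on a dense set. -/
theorem exists_linearIndependent [ConnectedSpace M] {i : ι} {U : Set (Fin (2 * n) → ℝ)}
    (hU : IsOpen U) (hUd : U ⊆ (S.atlas.chart i).dom) (hne : U.Nonempty) :
    ∃ z ∈ U, LinearIndependent ℝ fun k : Fin n => K.actionField x i (Pi.single k 1) z := by
  classical
  let v : Fin n → (Fin (2 * n) → ℝ) → (Fin (2 * n) → ℝ) := fun k =>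
    K.actionField x i (Pi.single k 1)
  -- Sets of basis vectors whose action fields are independent at some point of `U`. For a largest
  -- such `s` and an index `k` outside it, the field of `k` is a combination of those of `s`
  -- wherever the latter are independent.
  let P : Finset (Finset (Fin n)) := Finset.univ.filter fun s =>
    ∃ z ∈ U, LinearIndepOn ℝ (fun k => v k z) (s : Set (Fin n))
  obtain ⟨z₁, hz₁⟩ := hne
  obtain ⟨s, hsP, hmax⟩ := Finset.exists_max_image P Finset.card ⟨∅, by
    simp only [P, Finset.mem_filter, Finset.mem_univ, true_and, Finset.coe_empty]
    exact ⟨z₁, hz₁, linearIndepOn_empty ℝ _⟩⟩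
  obtain ⟨z₀, hz₀, hind⟩ := (Finset.mem_filter.1 hsP).2
  by_cases hs : ∀ k, k ∈ s
  · refine ⟨z₀, hz₀, ?_⟩
    have : (s : Set (Fin n)) = univ := eq_univ_of_forall hs
    rw [this, linearIndepOn_univ_iff] at hind
    exact hind
  obtain ⟨k, hk⟩ := not_forall.1 hs
  exfalso
  have hspan : ∀ z ∈ U, LinearIndepOn ℝ (fun k => v k z) (s : Set (Fin n)) →
      ∃ a : ↥(s : Set (Fin n)) → ℝ, ∑ j, a j • v j z = v k z := by
    intro z hz hli
    have hnot : ¬ LinearIndepOn ℝ (fun k => v k z) (insert k (s : Set (Fin n))) := by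
      intro h
      have h1 : insert k s ∈ P := Finset.mem_filter.2 ⟨Finset.mem_univ _, z, hz, by
        rwa [Finset.coe_insert]⟩
      have h2 := hmax _ h1
      rw [Finset.card_insert_of_notMem hk] at h2
      omega
    rw [linearIndepOn_insert (by simpa using hk)] at hnot
    have hmem : v k z ∈ Submodule.span ℝ ((fun k => v k z) '' (s : Set (Fin n))) := by
      by_contra h
      exact hnot ⟨hli, h⟩
    rw [image_eq_range] at hmem
    exact (Submodule.mem_span_range_iff_exists_fun ℝ).1 hmem
  have hvc : ∀ j, ContinuousAt (v j) z₀ := fun j =>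
    (contDiffOn_pi.2 (K.contDiffOn_actionField hx i (Pi.single j 1))).continuousOn.continuousAt
      ((S.atlas.chart i).isOpen_dom.mem_nhds (hUd hz₀))
  have hnear : ∀ᶠ z in 𝓝 z₀, LinearIndepOn ℝ (fun k => v k z) (s : Set (Fin n)) := by
    have hc : ContinuousAt (fun z => fun j : ↥(s : Set (Fin n)) => v j z) z₀ :=
      continuousAt_pi.2 fun j => hvc j
    exact hc.eventually (isOpen_setOfPred_linearIndependent.mem_nhds hind)
  obtain ⟨r, hr, hball⟩ := Metric.mem_nhds_iff.1 (Filter.inter_mem (hU.mem_nhds hz₀) hnear)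
  set B := Metric.ball z₀ r with hB
  have hBd : B ⊆ (S.atlas.chart i).dom := fun z hz => hUd (hball hz).1
  have hz₀B : z₀ ∈ B := Metric.mem_ball_self hr
  have hm := (K.isKahler.chart i).toIsMetricOn
  have hmB := hm.mono Metric.isOpen_ball hBd
  let Y : (Fin n → ℝ) → Fin (2 * n) → smoothFn B := fun b l =>
    of _ ((K.contDiffOn_actionField hx i b l).mono hBd)
  have hY : ∀ b (z : B) l, K.actionField x i b z l = ev z (Y b l) := fun _ _ _ => rfl
  have hlie : ∀ b, lieMetric (pd hmB.isOpen) hmB.met (Y b) = 0 := by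
    intro b
    refine Matrix.ext fun a c => ev_injective fun z => ?_
    have h1 := hm.ev_lieMetric (fun z l => K.actionField_eq hx i b z l) ⟨z, hBd z.2⟩ a c
    have h2 := K.isKillingPotential hx i b
    rw [IsKahlerOn.IsKillingPotential] at h2
    rw [h2, Matrix.zero_apply, map_zero] at h1
    rw [Matrix.zero_apply, map_zero, hmB.ev_lieMetric (hY b)]
    exact h1.symm
  have hbr : ∀ a b l, ∑ c, (Y a c * pd hmB.isOpen c (Y b l) - Y b c * pd hmB.isOpen c (Y a l))
      = 0 := by
    intro a b l
    refine ev_injective fun z => ?_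
    rw [Finset.sum_sub_distrib, map_sub, ← fderiv_field_eq_sum hmB.isOpen (hY a) (hY b),
      ← fderiv_field_eq_sum hmB.isOpen (hY b) (hY a),
      K.fderiv_actionField_comm hx (hBd z.2), sub_self, map_zero]
  let e : ↥(s : Set (Fin n)) → Fin n → ℝ := fun j => Pi.single (j : Fin n) 1
  let Gm : Matrix ↥(s : Set (Fin n)) ↥(s : Set (Fin n)) (smoothFn B) :=
    Matrix.of fun a j => Y (e a) ⬝ᵥ hmB.met *ᵥ Y (e j)
  have hGev : ∀ z, Gm.map (ev z)
      = Matrix.of fun a j : (s : Set (Fin n)) => v a z ⬝ᵥ K.g i z *ᵥ v j z := fun z => by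
    ext a j
    exact hmB.ev_metric z (Y (e a)) (Y (e j))
  have hGz : ∀ z : B, IsUnit (Gm.map (ev z)).det := fun z => by
    rw [hGev]
    exact (hmB.posDef z z.2).isUnit_det_gram (hball z.2).2
  have hGu : IsUnit Gm.det := isUnit_det_of_ev hGz
  -- Solving for the coefficients through the inverse Gram matrix shows that they are smooth.
  let c : ↥(s : Set (Fin n)) → smoothFn B :=
    Gm⁻¹ *ᵥ fun a => Y (e a) ⬝ᵥ hmB.met *ᵥ Y (Pi.single k 1)
  have hcY : ∑ j, c j • Y (e j) = Y (Pi.single k 1) := by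
    ext l : 1
    refine ev_injective fun z => ?_
    obtain ⟨a, ha⟩ := hspan z (hball z.2).1 (hball z.2).2
    have hca : (fun j => ev z (c j)) = a := by
      have h1 : (fun j => ev z (c j)) = (Gm.map (ev z))⁻¹ *ᵥ
          fun j : ↥(s : Set (Fin n)) => v j z ⬝ᵥ K.g i z *ᵥ v k z := by
        ext j
        rw [ev_mulVec, map_ev_inv hGu]
        congr 2
        ext j
        rw [hmB.ev_metric]
        rfl
      have h2 : (fun j : ↥(s : Set (Fin n)) => v j z ⬝ᵥ K.g i z *ᵥ v k z)
          = Gm.map (ev z) *ᵥ a := by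
        ext j
        rw [hGev, ← ha, Matrix.mulVec_sum, dotProduct_sum]
        refine Finset.sum_congr rfl fun j' _ => ?_
        rw [Matrix.mulVec_smul, dotProduct_smul, smul_eq_mul, mul_comm]
        rfl
      rw [h1, h2, Matrix.mulVec_mulVec, Matrix.nonsing_inv_mul _ (hGz z), Matrix.one_mulVec]
    rw [← hY, Finset.sum_apply, map_sum]
    refine Eq.trans ?_ (congrFun ha l)
    rw [Finset.sum_apply]
    refine Finset.sum_congr rfl fun j _ => ?_
    rw [Pi.smul_apply, smul_eq_mul, map_mul, congrFun hca j, Pi.smul_apply, smul_eq_mul]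
    rfl
  have hdc : ∀ u j, pd hmB.isOpen u (c j) = 0 := fun u j => by
    refine hmB.isLeviCivita.deriv_coeff_eq_zero (fun j => hlie (e j)) ?_
      (fun a b l => hbr (e a) (e b) l) ?_ ?_ u j
    · rw [hcY]; exact hlie _
    · intro a l
      rw [hcY]
      exact hbr _ _ l
    · intro y hy
      have h1 : Gm *ᵥ y = 0 := by
        ext a : 1
        rw [Pi.zero_apply, ← hy a]
        exact Finset.sum_congr rfl fun j _ => mul_comm _ _
      have h2 : Gm⁻¹ *ᵥ (Gm *ᵥ y) = y := by
        rw [Matrix.mulVec_mulVec, Matrix.nonsing_inv_mul _ hGu, Matrix.one_mulVec]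
      rw [← h2, h1, Matrix.mulVec_zero]
  have hconst : ∀ j (z : B), ev z (c j) = ev ⟨z₀, hz₀B⟩ (c j) := by
    intro j z
    have h1 := Metric.isOpen_ball.is_const_of_fderiv_eq_zero (𝕜 := ℝ) (f := rep (c j))
      (convex_ball z₀ r).isPreconnected ((contDiffOn_rep (c j)).differentiableOn (by simp))
      (fun y hy => by
        ext w
        rw [fderiv_apply_eq_sum]
        refine Finset.sum_eq_zero fun u _ => ?_
        rw [pderiv_eq_ev hmB.isOpen (fun z => rep_apply (c j) z) u ⟨y, hy⟩, hdc, map_zero,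
          mul_zero]) z.2 hz₀B
    rwa [rep_apply, rep_apply (c j) ⟨z₀, hz₀B⟩] at h1
  -- The coefficients being constant on the ball, the relation among the fields is the vanishing of
  -- the action field of this `b`. Its `k`-th entry is 1, which contradicts effectiveness.
  let b : Fin n → ℝ := Pi.single k 1 - ∑ j, ev ⟨z₀, hz₀B⟩ (c j) • e j
  have hb : b = 0 := by
    refine K.eq_zero_of_actionField_eq_zero hx b (hUd hz₀) ?_
    filter_upwards [Metric.isOpen_ball.mem_nhds hz₀B] with z hz
    have hlin := fun b => K.actionField_eq_sum hx i b (hBd hz)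
    rw [hlin, map_sub, map_sum, ← hlin, sub_eq_zero]
    ext l
    rw [hY (Pi.single k 1) ⟨z, hz⟩ l, ← hcY, Finset.sum_apply, map_sum, Finset.sum_apply]
    refine Finset.sum_congr rfl fun j _ => ?_
    rw [Pi.smul_apply, smul_eq_mul, map_mul, map_smul, ← hlin, Pi.smul_apply, smul_eq_mul, hconst]
    rfl
  have hbk := congrFun hb k
  simp only [b, Pi.sub_apply, Finset.sum_apply, Pi.smul_apply, smul_eq_mul, Pi.zero_apply,
    Pi.single_eq_same] at hbk
  rw [Finset.sum_eq_zero, sub_zero] at hbk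
  · exact one_ne_zero hbk
  · intro j _
    have : k ≠ j := fun h => hk (by rw [h]; exact j.2)
    simp only [e]
    rw [Pi.single_eq_of_ne this, mul_zero]

end ToricKahler

end SymplecticTorusOrbifold

end

/-! ### Orbit directions and their images under `J` span the tangent space. -/

section

open Set DiffAlg smoothFn

namespace SymplecticTorusOrbifold

open OrbifoldChart OrbifoldAtlas

variable {ι : Type*} {n : ℕ} {M : Type*} [TopologicalSpace M] [AddAction (Torus n) M]
  {S : SymplecticTorusOrbifold ι n M} {x : M → Module.Dual ℝ (Fin n → ℝ)}

namespace ToricKahler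

variable (K : S.ToricKahler)

theorem transpose_g {i : ι} {z : Fin (2 * n) → ℝ} (hz : z ∈ (S.atlas.chart i).dom) :
    (K.g i z)ᵀ = K.g i z := by
  have := (K.posDef_g i z hz).isHermitian.eq
  rwa [Matrix.conjTranspose_eq_transpose_of_trivial] at this

theorem g_mul_J {i : ι} {z : Fin (2 * n) → ℝ} (hz : z ∈ (S.atlas.chart i).dom) :
    K.g i z * K.J i z = - ((K.J i z)ᵀ * K.g i z) := by
  have := S.alternating_omega i z hz
  rwa [K.compatible i z hz, Matrix.transpose_mul, Matrix.transpose_transpose,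
    K.transpose_g hz] at this

theorem J_mulVec_actionField {i : ι} {z : Fin (2 * n) → ℝ} (hz : z ∈ (S.atlas.chart i).dom)
    (b : Fin n → ℝ) : K.J i z *ᵥ K.actionField x i b z
      = - Coord.grad (K.g i) (fun y => x ((S.atlas.chart i).proj y) b) z := by
  rw [actionField, Matrix.mulVec_mulVec, K.J_mul_J i z hz, Matrix.neg_mulVec, Matrix.one_mulVec]

variable (hx : S.IsMomentMap x)
include hx

theorem actionField_dotProduct_grad [CompactSpace M] [ConnectedSpace M] (a b : Fin n → ℝ) {i : ι}
    {z : Fin (2 * n) → ℝ} (hz : z ∈ (S.atlas.chart i).dom) :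
    K.actionField x i a z ⬝ᵥ K.g i z *ᵥ
      Coord.grad (K.g i) (fun y => x ((S.atlas.chart i).proj y) b) z = 0 := by
  have h := K.fderiv_actionField hx a b i hz
  rwa [K.isKahler.fderiv_grad (hx.smooth b) i hz, Matrix.dotProduct_mulVec,
    ← Matrix.mulVec_transpose, K.transpose_g hz, dotProduct_comm] at h

/-- At a point where the action fields of a basis are independent, the orbit directions and their
images under `J` span the tangent space. -/
theorem exists_eq_add_of_linearIndependent [CompactSpace M] [ConnectedSpace M] {i : ι}
    {z : Fin (2 * n) → ℝ} (hz : z ∈ (S.atlas.chart i).dom)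
    (hli : LinearIndependent ℝ fun k : Fin n => K.actionField x i (Pi.single k 1) z)
    (w : Fin (2 * n) → ℝ) :
    ∃ a b, K.actionField x i a z + K.J i z *ᵥ K.actionField x i b z = w := by
  let lc := Fintype.linearCombination ℝ (fun k => K.actionField x i (Pi.single k 1) z)
  have hlc : ∀ b, lc b = K.actionField x i b z := fun b => (K.actionField_eq_sum hx i b hz).symm
  have hinj : Function.Injective lc := hli.fintypeLinearCombination_injective
  -- The map `(a, b) ↦ X_a + J X_b` between spaces of dimension `2 n`; injectivity gives
  -- surjectivity.
  let Φ := lc.coprod ((Matrix.toLin' (K.J i z)).comp lc)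
  have hΦ : ∀ q, Φ q = K.actionField x i q.1 z + K.J i z *ᵥ K.actionField x i q.2 z := fun q => by
    simp only [Φ, LinearMap.coprod_apply, LinearMap.comp_apply, Matrix.toLin'_apply, hlc]
  have hΦi : Function.Injective Φ := by
    rw [← LinearMap.ker_eq_bot, LinearMap.ker_eq_bot']
    rintro ⟨a, b⟩ h0
    rw [hΦ] at h0
    -- In the kernel `X_a` equals `grad ⟨x, b⟩`, to which it is orthogonal by isotropy.
    have h1 : K.actionField x i a z = 0 := by
      refine (K.posDef_g i z hz).eq_zero_of_dotProduct ?_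
      have h1 := eq_neg_of_add_eq_zero_left h0
      rw [K.J_mulVec_actionField hz, neg_neg] at h1
      have h2 := K.actionField_dotProduct_grad hx a b hz
      rwa [← h1] at h2
    have h2 : K.actionField x i b z = 0 := by
      rw [h1, zero_add] at h0
      have := congrArg (fun v => K.J i z *ᵥ v) h0
      simp only [Matrix.mulVec_mulVec, K.J_mul_J i z hz, Matrix.neg_mulVec, Matrix.one_mulVec,
        Matrix.mulVec_zero, neg_eq_zero] at this
      exact this
    rw [Prod.mk_eq_zero]
    exact ⟨hinj (by rw [hlc, h1, map_zero]), hinj (by rw [hlc, h2, map_zero])⟩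
  obtain ⟨q, hq⟩ := (LinearMap.injective_iff_surjective_of_finrank_eq_finrank (by
    simp [two_mul])).1 hΦi w
  exact ⟨q.1, q.2, (hΦ q).symm.trans hq⟩

/-- A continuous endomorphism field which vanishes on the orbit directions and on their images
under `J` vanishes. -/
theorem eq_zero_of_mulVec_actionField [CompactSpace M] [ConnectedSpace M] {i : ι}
    {T : (Fin (2 * n) → ℝ) → Matrix (Fin (2 * n)) (Fin (2 * n)) ℝ}
    (hT : ContinuousOn T (S.atlas.chart i).dom)
    (h1 : ∀ z ∈ (S.atlas.chart i).dom, ∀ b, T z *ᵥ K.actionField x i b z = 0)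
    (h2 : ∀ z ∈ (S.atlas.chart i).dom, ∀ b, T z *ᵥ (K.J i z *ᵥ K.actionField x i b z) = 0) :
    ∀ z ∈ (S.atlas.chart i).dom, T z = 0 := by
  by_contra! hcon
  obtain ⟨z₁, hz₁, hne⟩ := hcon
  obtain ⟨z, hz, hli⟩ := K.exists_linearIndependent hx
    (hT.isOpen_inter_preimage (S.atlas.chart i).isOpen_dom isOpen_compl_singleton)
    inter_subset_left ⟨z₁, hz₁, hne⟩
  refine hz.2 (Matrix.toLin'.injective (LinearMap.ext fun w => ?_))
  obtain ⟨a, b, rfl⟩ := K.exists_eq_add_of_linearIndependent hx hz.1 hli w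
  rw [Matrix.toLin'_apply, Matrix.mulVec_add, h1 z hz.1, h2 z hz.1, add_zero, map_zero]
  rfl

end ToricKahler

end SymplecticTorusOrbifold

end

/-! ### Harmonic functions and the Lichnerowicz-Matsushima estimate. -/

section

open Set DiffAlg smoothFn

section Chart

theorem Matrix.PosDef.dotProduct_nonneg {m : ℕ} {G : Matrix (Fin m) (Fin m) ℝ} (hG : G.PosDef)
    (v : Fin m → ℝ) : 0 ≤ v ⬝ᵥ G *ᵥ v := by
  simpa only [star_trivial] using hG.posSemidef.dotProduct_mulVec_nonneg v

variable {m : ℕ} {g J : (Fin m → ℝ) → Matrix (Fin m) (Fin m) ℝ} {O : Set (Fin m → ℝ)}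

theorem Coord.grad_add_const (g : (Fin m → ℝ) → Matrix (Fin m) (Fin m) ℝ)
    (f : (Fin m → ℝ) → ℝ) (c : ℝ) : grad g (fun y => f y + c) = grad g f := by
  ext z k
  simp only [grad, pderiv, fderiv_add_const]

theorem Coord.laplacian_add_const (g : (Fin m → ℝ) → Matrix (Fin m) (Fin m) ℝ)
    (f : (Fin m → ℝ) → ℝ) (c : ℝ) : laplacian g (fun y => f y + c) = laplacian g f := by
  ext z
  rw [laplacian, laplacian, grad_add_const]

namespace IsKahlerOn

variable (h : IsKahlerOn g J O)
include h

theorem trace_hess_add (f f' : smoothFn O) :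
    (h.hess (f + f')).trace = (h.hess f).trace + (h.hess f').trace := by
  have e : h.gr (f + f') = h.gr f + h.gr f' := by
    simp only [IsMetricOn.gr, map_add]
    exact Matrix.mulVec_add _ _ _
  rw [hess, e, covVec_add, Matrix.trace_add]
  rfl

theorem trace_hess_smul (r : ℝ) (f : smoothFn O) :
    (h.hess (r • f)).trace = r • (h.hess f).trace := by
  have e : h.gr (r • f) = r • h.gr f := by
    simp only [IsMetricOn.gr, Derivation.map_smul]
    exact Matrix.mulVec_smul h.met⁻¹ r fun a => pd h.isOpen a f
  have e2 : covVec (pd h.isOpen) h.conn (r • h.gr f) = r • covVec (pd h.isOpen) h.conn (h.gr f) := by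
    refine Matrix.ext fun k a => ?_
    simp only [covVec, Matrix.of_apply, Matrix.mulVec_smul, Pi.smul_apply, Derivation.map_smul,
      Matrix.smul_apply, smul_add]
  rw [hess, e, e2, Matrix.trace_smul]
  rfl

theorem continuousOn_ricci : ContinuousOn (Coord.ricci g) O :=
  continuousOn_pi.2 fun a => continuousOn_pi.2 fun b =>
    (contDiffOn_of_ev (f := ric (pd h.isOpen) h.conn a b) fun z => by
      rw [h.ricci_eq]; rfl).continuousOn

/-- The divergence of the field `∇_Y Y + J ∇_{J Y} Y` for `Y = grad F`, where `F` is an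
eigenfunction of the Laplacian of a Kähler-Einstein metric. -/
theorem le_divergence_kahlerField {lam μ : ℝ} (hric : ∀ z ∈ O, Coord.ricci g z = lam • g z)
    {F : (Fin m → ℝ) → ℝ} (hF : ContDiffOn ℝ ∞ F O)
    (hL : ∀ z ∈ O, Coord.laplacian g F z = μ * F z) {z : Fin m → ℝ} (hz : z ∈ O) :
    (2 * lam - μ) * (Coord.grad g F z ⬝ᵥ g z *ᵥ Coord.grad g F z)
      ≤ Coord.divergence g (Coord.kahlerField g J F) z := by
  let f : smoothFn O := of F hF
  have hg : ∀ z : O, Coord.grad g F z = fun k => ev z (h.gr f k) := fun z =>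
    funext fun k => h.grad_eq (f := f) (fun _ => rfl) k z
  have hH : (h.hess f).trace = (-μ) • f := ev_injective fun z => by
    have h1 := (h.laplacian_eq (f := f) (fun _ => rfl) z).symm.trans (hL z z.2)
    have h2 : ev z (h.hess f).trace = - (μ * F z) := by rw [← h1, neg_neg]; rfl
    rw [ev_smul, neg_mul, h2]
    rfl
  have e := h.divergence_eq (fun z k => h.kahlerField_eq (F := F) (f := f) (fun _ => rfl) z k)
    ⟨z, hz⟩
  simp only at e
  rw [e, h.trace_covVec_kfield, map_add, map_add]
  refine le_trans (le_of_eq ?_) (le_add_of_nonneg_right (h.ev_trace_nonneg f ⟨z, hz⟩))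
  have e1 : ∑ a, h.gr f a * pd h.isOpen a (h.hess f).trace
      = (-μ) • (h.gr f ⬝ᵥ h.met *ᵥ h.gr f) := by
    rw [hH, ← h.sum_pd_mul, Finset.smul_sum]
    refine Finset.sum_congr rfl fun a _ => ?_
    rw [Derivation.map_smul, mul_smul_comm, mul_comm]
  have e2 : ev ⟨z, hz⟩ (h.gr f ⬝ᵥ ric (pd h.isOpen) h.conn *ᵥ h.gr f)
      = lam * (Coord.grad g F z ⬝ᵥ g z *ᵥ Coord.grad g F z) := by
    rw [ev_dotProduct]
    simp only [ev_mulVec]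
    rw [← h.ricci_eq, hric z hz, hg ⟨z, hz⟩]
    change _ ⬝ᵥ (lam • g z) *ᵥ _ = _
    rw [Matrix.smul_mulVec, dotProduct_smul, smul_eq_mul]
  rw [e1, ev_smul, ev_smul, e2, h.ev_metric, ← hg ⟨z, hz⟩]
  ring

end IsKahlerOn

end Chart

namespace OrbifoldAtlas

variable {m : ℕ} {M : Type*} [TopologicalSpace M] {ι : Type*} {A : OrbifoldAtlas ι m M}
  {g J : ι → (Fin m → ℝ) → Matrix (Fin m) (Fin m) ℝ}

namespace IsKahler

variable [T2Space M] [CompactSpace M] (h : A.IsKahler g J) {f : M → ℝ} (hf : A.IsSmooth f)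
include h hf

theorem grad_eq_zero_of_dotProduct {i : ι} {z : Fin m → ℝ} (hz : z ∈ (A.chart i).dom)
    (h0 : Coord.grad (g i) (fun y => f ((A.chart i).proj y)) z ⬝ᵥ
      g i z *ᵥ Coord.grad (g i) (fun y => f ((A.chart i).proj y)) z ≤ 0) :
    Coord.grad (g i) (fun y => f ((A.chart i).proj y)) z = 0 := by
  refine ((h.chart i).posDef z hz).eq_zero_of_dotProduct (le_antisymm h0 ?_)
  exact ((h.chart i).posDef z hz).dotProduct_nonneg _

/-- Harmonic functions on a compact Kähler orbifold have no gradient. -/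
theorem grad_eq_zero_of_laplacian (hL : ∀ i, ∀ z ∈ (A.chart i).dom,
    Coord.laplacian (g i) (fun y => f ((A.chart i).proj y)) z = 0) :
    ∀ i, ∀ z ∈ (A.chart i).dom, Coord.grad (g i) (fun y => f ((A.chart i).proj y)) z = 0 := by
  -- For harmonic `f` the divergence of `f grad f` is `|grad f|²`, which is nonnegative and hence
  -- zero.
  have hdiv : ∀ i, ∀ z ∈ (A.chart i).dom, Coord.divergence (g i)
      (fun y => f ((A.chart i).proj y) •
        Coord.grad (g i) (fun y => f ((A.chart i).proj y)) y) z
      = Coord.grad (g i) (fun y => f ((A.chart i).proj y)) z ⬝ᵥ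
        g i z *ᵥ Coord.grad (g i) (fun y => f ((A.chart i).proj y)) z := by
    intro i z hz
    rw [(h.chart i).divergence_smul (hf i) ((h.isVectorField_grad hf).smooth i) hz,
      h.fderiv_grad hf i hz]
    have := hL i z hz
    rw [Coord.laplacian, neg_eq_zero] at this
    rw [this, mul_zero, add_zero]
  have := h.divergence_eq_zero_of_nonneg hf ((h.isVectorField_grad hf).smul hf) fun i z hz => by
    rw [hdiv i z hz]
    exact ((h.chart i).posDef z hz).dotProduct_nonneg _
  intro i z hz
  refine h.grad_eq_zero_of_dotProduct hf hz (le_of_eq ?_)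
  rw [← hdiv i z hz]
  exact this i z hz

/-- The Lichnerowicz-Matsushima estimate for the eigenvalues of the Laplacian of a compact
Kähler-Einstein orbifold. -/
theorem two_mul_le_of_eigenvalue [ConnectedSpace M] {lam μ : ℝ} (hric : ∀ i, ∀ z ∈ (A.chart i).dom,
    Coord.ricci (g i) z = lam • g i z) (hμ : μ ≠ 0) (hf0 : f ≠ 0)
    (hL : ∀ i, ∀ z ∈ (A.chart i).dom, Coord.laplacian (g i) (fun y => f ((A.chart i).proj y)) z
      = μ * f ((A.chart i).proj z)) : 2 * lam ≤ μ := by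
  by_contra! hlt
  -- If `μ < 2 * lam`, this bound makes the divergence of the Kähler field nonnegative. It is then
  -- zero, and the same bound forces the gradient of `f` to vanish.
  have hle := fun i z hz => (h.chart i).le_divergence_kahlerField (hric i) (hf i) (hL i)
    (z := z) hz
  have h0 := h.divergence_eq_zero_of_nonneg hf (h.isVectorField_kahlerField hf) fun i z hz => by
    refine le_trans (mul_nonneg (sub_nonneg.2 hlt.le) ?_) (hle i z hz)
    exact ((h.chart i).posDef z hz).dotProduct_nonneg _
  have hgrad : ∀ i, ∀ z ∈ (A.chart i).dom,
      Coord.grad (g i) (fun y => f ((A.chart i).proj y)) z = 0 := fun i z hz => by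
    refine h.grad_eq_zero_of_dotProduct hf hz ?_
    have := hle i z hz
    rw [h0 i z hz] at this
    exact nonpos_of_mul_nonpos_right this (sub_pos.2 hlt)
  obtain ⟨c, hc⟩ := h.exists_eq_const_of_grad hf hgrad
  refine hf0 (funext fun p => ?_)
  obtain ⟨i, z, hz, rfl⟩ := A.cover p
  have h1 := hL i z hz
  simp only [hc, Coord.laplacian, Coord.divergence, Coord.grad, Coord.pderiv, fderiv_fun_const] at h1
  simp only [Pi.zero_apply, zero_apply, mul_zero, Finset.sum_const_zero, fderiv_fun_const,
    add_zero, neg_zero] at h1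
  rw [hc, Pi.zero_apply]
  exact (mul_eq_zero.1 h1.symm).resolve_left hμ

end IsKahler

end OrbifoldAtlas

end

/-! ### The Einstein equation, the moment map, and the least nonzero eigenvalue. -/

section

open Set DiffAlg smoothFn

namespace SymplecticTorusOrbifold

open OrbifoldChart OrbifoldAtlas

variable {ι : Type*} {n : ℕ} {M : Type*} [TopologicalSpace M] [AddAction (Torus n) M]
  {S : SymplecticTorusOrbifold ι n M} {x : M → Module.Dual ℝ (Fin n → ℝ)}

namespace ToricKahler

variable (K : S.ToricKahler)

theorem isKahlerEinstein_iff {lam : ℝ} : K.IsKahlerEinstein lam ↔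
    ∀ i, ∀ z ∈ (S.atlas.chart i).dom, Coord.ricci (K.g i) z = lam • K.g i z := by
  refine forall_congr' fun i => forall₂_congr fun z hz => ?_
  rw [ricciForm, K.compatible i z hz, ← Matrix.mul_smul]
  refine ⟨fun h => ?_, fun h => by rw [h]⟩
  have hJ : (K.J i z)ᵀ * (K.J i z)ᵀ = -1 := by
    rw [← Matrix.transpose_mul, K.J_mul_J i z hz, Matrix.transpose_neg, Matrix.transpose_one]
  have := congrArg (fun B => (K.J i z)ᵀ * B) h
  simp only [← Matrix.mul_assoc, hJ, Matrix.neg_mul, Matrix.one_mul, neg_inj] at this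
  exact this

variable (hx : S.IsMomentMap x)
include hx

theorem isSmooth_add_const (α : Module.Dual ℝ (Fin n → ℝ)) (b : Fin n → ℝ) :
    S.atlas.IsSmooth fun p => (x p + α) b :=
  fun i => (hx.smooth b i).add contDiffOn_const

omit hx in
theorem hasLaplacian_add_const_iff {α : Module.Dual ℝ (Fin n → ℝ)} {b : Fin n → ℝ} {h : M → ℝ} :
    K.HasLaplacian (fun p => (x p + α) b) h ↔ K.HasLaplacian (fun p => x p b) h := by
  refine forall_congr' fun i => forall₂_congr fun z hz => ?_
  have := Coord.laplacian_add_const (K.g i) (fun y => x ((S.atlas.chart i).proj y) b) (α b)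
  rw [← this]
  rfl

/-- `d (Δ ⟨x, b⟩) = 2 Ric (grad ⟨x, b⟩, ·)`. -/
theorem fderiv_laplacian {b : Fin n → ℝ} {L : M → ℝ} (hL : K.HasLaplacian (fun p => x p b) L)
    {i : ι} {z : Fin (2 * n) → ℝ} (hz : z ∈ (S.atlas.chart i).dom) (v : Fin (2 * n) → ℝ) :
    fderiv ℝ (fun y => L ((S.atlas.chart i).proj y)) z v = 2 * (v ⬝ᵥ Coord.ricci (K.g i) z *ᵥ
      Coord.grad (K.g i) (fun y => x ((S.atlas.chart i).proj y) b) z) := by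
  have h := K.isKahler.chart i
  have e : ∀ z : (S.atlas.chart i).dom, L ((S.atlas.chart i).proj z)
      = ev z (- (h.hess ((hx.smooth b).loc i)).trace) := fun z => by
    rw [← hL i z z.2, K.isKahler.laplacian_eq (hx.smooth b) i z, map_neg]
  rw [fderiv_apply_eq_sum, dotProduct, Finset.mul_sum]
  refine Finset.sum_congr rfl fun k _ => ?_
  rw [pderiv_eq_ev h.isOpen e k ⟨z, hz⟩, map_neg, map_neg,
    h.pd_trace_hess (K.isKillingPotential hx i b), neg_smul, map_neg, neg_neg, ev_smul, ev_mulVec,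
    ← h.ricci_eq, ← funext (K.isKahler.grad_eq (hx.smooth b) i ⟨z, hz⟩)]
  ring

theorem exists_hasLaplacian (b : Fin n → ℝ) :
    ∃ L, S.atlas.IsSmooth L ∧ K.HasLaplacian (fun p => x p b) L :=
  let ⟨L, hLs, hL⟩ := K.isKahler.exists_laplacian (f := fun p => x p b) (hx.smooth b)
  ⟨L, hLs, fun i z hz => hL i z hz⟩

theorem hasLaplacian_add {a b : Fin n → ℝ} {L L' : M → ℝ} (h : K.HasLaplacian (fun p => x p a) L)
    (h' : K.HasLaplacian (fun p => x p b) L') :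
    K.HasLaplacian (fun p => x p (a + b)) fun p => L p + L' p := by
  intro i z hz
  have e : (hx.smooth (a + b)).loc i = (hx.smooth a).loc i + (hx.smooth b).loc i :=
    ev_injective fun z => map_add (x _) a b
  simp only
  rw [← h i z hz, ← h' i z hz, K.isKahler.laplacian_eq (hx.smooth _) i ⟨z, hz⟩,
    K.isKahler.laplacian_eq (hx.smooth _) i ⟨z, hz⟩,
    K.isKahler.laplacian_eq (hx.smooth _) i ⟨z, hz⟩, e, IsKahlerOn.trace_hess_add, map_add]
  ring

theorem hasLaplacian_smul (r : ℝ) {b : Fin n → ℝ} {L : M → ℝ}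
    (h : K.HasLaplacian (fun p => x p b) L) :
    K.HasLaplacian (fun p => x p (r • b)) fun p => r * L p := by
  intro i z hz
  have e : (hx.smooth (r • b)).loc i = r • (hx.smooth b).loc i :=
    ev_injective fun z => map_smul (x _) r b
  simp only
  rw [← h i z hz, K.isKahler.laplacian_eq (hx.smooth _) i ⟨z, hz⟩,
    K.isKahler.laplacian_eq (hx.smooth _) i ⟨z, hz⟩, e, IsKahlerOn.trace_hess_smul, ev_smul]
  ring

variable [CompactSpace M] [ConnectedSpace M]

/-- On a Kähler-Einstein orbifold, `Δ x - 2 lam x` is constant. -/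
theorem IsKahlerEinstein.exists_const {lam : ℝ} (hE : K.IsKahlerEinstein lam) :
    ∃ c : Module.Dual ℝ (Fin n → ℝ), ∀ b,
      K.HasLaplacian (fun p => x p b) fun p => 2 * lam * x p b + c b := by
  have hE' := K.isKahlerEinstein_iff.1 hE
  have hc : ∀ b, ∃ c : ℝ, K.HasLaplacian (fun p => x p b) fun p => 2 * lam * x p b + c := by
    intro b
    obtain ⟨L, hLs, hL⟩ := K.exists_hasLaplacian hx b
    obtain ⟨c, hc⟩ := IsSmooth.exists_eq_const (A := S.atlas)
      (f := fun p => L p - 2 * lam * x p b)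
      (fun i => (hLs i).sub (contDiffOn_const.mul (hx.smooth b i))) fun i z hz => by
        have hd : ∀ {f : M → ℝ}, S.atlas.IsSmooth f →
            DifferentiableAt ℝ (fun y => f ((S.atlas.chart i).proj y)) z := fun hf =>
          ((hf i).differentiableOn (by simp) z hz).differentiableAt
            ((S.atlas.chart i).isOpen_dom.mem_nhds hz)
        ext v
        rw [fderiv_fun_sub (hd hLs) ((hd (hx.smooth b)).const_mul _),
          fderiv_const_mul (hd (hx.smooth b)), sub_apply, smul_apply,
          K.fderiv_laplacian hx hL hz, K.isKahler.fderiv_grad (hx.smooth b) i hz, hE' i z hz,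
          Matrix.smul_mulVec, dotProduct_smul, Matrix.dotProduct_mulVec, ← Matrix.mulVec_transpose,
          K.transpose_g hz, dotProduct_comm, smul_eq_mul, smul_eq_mul, zero_apply]
        ring
    refine ⟨c, fun i z hz => ?_⟩
    rw [hL i z hz, ← hc ((S.atlas.chart i).proj z)]
    ring
  choose c hc using hc
  -- Comparison at a single point suffices for the linearity of `c`, since both the Laplacian and `x
  -- p` are linear in `b`.
  obtain ⟨p⟩ : Nonempty M := inferInstance
  obtain ⟨i, z, hz, rfl⟩ := S.atlas.cover p
  refine ⟨⟨⟨c, fun a b => ?_⟩, fun r b => ?_⟩, hc⟩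
  · have h1 := (K.hasLaplacian_add hx (hc a) (hc b) i z hz).symm.trans (hc (a + b) i z hz)
    simp only [map_add] at h1
    linarith
  · have h1 := (K.hasLaplacian_smul hx r (hc b) i z hz).symm.trans (hc (r • b) i z hz)
    simp only [map_smul, smul_eq_mul] at h1
    simp only [RingHom.id_apply, smul_eq_mul]
    linarith

/-- A moment map has no constant component. -/
theorem eq_zero_of_grad_eq_zero {b : Fin n → ℝ} (h : ∀ i, ∀ z ∈ (S.atlas.chart i).dom,
    Coord.grad (K.g i) (fun y => x ((S.atlas.chart i).proj y) b) z = 0) : b = 0 := by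
  obtain ⟨p⟩ : Nonempty M := inferInstance
  obtain ⟨i, z, hz, -⟩ := S.atlas.cover p
  refine K.eq_zero_of_actionField_eq_zero hx b hz ?_
  filter_upwards [(S.atlas.chart i).isOpen_dom.mem_nhds hz] with y hy
  rw [actionField, h i y hy, Matrix.mulVec_zero]

/-- Comparing differentials gives `Ric = lam g` on the gradients of the components of `x`. The
tensor `Ric - lam g` is anti-linear for `J` in the sense `T J = -Jᵀ T`, so it also kills the action
fields; by density and continuity it is zero. -/
theorem isKahlerEinstein_of_hasLaplacian {lam : ℝ} {α : Module.Dual ℝ (Fin n → ℝ)}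
    (h : ∀ b, K.HasLaplacian (fun p => (x p + α) b) fun p => 2 * lam * (x p + α) b) :
    K.IsKahlerEinstein lam := by
  rw [isKahlerEinstein_iff]
  intro i
  have hg : ∀ z ∈ (S.atlas.chart i).dom, ∀ b, Coord.ricci (K.g i) z *ᵥ
      Coord.grad (K.g i) (fun y => x ((S.atlas.chart i).proj y) b) z
        = lam • K.g i z *ᵥ Coord.grad (K.g i) (fun y => x ((S.atlas.chart i).proj y) b) z := by
    intro z hz b
    refine dotProduct_eq _ _ fun v => ?_
    rw [dotProduct_comm, dotProduct_comm _ v]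
    have h1 := K.fderiv_laplacian hx (K.hasLaplacian_add_const_iff.1 (h b)) hz v
    have hd : DifferentiableAt ℝ (fun y => x ((S.atlas.chart i).proj y) b) z :=
      ((hx.smooth b i).differentiableOn (by simp) z hz).differentiableAt
        ((S.atlas.chart i).isOpen_dom.mem_nhds hz)
    have e : fderiv ℝ (fun y => 2 * lam * (x ((S.atlas.chart i).proj y) + α) b) z
        = (2 * lam) • fderiv ℝ (fun y => x ((S.atlas.chart i).proj y) b) z := by
      simp only [LinearMap.add_apply]
      rw [fderiv_const_mul (hd.add_const _), fderiv_add_const]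
    rw [e, smul_apply, K.isKahler.fderiv_grad (hx.smooth b) i hz, Matrix.dotProduct_mulVec,
      ← Matrix.mulVec_transpose, K.transpose_g hz, dotProduct_comm, smul_eq_mul] at h1
    rw [dotProduct_smul, smul_eq_mul]
    linarith
  have hT := K.eq_zero_of_mulVec_actionField hx (i := i)
    (T := fun z => Coord.ricci (K.g i) z - lam • K.g i z)
    ((K.isKahler.chart i).continuousOn_ricci.sub
      (ContinuousOn.const_smul
        (continuousOn_pi.2 fun a => continuousOn_pi.2 fun c => (K.form_g.1 i a c).continuousOn)
        lam))
    (fun z hz b => by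
      have e : Coord.ricci (K.g i) z * K.J i z = - ((K.J i z)ᵀ * Coord.ricci (K.g i) z) := by
        have h1 := congrArg (fun B => B * K.J i z)
          ((K.isKahler.chart i).ricci_invariant ⟨z, hz⟩)
        simp only [Matrix.mul_assoc, K.J_mul_J i z hz] at h1
        rw [← h1]
        simp
      rw [actionField, Matrix.mulVec_mulVec, Matrix.sub_mul, Matrix.smul_mul, e, K.g_mul_J hz,
        smul_neg, neg_sub_neg, ← Matrix.mul_smul, ← Matrix.mul_sub, ← Matrix.mulVec_mulVec,
        Matrix.sub_mulVec, hg z hz b, Matrix.smul_mulVec, sub_self, Matrix.mulVec_zero])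
    (fun z hz b => by
      rw [K.J_mulVec_actionField hz, Matrix.mulVec_neg, Matrix.sub_mulVec, hg z hz b,
        Matrix.smul_mulVec, sub_self, neg_zero])
  exact fun z hz => sub_eq_zero.1 (hT z hz)

variable [T2Space M]

/-- For `lam ≠ 0` the constant is absorbed by a translation. For `lam = 0` no translation can remove
it, but then `grad ⟨x, b⟩` has divergence `-c b`; after possibly replacing `b` by `-b` this is
nonnegative, hence zero. -/
theorem IsKahlerEinstein.exists_hasLaplacian {lam : ℝ} (hE : K.IsKahlerEinstein lam) :
    ∃ α : Module.Dual ℝ (Fin n → ℝ), ∀ b,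
      K.HasLaplacian (fun p => (x p + α) b) fun p => 2 * lam * (x p + α) b := by
  obtain ⟨c, hc⟩ := IsKahlerEinstein.exists_const K hx hE
  rcases eq_or_ne lam 0 with rfl | hlam
  · have key : ∀ b, c b ≤ 0 → c b = 0 := by
      intro b hb
      have hdiv : ∀ i, ∀ z ∈ (S.atlas.chart i).dom, Coord.divergence (K.g i)
          (Coord.grad (K.g i) fun y => x ((S.atlas.chart i).proj y) b) z = - c b := by
        intro i z hz
        have := hc b i z hz
        rw [Coord.laplacian] at this
        linarith
      have h0 := K.isKahler.divergence_eq_zero_of_nonneg (hx.smooth b)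
        (K.isKahler.isVectorField_grad (hx.smooth b)) fun i z hz => by
          rw [hdiv i z hz]
          exact neg_nonneg.2 hb
      obtain ⟨p⟩ : Nonempty M := inferInstance
      obtain ⟨i, z, hz, -⟩ := S.atlas.cover p
      have := h0 i z hz
      rwa [hdiv i z hz, neg_eq_zero] at this
    have h0 : c = 0 := by
      refine LinearMap.ext fun b => ?_
      rcases le_total (c b) 0 with hb | hb
      · exact key b hb
      · have := key (-b) (by rw [map_neg]; exact neg_nonpos.2 hb)
        rwa [map_neg, neg_eq_zero] at this
    refine ⟨0, fun b => K.hasLaplacian_add_const_iff.2 fun i z hz => ?_⟩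
    rw [hc b i z hz, h0]
    simp
  · refine ⟨(2 * lam)⁻¹ • c, fun b => K.hasLaplacian_add_const_iff.2 fun i z hz => ?_⟩
    rw [hc b i z hz]
    simp only [LinearMap.add_apply, LinearMap.smul_apply, smul_eq_mul]
    field_simp

/-- The condition `0 < n` provides a `b ≠ 0`, whose moment map component is not constant by
effectiveness. That makes it a nonzero eigenfunction, and it excludes `2 * lam = 0`, since harmonic
functions are constant. -/
theorem IsKahlerEinstein.isLeast_eigenvalue (hn : 0 < n) {lam : ℝ} (hE : K.IsKahlerEinstein lam) :
    IsLeast {μ : ℝ | μ ≠ 0 ∧ K.IsEigenvalue μ} (2 * lam) := by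
  obtain ⟨α, hα⟩ := IsKahlerEinstein.exists_hasLaplacian K hx hE
  refine ⟨?_, ?_⟩
  · let b : Fin n → ℝ := Pi.single ⟨0, hn⟩ 1
    have hb : b ≠ 0 := fun h => one_ne_zero ((Pi.single_eq_same _ _).symm.trans (congrFun h ⟨0, hn⟩))
    have hgrad : ∀ i, Coord.grad (K.g i) (fun y => (x ((S.atlas.chart i).proj y) + α) b)
        = Coord.grad (K.g i) (fun y => x ((S.atlas.chart i).proj y) b) := fun i =>
      Coord.grad_add_const _ _ _
    refine ⟨fun h0 => hb (K.eq_zero_of_grad_eq_zero hx fun i z hz => ?_),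
      fun p => (x p + α) b, isSmooth_add_const hx α b, fun h0 => hb
        (K.eq_zero_of_grad_eq_zero hx fun i z hz => ?_), hα b⟩
    · refine K.isKahler.grad_eq_zero_of_laplacian (hx.smooth b) (fun i z hz => ?_) i z hz
      have := K.hasLaplacian_add_const_iff.1 (hα b) i z hz
      rwa [h0, zero_mul] at this
    · rw [← hgrad]
      have : (fun y => (x ((S.atlas.chart i).proj y) + α) b) = fun _ => 0 :=
        funext fun y => congrFun h0 _
      rw [this]
      ext k
      simp [Coord.grad, Coord.pderiv]
  · rintro μ ⟨hμ, f, hf, hf0, hL⟩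
    exact K.isKahler.two_mul_le_of_eigenvalue hf (K.isKahlerEinstein_iff.1 hE) hμ hf0 hL

end ToricKahler

end SymplecticTorusOrbifold

end

end

theorem mainTheorem5 {ι : Type*} {n : ℕ} (hn : 0 < n) {M : Type*} [TopologicalSpace M]
    [T2Space M] [CompactSpace M] [ConnectedSpace M] [AddAction (Torus n) M]
    (S : SymplecticTorusOrbifold ι n M) (x : M → Module.Dual ℝ (Fin n → ℝ))
    (hx : S.IsMomentMap x) (K : S.ToricKahler) (lam : ℝ) :
    (K.IsKahlerEinstein lam ↔
      ∃ α : Module.Dual ℝ (Fin n → ℝ), ∀ b : Fin n → ℝ,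
        K.HasLaplacian (fun p => (x p + α) b) (fun p => 2 * lam * (x p + α) b)) ∧
    (K.IsKahlerEinstein lam → IsLeast {μ : ℝ | μ ≠ 0 ∧ K.IsEigenvalue μ} (2 * lam)) := by
  exact ⟨⟨fun hE => SymplecticTorusOrbifold.ToricKahler.IsKahlerEinstein.exists_hasLaplacian K hx hE,
    fun ⟨_, h⟩ => K.isKahlerEinstein_of_hasLaplacian hx h⟩,
    fun hE => SymplecticTorusOrbifold.ToricKahler.IsKahlerEinstein.isLeast_eigenvalue K hx hn hE⟩
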